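/- Notation. For $\lambda\ge1$ let $\mathbb T_\lambda=\mathbb R/2\pi\lambda\mathbb Z$ with Lebesgue measure (total mass $2\pi\lambda$), write $\langle x\rangle=1+|x|$, and for functions or distributions $u(t,x)$ on $\mathbb R\times\mathbb T_\lambda$ set $\widehat u(\xi,\tau)=\int_{\mathbb R}\int_{\mathbb T_\lambda}u(t,x)e^{-i(x\xi+t\tau)}\,dx\,dt$ for $\xi\in\lambda^{-1}\mathbb Z$, $\tau\in\mathbb R$ (in the sense of tempered distributions in time), and $$\|u\|_{X^{s,b}_\lambda}=\Big(\frac1\lambda\sum_{\xi\in\lambda^{-1}\mathbb Z}\int_{\mathbb R}\langle\tau+|\xi|\xi\rangle^{2b}\langle\xi\rangle^{2s}|\widehat u(\xi,\tau)|^2\,d\tau\Big)^{1/2}.$$ $J^s_x$ is the Fourier multiplier in $x$ with symbol $(1+|\xi|^2)^{s/2}$, and $P_{\pm}$ are the projections on the frequencies $\pm\xi>0$. Fix $\eta\in C_0^\infty(\mathbb R)$ with $0\le\eta\le1$, $\eta=1$ on $[-1,1]$, $\operatorname{supp}\eta\subset[-2,2]$; put $\phi(\xi)=\eta(\xi)-\eta(2\xi)$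 and let $P_{+hi}=P_+P_{hi}$, where $P_{hi}$ has the symbol $\sum_{k\ge1}\phi(2^{-k}\xi)$. Proposition. Let $s\ge\frac14$. There is a constant $C$, depending only on $s$ and $\eta$, such that for every $\lambda\ge1$ and all complex-valued $W,u\in L^2(\mathbb R\times\mathbb T_\lambda)$ with $W\in X^{s+\frac12,\frac12}_\lambda$, $J_x^su\in L^2(\mathbb R\times\mathbb T_\lambda)\cap L^4(\mathbb R\times\mathbb T_\lambda)$ and $u\in X^{s-1,1}_\lambda$, the product $W\,P_-\partial_xu$ is well defined (for each spatial frequency, the series giving the Fourier coefficient of the product converges absolutely for almost every $t$, with a sum that is integrable in $t$) and $$\|P_{+hi}(W\,P_-\partial_xu)\|_{X^{s+\frac12,-\frac12}_\lambda}\le C\,\|W\|_{X^{s+\frac12,\frac12}_\lambda}\Big(\|J^s_xu\|_{L^2(\mathbb R\times\mathbb T_\lambda)}+\|J^s_xu\|_{L^4(\mathbb R\times\mathbb T_\lambda)}+\|u\|_{X^{s-1,1}_\lambda}\Big).$$ -/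

import Mathlib

open MeasureTheory
open scoped ENNReal NNReal FourierTransform SchwartzMap

namespace BOTorus

/-- The torus `ℝ / 2πλℤ`. Its `volume` is Lebesgue measure, of total mass `2πλ`. -/
abbrev Torus (lam : ℝ) : Type := AddCircle (2 * Real.pi * lam)

instance torusPeriodPos (lam : ℝ) [h : Fact (1 ≤ lam)] : Fact (0 < 2 * Real.pi * lam) :=
  ⟨mul_pos (mul_pos two_pos Real.pi_pos) (lt_of_lt_of_le one_pos h.out)⟩

/-- Time-dependent spatial Fourier coefficients: `c n t` is the coefficient at time `t` of
`x ↦ exp (i ξ x)`, where `ξ = n / λ` (so that `f(t, x) = ∑ n, c n t * exp (i n x / λ)`).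
They describe space-time functions and distributions on `ℝ × ℝ / 2πλℤ`. -/
abbrev Coeffs : Type := ℤ → ℝ → ℂ

/-- The coefficients `(2πλ)⁻¹ ∫ u(t, x) exp (-i n x / λ) dx` of a function of `(t, x)`. -/
noncomputable def coeffs {lam : ℝ} [Fact (1 ≤ lam)] (u : ℝ × Torus lam → ℂ) : Coeffs :=
  fun n t => fourierCoeff (fun x => u (t, x)) n

/-- The Fourier multiplier in space with symbol `m(ξ)`, `ξ = n / λ`. -/
noncomputable def multiplier (lam : ℝ) (m : ℝ → ℂ) (c : Coeffs) : Coeffs :=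
  fun n t => m (n / lam) * c n t

/-- The derivative `∂ₓ`. -/
noncomputable def dx (lam : ℝ) : Coeffs → Coeffs :=
  multiplier lam fun ξ => Complex.I * ξ

/-- The Bessel potential `J_x^s`. -/
noncomputable def bessel (lam s : ℝ) : Coeffs → Coeffs :=
  multiplier lam fun ξ => (((1 + |ξ| ^ 2) ^ (s / 2) : ℝ) : ℂ)

/-- The projection `P₊` on the positive frequencies. -/
noncomputable def projPos (lam : ℝ) : Coeffs → Coeffs :=
  multiplier lam (Set.indicator (Set.Ioi 0) 1)

/-- The projection `P₋` on the negative frequencies. -/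
noncomputable def projNeg (lam : ℝ) : Coeffs → Coeffs :=
  multiplier lam (Set.indicator (Set.Iio 0) 1)

/-- The cutoff functions `η` from which the Littlewood-Paley multipliers are built. -/
structure IsCutoff (η : ℝ → ℝ) : Prop where
  smooth : ContDiff ℝ (⊤ : ℕ∞) η
  nonneg : ∀ ξ, 0 ≤ η ξ
  le_one : ∀ ξ, η ξ ≤ 1
  eq_one : ∀ ξ ∈ Set.Icc (-1 : ℝ) 1, η ξ = 1
  support : tsupport η ⊆ Set.Icc (-2) 2

/-- The dyadic symbol `φ_N(ξ) = φ(ξ / N)`, where `φ(ξ) = η(ξ) - η(2ξ)`. -/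
noncomputable def dyadicSymbol (η : ℝ → ℝ) (N ξ : ℝ) : ℝ :=
  η (ξ / N) - η (2 * (ξ / N))

/-- The operator `P_hi`, the sum of the Littlewood-Paley multipliers `P_N` over the dyadic
numbers `N = 2, 4, 8, …`. At each frequency only finitely many of the symbols are nonzero. -/
noncomputable def projHigh (η : ℝ → ℝ) (lam : ℝ) : Coeffs → Coeffs :=
  multiplier lam fun ξ => ((∑' k : ℕ, dyadicSymbol η (2 ^ (k + 1)) ξ : ℝ) : ℂ)

/-- The operator `P_{+hi} = P₊ P_hi`. -/
noncomputable def projPosHigh (η : ℝ → ℝ) (lam : ℝ) (c : Coeffs) : Coeffs :=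
  projPos lam (projHigh η lam c)

/-- The series for the `n`-th coefficient of a product converges absolutely for almost every
time, and this coefficient is integrable in time. -/
def ProductDefined (a b : Coeffs) : Prop :=
  ∀ n : ℤ, (∀ᵐ t : ℝ, Summable fun m : ℤ => a (n - m) t * b m t) ∧
    Integrable fun t : ℝ => ∑' m : ℤ, a (n - m) t * b m t

/-- The coefficients of a product in physical space: convolution of the coefficients in space,
at each time. -/
noncomputable def product (a b : Coeffs) : Coeffs :=
  fun n t => ∑' m : ℤ, a (n - m) t * b m t

/-- `G` is the Fourier transform `G(τ) = ∫ g(t) exp (-i t τ) dt` of `g` in the sense of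
tempered distributions. Mathlib's `𝓕 φ` has the kernel `exp (-2πi t τ)`, hence the `2π`. Such
a `G` is unique up to null sets. -/
def IsTimeFourier (g G : ℝ → ℂ) : Prop :=
  ∀ φ : 𝓢(ℝ, ℂ),
    Integrable (fun τ => G τ * φ τ) ∧
    Integrable (fun t => g t * 𝓕 (φ : ℝ → ℂ) (t / (2 * Real.pi))) ∧
    ∫ τ, G τ * φ τ = ∫ t, g t * 𝓕 (φ : ℝ → ℂ) (t / (2 * Real.pi))

/-- The bracket `⟨x⟩ = 1 + |x|`. -/
noncomputable def bracket (x : ℝ) : ℝ := 1 + |x|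

/-- The norm of the Bourgain space `X^{s,b}_λ`,
`(λ⁻¹ ∑_{ξ ∈ λ⁻¹ℤ} ∫ ⟨τ + |ξ|ξ⟩^{2b} ⟨ξ⟩^{2s} |û(ξ, τ)|² dτ)^{1/2}`, where
`û(ξ, τ) = ∫∫ u(t, x) exp (-i (xξ + tτ)) dx dt` is `2πλ` times the time Fourier transform `G n`
of the `n`-th coefficient, `ξ = n / λ`. The infimum runs over the versions of `G`, which all
give the same value; it is `∞` if the space-time Fourier transform is not a function. -/
noncomputable def xNorm (lam s b : ℝ) (c : Coeffs) : ℝ≥0∞ :=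
  ⨅ (G : ℤ → ℝ → ℂ) (_ : ∀ n, IsTimeFourier (c n) (G n)),
    (ENNReal.ofReal lam⁻¹ * ∑' n : ℤ, ∫⁻ τ : ℝ,
      ENNReal.ofReal (bracket (τ + |n / lam| * (n / lam)) ^ (2 * b)
        * bracket (n / lam) ^ (2 * s)) * ‖(2 * Real.pi * lam : ℝ) * G n τ‖ₑ ^ 2) ^ (1 / 2 : ℝ)

/-- The norm in `L^p(ℝ × ℝ / 2πλℤ)` of the function with the coefficients `c`. The infimum runs
over the versions of this function, which all have the same norm; it is `∞` if there is no such
function in `L^p`. -/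
noncomputable def spaceTimeNorm (lam : ℝ) [Fact (1 ≤ lam)] (p : ℝ≥0∞) (c : Coeffs) : ℝ≥0∞ :=
  ⨅ (v : ℝ × Torus lam → ℂ) (_ : MemLp v p volume) (_ : ∀ n, coeffs v n =ᵐ[volume] c n),
    eLpNorm v p volume

end BOTorus

open BOTorus

/-! By duality the estimate is a trilinear bound. The product is paired with a test function h of
frequency ξ; write ξ₁ for the frequency of W and ξ₂ for that of u, so ξ = ξ₁ + ξ₂, and σ, σ₁, σ₂ for
the modulations τ + |ξ|ξ of output, W and u. The cutoff forces ξ > 1 and P₋ forces ξ₂ < 0, hence ξ₁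
> 0 whatever the spectrum of W, and σ = σ₁ + σ₂ + 2ξξ₂ (`resonance_identity`): some modulation is at
least of size ξ|ξ₂|. Dividing |ξ₂| by the weights of the three norms leaves a kernel whose square,
for s = 1/4, is bounded by the exponential of `kernelLog`; larger s only helps, because ⟨ξ⟩ ≤
⟨ξ₁⟩⟨ξ₂⟩ (`exp_kernelLog_half_ge`). The weight on u is ⟨ξ₂⟩^(s-1)(⟨ξ₂⟩ + ⟨σ₂⟩), which is controlled
by ‖J^s u‖ in L² together with X^{s-1,1}.

`kernel_le` bounds the squared kernel by three kernels. Each is integrable, uniformly, once one of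
the three space-time frequencies is frozen, and then Cauchy-Schwarz applies (`trilinear_le`). The
natural choice is to freeze the variable with the dominant modulation: the sum or difference of the
other two modulations is then a function of one free frequency, and the distance to its zeros
supplies the decay. This function is linear if σ or σ₂ dominates. If σ₁ dominates it is the
quadratic σ₁ + 2ξ(ξ - ξ₁), which is flat near ξ = ξ₁/2, that is, where ξ and -ξ₂ are almost equal.
There the method alone fails.

In that region the L⁴ norm enters. Cut ξ₁ into blocks [j⁴, (j+1)⁴), of length about j³. For output
near j⁴/2, the symbol iξ₂ of ∂ₓ is replaced by a constant of size at most j³ times the symbol of J^s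
(`frozenSymbol`), but only on the part of W with modulation at least j⁸/10. The error has an
additional factor 1/j, which is enough to make the Cauchy-Schwarz argument work again
(`enorm_pair_sub_le`, `sum_remainder_le`). The frozen main term is h · W · J^s u in physical space,
estimated by Hölder in L⁴ · L² · L⁴ (`enorm_block_le`). The test function h is put in L⁴ by
Bernstein in space, costing (λj³)^(1/4), and by the embedding H^(1/2) ⊂ L⁴ in time; the large
modulation of W gains j⁻⁴. Since j³ · j^(3/4) · j⁻⁴ ≤ 1 every block is bounded, and the blocks are
summed by Cauchy-Schwarz, the output intervals having bounded overlap.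

Uniformity in λ is a matter of scaling: a sum over λ⁻¹ℤ costs a factor λ in the squared kernels,
hence λ^(1/2), which the normalization of the norms absorbs. -/

namespace BOTorus

/-! ### The Fourier transform in time: uniqueness, Plancherel, convolution. -/

/-- The Fourier transform in time of an integrable function. -/
noncomputable def timeFt (g : ℝ → ℂ) (τ : ℝ) : ℂ :=
  ∫ t : ℝ, g t * Complex.exp (-(Complex.I * t * τ))

lemma fourier_div_two_pi (g : ℝ → ℂ) (τ : ℝ) : 𝓕 g (τ / (2 * Real.pi)) = timeFt g τ := by
  rw [Real.fourier_real_eq_integral_exp_smul]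
  refine integral_congr_ae (Filter.Eventually.of_forall fun t => ?_)
  simp only [smul_eq_mul]
  rw [mul_comm]
  congr 2
  push_cast
  have : (Real.pi : ℂ) ≠ 0 := by exact_mod_cast Real.pi_ne_zero
  field_simp

lemma norm_exp_I_mul (t τ : ℝ) : ‖Complex.exp (-(Complex.I * t * τ))‖ = 1 := by
  rw [show -(Complex.I * t * τ) = ((-(t * τ) : ℝ) : ℂ) * Complex.I by push_cast; ring]
  exact Complex.norm_exp_ofReal_mul_I _

lemma integrable_mul_exp {g : ℝ → ℂ} (hg : Integrable g) (τ : ℝ) :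
    Integrable fun t : ℝ => g t * Complex.exp (-(Complex.I * t * τ)) := by
  refine hg.mono (hg.1.mul (by fun_prop)) (Filter.Eventually.of_forall fun t => ?_)
  rw [norm_mul, norm_exp_I_mul, mul_one]

lemma norm_timeFt_le (g : ℝ → ℂ) (τ : ℝ) : ‖timeFt g τ‖ ≤ ∫ t, ‖g t‖ := by
  refine (norm_integral_le_integral_norm _).trans (le_of_eq ?_)
  simp_rw [norm_mul, norm_exp_I_mul, mul_one]

lemma continuous_timeFt {g : ℝ → ℂ} (hg : Integrable g) : Continuous (timeFt g) := by
  refine continuous_of_dominated (F := fun (τ t : ℝ) => g t * Complex.exp (-(Complex.I * t * τ)))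
    (bound := fun t => ‖g t‖) (fun τ => (integrable_mul_exp hg τ).1) (fun τ => ?_) hg.norm ?_
  · filter_upwards with t
    rw [norm_mul, norm_exp_I_mul, mul_one]
  · filter_upwards with t
    fun_prop

/-- The multiplication formula for the Fourier transform in time. -/
lemma integral_mul_timeFt {g h : ℝ → ℂ} (hg : Integrable g) (hh : Integrable h) :
    ∫ τ, timeFt g τ * h τ = ∫ t, g t * timeFt h t := by
  have hint : Integrable (Function.uncurry fun (τ t : ℝ) =>
      g t * Complex.exp (-(Complex.I * t * τ)) * h τ) (volume.prod volume) := by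
    have := (hh.mul_prod hg)
    refine this.mono ?_ (Filter.Eventually.of_forall fun p => ?_)
    · have h1 : AEStronglyMeasurable (fun p : ℝ × ℝ => g p.2) (volume.prod volume) :=
        hg.1.comp_snd
      have h2 : AEStronglyMeasurable (fun p : ℝ × ℝ => h p.1) (volume.prod volume) :=
        hh.1.comp_fst
      exact (h1.mul (by fun_prop)).mul h2
    · simp only [Function.uncurry, norm_mul, norm_exp_I_mul, mul_one]
      rw [mul_comm]
  simp only [timeFt]
  simp_rw [← integral_mul_const, ← integral_const_mul]
  rw [integral_integral_swap hint]
  refine integral_congr_ae (Filter.Eventually.of_forall fun t => ?_)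
  refine integral_congr_ae (Filter.Eventually.of_forall fun τ => ?_)
  simp only
  rw [show Complex.I * (τ : ℂ) * t = Complex.I * t * τ by ring]
  ring

lemma IsTimeFourier.congr_left {g g' G : ℝ → ℂ} (h : IsTimeFourier g G)
    (hg : g =ᵐ[volume] g') : IsTimeFourier g' G := by
  intro φ
  obtain ⟨h1, h2, h3⟩ := h φ
  have : (fun t => g t * 𝓕 (φ : ℝ → ℂ) (t / (2 * Real.pi))) =ᵐ[volume]
      fun t => g' t * 𝓕 (φ : ℝ → ℂ) (t / (2 * Real.pi)) := by
    filter_upwards [hg] with t ht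
    rw [ht]
  exact ⟨h1, h2.congr this, h3.trans (integral_congr_ae this)⟩

lemma IsTimeFourier.congr_right {g G G' : ℝ → ℂ} (h : IsTimeFourier g G)
    (hG : G =ᵐ[volume] G') : IsTimeFourier g G' := by
  intro φ
  obtain ⟨h1, h2, h3⟩ := h φ
  have : (fun t => G t * φ t) =ᵐ[volume] fun t => G' t * φ t := by
    filter_upwards [hG] with t ht
    rw [ht]
  exact ⟨h1.congr this, h2, (integral_congr_ae this).symm.trans h3⟩

lemma IsTimeFourier.const_mul {g G : ℝ → ℂ} (h : IsTimeFourier g G) (a : ℂ) :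
    IsTimeFourier (fun t => a * g t) (fun τ => a * G τ) := by
  intro φ
  obtain ⟨h1, h2, h3⟩ := h φ
  simp_rw [mul_assoc]
  refine ⟨h1.const_mul a, h2.const_mul a, ?_⟩
  rw [integral_const_mul, integral_const_mul, h3]

/-- Testing with a bump function equal to 1 on the compact set suffices. Local integrability is what
makes the fundamental lemma of the calculus of variations available for uniqueness. -/
lemma IsTimeFourier.locallyIntegrable {g G : ℝ → ℂ} (h : IsTimeFourier g G) :
    LocallyIntegrable G := by
  rw [MeasureTheory.locallyIntegrable_iff]
  intro k hk
  obtain ⟨R, hR⟩ := hk.isBounded.subset_closedBall 0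
  let f : ContDiffBump (0 : ℝ) := ⟨|R| + 1, |R| + 2, by positivity, by linarith⟩
  have hc : HasCompactSupport (fun x : ℝ => ((f x : ℝ) : ℂ)) :=
    f.hasCompactSupport.comp_left (g := fun x : ℝ => (x : ℂ)) rfl
  have hd : ContDiff ℝ (⊤ : ℕ∞) (fun x : ℝ => ((f x : ℝ) : ℂ)) :=
    Complex.ofRealCLM.contDiff.comp f.contDiff
  have h1 := (h (hc.toSchwartzMap hd)).1
  refine (h1.integrableOn (s := k)).congr_fun_ae ?_
  filter_upwards [ae_restrict_mem hk.measurableSet] with x hx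
  have hx' := hR hx
  have : f x = 1 := by
    apply f.one_of_mem_closedBall
    simp only [Metric.mem_closedBall, dist_zero_right] at hx' ⊢
    exact hx'.trans ((le_abs_self R).trans (by simp [f]))
  simp [this]

/-- A function has at most one Fourier transform in time, up to null sets. -/
lemma IsTimeFourier.ae_eq {g G G' : ℝ → ℂ} (h : IsTimeFourier g G) (h' : IsTimeFourier g G') :
    G =ᵐ[volume] G' := by
  refine ae_eq_of_integral_contDiff_smul_eq h.locallyIntegrable h'.locallyIntegrable ?_
  intro φ hφ hφc
  have hc : HasCompactSupport (fun x : ℝ => ((φ x : ℝ) : ℂ)) :=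
    hφc.comp_left (g := fun x : ℝ => (x : ℂ)) rfl
  have hd : ContDiff ℝ (⊤ : ℕ∞) (fun x : ℝ => ((φ x : ℝ) : ℂ)) :=
    Complex.ofRealCLM.contDiff.comp hφ
  have e := (h (hc.toSchwartzMap hd)).2.2.trans (h' (hc.toSchwartzMap hd)).2.2.symm
  simpa [mul_comm] using e

lemma isTimeFourier_timeFt {g : ℝ → ℂ} (hg : Integrable g) : IsTimeFourier g (timeFt g) := by
  intro φ
  have hφ : Integrable (φ : ℝ → ℂ) := φ.integrable
  simp_rw [fourier_div_two_pi]
  refine ⟨?_, ?_, integral_mul_timeFt hg hφ⟩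
  · exact hφ.bdd_mul (c := ∫ t, ‖g t‖) (continuous_timeFt hg).aestronglyMeasurable
      (Filter.Eventually.of_forall fun τ => norm_timeFt_le g τ)
  · exact hg.mul_bdd (c := ∫ t, ‖φ t‖) (continuous_timeFt hφ).aestronglyMeasurable
      (Filter.Eventually.of_forall fun τ => norm_timeFt_le φ τ)

lemma integral_comp_two_pi_mul (f : ℝ → ℂ) :
    (2 * Real.pi : ℂ) * ∫ x : ℝ, f (2 * Real.pi * x) = ∫ x, f x := by
  rw [Measure.integral_comp_mul_left f (2 * Real.pi),
    abs_of_pos (inv_pos.2 Real.two_pi_pos), Complex.real_smul, ← mul_assoc]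
  have : (Real.pi : ℂ) ≠ 0 := by exact_mod_cast Real.pi_ne_zero
  push_cast
  field_simp

lemma lintegral_comp_two_pi_mul (f : ℝ → ℝ≥0∞) :
    ENNReal.ofReal (2 * Real.pi) * ∫⁻ x : ℝ, f (2 * Real.pi * x) = ∫⁻ x, f x := by
  have h := Real.smul_map_volume_mul_left Real.two_pi_pos.ne'
  conv_rhs => rw [← h]
  rw [lintegral_smul_measure, abs_of_pos Real.two_pi_pos, smul_eq_mul,
    (Homeomorph.mulLeft₀ (2 * Real.pi) Real.two_pi_pos.ne').measurableEmbedding.lintegral_map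
      (g := fun x => 2 * Real.pi * x)]

lemma quasiMeasurePreserving_div_two_pi :
    Measure.QuasiMeasurePreserving (fun x : ℝ => x / (2 * Real.pi)) volume volume := by
  refine ⟨by fun_prop, ?_⟩
  have h := Real.smul_map_volume_mul_right (a := (2 * Real.pi)⁻¹)
    (inv_ne_zero Real.two_pi_pos.ne')
  simp_rw [div_eq_mul_inv]
  conv_rhs => rw [← h]
  refine Measure.absolutelyContinuous_smul ?_
  rw [abs_of_pos (inv_pos.2 Real.two_pi_pos)]
  simp [Real.pi_pos]

lemma quasiMeasurePreserving_two_pi_mul :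
    Measure.QuasiMeasurePreserving (fun x : ℝ => 2 * Real.pi * x) volume volume := by
  refine ⟨by fun_prop, ?_⟩
  have h := Real.smul_map_volume_mul_left Real.two_pi_pos.ne'
  conv_rhs => rw [← h]
  refine Measure.absolutelyContinuous_smul ?_
  rw [abs_of_pos Real.two_pi_pos]
  simp [Real.pi_pos]

lemma memLp_two_iff_lintegral {α : Type*} [MeasurableSpace α] {μ : Measure α} {f : α → ℂ} :
    MemLp f 2 μ ↔ AEStronglyMeasurable f μ ∧ ∫⁻ x, ‖f x‖ₑ ^ 2 ∂μ < ∞ := by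
  unfold MemLp
  refine and_congr_right fun _ => ?_
  rw [eLpNorm_lt_top_iff_lintegral_rpow_enorm_lt_top two_ne_zero ENNReal.ofNat_ne_top]
  simp

lemma memLp_comp_div_two_pi {f : ℝ → ℂ} (hf : MemLp f 2) :
    MemLp (fun τ => f (τ / (2 * Real.pi))) 2 ∧
      ∫⁻ τ, ‖f (τ / (2 * Real.pi))‖ₑ ^ 2 = ENNReal.ofReal (2 * Real.pi) * ∫⁻ x, ‖f x‖ₑ ^ 2 := by
  have h2 : ∫⁻ τ, ‖f (τ / (2 * Real.pi))‖ₑ ^ 2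
      = ENNReal.ofReal (2 * Real.pi) * ∫⁻ x, ‖f x‖ₑ ^ 2 := by
    rw [← lintegral_comp_two_pi_mul]
    congr 1
    refine lintegral_congr fun x => ?_
    rw [mul_div_cancel_left₀ _ Real.two_pi_pos.ne']
  rw [memLp_two_iff_lintegral] at hf ⊢
  refine ⟨⟨hf.1.comp_quasiMeasurePreserving quasiMeasurePreserving_div_two_pi, ?_⟩, h2⟩
  rw [h2]
  exact ENNReal.mul_lt_top ENNReal.ofReal_lt_top hf.2

/-- The L² Fourier transform agrees with the one on tempered distributions; tested on φ(2π ·), this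
agreement becomes the defining identity in the angular-frequency normalization. -/
lemma Lp_isTimeFourier (f : Lp ℂ 2 (volume : Measure ℝ)) :
    IsTimeFourier f fun τ => (𝓕 f : Lp ℂ 2 (volume : Measure ℝ)) (τ / (2 * Real.pi)) := by
  intro φ
  have hpi : (Real.pi : ℂ) ≠ 0 := by exact_mod_cast Real.pi_ne_zero
  set A : ℝ ≃L[ℝ] ℝ :=
    ContinuousLinearEquiv.unitsEquivAut ℝ (Units.mk0 (2 * Real.pi) Real.two_pi_pos.ne')
  set ψ : 𝓢(ℝ, ℂ) := SchwartzMap.compCLMOfContinuousLinearEquiv ℂ A φ with hψ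
  have hψx : ∀ x, ψ x = φ (2 * Real.pi * x) := fun x => by
    simp [hψ, A, mul_comm]
  have hF : ∀ t, (2 * Real.pi : ℂ) * (𝓕 ψ) t = 𝓕 (φ : ℝ → ℂ) (t / (2 * Real.pi)) := fun t => by
    rw [SchwartzMap.fourier_coe, Real.fourier_real_eq_integral_exp_smul,
      Real.fourier_real_eq_integral_exp_smul]
    conv_rhs => rw [← integral_comp_two_pi_mul]
    refine congrArg _ (integral_congr_ae <| Filter.Eventually.of_forall fun x => ?_)
    simp only [hψx, smul_eq_mul]
    congr 3
    push_cast
    field_simp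
  have hdist := congrArg (fun T => T ψ) (Lp.fourier_toTemperedDistribution_eq f)
  simp only [TemperedDistribution.fourier_apply, Lp.toTemperedDistribution_apply] at hdist
  have i1 := (memLp_comp_div_two_pi (Lp.memLp (𝓕 f : Lp ℂ 2 (volume : Measure ℝ)))).1
  have i2 : MemLp (𝓕 ψ : 𝓢(ℝ, ℂ)) 2 volume := SchwartzMap.memLp _ 2 volume
  refine ⟨i1.integrable_mul (SchwartzMap.memLp φ 2 volume), ?_, ?_⟩
  · refine (((Lp.memLp f).integrable_mul i2).const_mul (2 * Real.pi : ℂ)).congr ?_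
    filter_upwards with t
    rw [← hF]
    simp only [Pi.mul_apply]
    ring
  · rw [← integral_comp_two_pi_mul]
    simp_rw [← hF, mul_div_cancel_left₀ _ Real.two_pi_pos.ne', ← hψx]
    simp_rw [smul_eq_mul] at hdist
    calc _ = (2 * Real.pi : ℂ) * ∫ x, ψ x * (𝓕 f : Lp ℂ 2 (volume : Measure ℝ)) x := by
          congr 1
          exact integral_congr_ae (Filter.Eventually.of_forall fun x => mul_comm _ _)
      _ = _ := by
          rw [← hdist, ← integral_const_mul]
          exact integral_congr_ae (Filter.Eventually.of_forall fun x => by simp only; ring)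

/-- Plancherel's theorem for the Fourier transform in time. -/
lemma exists_isTimeFourier {f : ℝ → ℂ} (hf : MemLp f 2) :
    ∃ F, MemLp F 2 ∧ IsTimeFourier f F ∧
      ∫⁻ τ, ‖F τ‖ₑ ^ 2 = ENNReal.ofReal (2 * Real.pi) * ∫⁻ t, ‖f t‖ₑ ^ 2 := by
  obtain ⟨h1, h2⟩ := memLp_comp_div_two_pi (Lp.memLp (𝓕 (hf.toLp f) : Lp ℂ 2 (volume : Measure ℝ)))
  refine ⟨_, h1, (Lp_isTimeFourier (hf.toLp f)).congr_left hf.coeFn_toLp, ?_⟩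
  rw [h2]
  congr 1
  have e := congrArg (fun x => (ENNReal.ofReal x) ^ 2) (Lp.norm_fourier_eq (hf.toLp f))
  simp only [ofReal_norm, Lp.enorm_def] at e
  rw [eLpNorm_congr_ae hf.coeFn_toLp] at e
  have key : ∀ g : ℝ → ℂ, eLpNorm g 2 volume ^ 2 = ∫⁻ x, ‖g x‖ₑ ^ 2 := fun g => by
    rw [eLpNorm_eq_lintegral_rpow_enorm_toReal two_ne_zero ENNReal.ofNat_ne_top]
    simp only [ENNReal.toReal_ofNat, ENNReal.rpow_ofNat, one_div]
    rw [← ENNReal.rpow_natCast, ← ENNReal.rpow_mul]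
    norm_num
  rwa [key, key] at e

lemma IsTimeFourier.lintegral_eq {f F : ℝ → ℂ} (hf : MemLp f 2) (h : IsTimeFourier f F) :
    MemLp F 2 ∧ ∫⁻ τ, ‖F τ‖ₑ ^ 2 = ENNReal.ofReal (2 * Real.pi) * ∫⁻ t, ‖f t‖ₑ ^ 2 := by
  obtain ⟨F', h1, h2, h3⟩ := exists_isTimeFourier hf
  have e := h2.ae_eq h
  refine ⟨h1.ae_eq e, ?_⟩
  rw [← h3]
  refine lintegral_congr_ae ?_
  filter_upwards [e] with τ hτ
  rw [hτ]

/-- The Fourier transform in time is onto `L²`. -/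
lemma exists_isTimeFourier_eq {F : ℝ → ℂ} (hF : MemLp F 2) :
    ∃ f, MemLp f 2 ∧ IsTimeFourier f F := by
  have hm : MemLp (fun x => F (2 * Real.pi * x)) 2 := by
    rw [memLp_two_iff_lintegral] at hF ⊢
    refine ⟨hF.1.comp_quasiMeasurePreserving quasiMeasurePreserving_two_pi_mul, ?_⟩
    have := hF.2
    rw [← lintegral_comp_two_pi_mul] at this
    refine ENNReal.lt_top_of_mul_ne_top_right this.ne ?_
    simp [Real.pi_pos]
  refine ⟨(𝓕⁻ (hm.toLp _) : Lp ℂ 2 (volume : Measure ℝ)), Lp.memLp _, ?_⟩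
  refine (Lp_isTimeFourier _).congr_right ?_
  rw [FourierTransform.fourier_fourierInv_eq]
  have := quasiMeasurePreserving_div_two_pi.ae_eq_comp hm.coeFn_toLp
  filter_upwards [this] with τ hτ
  simp only [Function.comp] at hτ
  rw [hτ, mul_div_cancel₀ _ Real.two_pi_pos.ne']

/-- Purpose: the value at τ₀ of the transform of f · g is an L² inner product of g with the
conjugated and modulated f, so polarized Plancherel turns it into the convolution at τ₀. -/
lemma IsTimeFourier.conj_modulate {f F : ℝ → ℂ} (h : IsTimeFourier f F) (τ₀ : ℝ) :
    IsTimeFourier (fun t => starRingEnd ℂ (f t) * Complex.exp (Complex.I * t * τ₀))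
      fun τ => starRingEnd ℂ (F (τ₀ - τ)) := by
  intro φ
  set ψ : 𝓢(ℝ, ℂ) := SchwartzMap.postcompCLM (𝕜 := ℝ) (Complex.conjCLE : ℂ →L[ℝ] ℂ)
    (SchwartzMap.compSubConstCLM ℝ τ₀
      (SchwartzMap.compCLMOfContinuousLinearEquiv ℝ (ContinuousLinearEquiv.neg ℝ) φ)) with hψ
  have hψx : ∀ x, ψ x = starRingEnd ℂ (φ (τ₀ - x)) := fun x => by
    simp [hψ]
  obtain ⟨h1, h2, h3⟩ := h ψ
  have hF : ∀ t, starRingEnd ℂ (𝓕 (ψ : ℝ → ℂ) (t / (2 * Real.pi)))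
      = Complex.exp (Complex.I * t * τ₀) * 𝓕 (φ : ℝ → ℂ) (t / (2 * Real.pi)) := fun t => by
    rw [fourier_div_two_pi, fourier_div_two_pi]
    unfold timeFt
    rw [← integral_conj, ← integral_const_mul, ← integral_sub_left_eq_self _ volume τ₀]
    refine integral_congr_ae (Filter.Eventually.of_forall fun x => ?_)
    simp only [hψx, map_mul, ← Complex.exp_conj, map_neg, Complex.conj_I, Complex.conj_ofReal,
      Complex.conj_conj, sub_sub_cancel]
    rw [mul_left_comm, ← Complex.exp_add]
    congr 2
    push_cast
    ring
  have e1 : (fun τ => starRingEnd ℂ (F (τ₀ - τ)) * φ τ)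
      = fun τ => (fun x => starRingEnd ℂ (F x * ψ x)) (τ₀ - τ) := by
    funext τ
    simp [hψx]
  have e2 : (fun t => starRingEnd ℂ (f t) * Complex.exp (Complex.I * t * τ₀) *
      𝓕 (φ : ℝ → ℂ) (t / (2 * Real.pi)))
      = fun t => starRingEnd ℂ (f t * 𝓕 (ψ : ℝ → ℂ) (t / (2 * Real.pi))) := by
    funext t
    rw [map_mul, hF, mul_assoc]
  rw [e1, e2]
  refine ⟨?_, ?_, ?_⟩
  · exact (((Complex.conjLIE.integrable_comp_iff).2 h1).comp_sub_left τ₀)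
  · exact (Complex.conjLIE.integrable_comp_iff).2 h2
  · rw [integral_sub_left_eq_self (fun x => starRingEnd ℂ (F x * ψ x)) volume τ₀,
      integral_conj, integral_conj, h3]

/-- The polarized form of Plancherel's theorem. -/
lemma integral_conj_mul_of_isTimeFourier {f F g G : ℝ → ℂ} (hf : MemLp f 2) (hg : MemLp g 2)
    (h : IsTimeFourier f F) (h' : IsTimeFourier g G) :
    ∫ τ, starRingEnd ℂ (F τ) * G τ = 2 * Real.pi * ∫ t, starRingEnd ℂ (f t) * g t := by
  have hF : F =ᵐ[volume] fun τ => (𝓕 (hf.toLp f) : Lp ℂ 2 (volume : Measure ℝ)) (τ / (2 * Real.pi)) :=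
    h.ae_eq ((Lp_isTimeFourier (hf.toLp f)).congr_left hf.coeFn_toLp)
  have hG : G =ᵐ[volume] fun τ => (𝓕 (hg.toLp g) : Lp ℂ 2 (volume : Measure ℝ)) (τ / (2 * Real.pi)) :=
    h'.ae_eq ((Lp_isTimeFourier (hg.toLp g)).congr_left hg.coeFn_toLp)
  have e := Lp.inner_fourier_eq (hf.toLp f) (hg.toLp g)
  rw [L2.inner_def, L2.inner_def] at e
  simp only [RCLike.inner_apply] at e
  calc _ = ∫ τ, (fun x => (𝓕 (hg.toLp g) : Lp ℂ 2 (volume : Measure ℝ)) x *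
        starRingEnd ℂ ((𝓕 (hf.toLp f) : Lp ℂ 2 (volume : Measure ℝ)) x)) (τ / (2 * Real.pi)) := by
        refine integral_congr_ae ?_
        filter_upwards [hF, hG] with τ h1 h2
        rw [h1, h2, mul_comm]
    _ = _ := by
        rw [← integral_comp_two_pi_mul]
        simp_rw [mul_div_cancel_left₀ _ Real.two_pi_pos.ne']
        rw [e]
        congr 1
        refine integral_congr_ae ?_
        filter_upwards [hf.coeFn_toLp, hg.coeFn_toLp] with t h1 h2
        rw [h1, h2, mul_comm]

/-- The Fourier transform of a product is a convolution. -/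
lemma timeFt_mul_eq {f F g G : ℝ → ℂ} (hf : MemLp f 2) (hg : MemLp g 2)
    (h : IsTimeFourier f F) (h' : IsTimeFourier g G) (τ₀ : ℝ) :
    2 * Real.pi * timeFt (fun t => f t * g t) τ₀ = ∫ τ, F (τ₀ - τ) * G τ := by
  have hm : MemLp (fun t => starRingEnd ℂ (f t) * Complex.exp (Complex.I * t * τ₀)) 2 := by
    refine hf.mono (AEStronglyMeasurable.mul
      (Complex.continuous_conj.comp_aestronglyMeasurable hf.1) (by fun_prop))
      (Filter.Eventually.of_forall fun t => ?_)
    rw [norm_mul, RCLike.norm_conj,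
      show Complex.I * t * τ₀ = ((t * τ₀ : ℝ) : ℂ) * Complex.I by push_cast; ring,
      Complex.norm_exp_ofReal_mul_I, mul_one]
  have e := integral_conj_mul_of_isTimeFourier hm hg (h.conj_modulate τ₀) h'
  simp only [Complex.conj_conj, map_mul, ← Complex.exp_conj, Complex.conj_I,
    Complex.conj_ofReal] at e
  rw [e]
  congr 1
  refine integral_congr_ae (Filter.Eventually.of_forall fun t => ?_)
  simp only
  rw [show -Complex.I * (t : ℂ) * τ₀ = -(Complex.I * t * τ₀) by ring]
  ring

end BOTorus

/-! ### Arithmetic of the exponents of the squared kernel. -/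

namespace BOTorus

/-- The weight `⟨x⟩ ^ (-65 / 64)`, which is integrable. -/
noncomputable def decay (x : ℝ) : ℝ := bracket x ^ (-(65 / 64) : ℝ)

lemma one_le_bracket (x : ℝ) : 1 ≤ bracket x := by
  unfold bracket; linarith [abs_nonneg x]

lemma bracket_pos (x : ℝ) : 0 < bracket x := zero_lt_one.trans_le (one_le_bracket x)

lemma log_bracket_nonneg (x : ℝ) : 0 ≤ Real.log (bracket x) := Real.log_nonneg (one_le_bracket x)

lemma decay_nonneg (x : ℝ) : 0 ≤ decay x := Real.rpow_nonneg (bracket_pos x).le _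

lemma decay_eq_exp (x : ℝ) : decay x = Real.exp (-(65 / 64) * Real.log (bracket x)) := by
  unfold decay
  rw [Real.rpow_def_of_pos (bracket_pos x), mul_comm]

/-- The crude bound log c ≤ c - 1 keeps every constant rational, so that all case distinctions below
become linear arithmetic in logarithms. -/
lemma log_le_log_add {x y c : ℝ} (hx : 0 < x) (hy : 0 < y) (hc : 0 < c) (h : x ≤ c * y) :
    Real.log x ≤ Real.log y + (c - 1) := by
  have := Real.log_le_log hx h
  rw [Real.log_mul hc.ne' hy.ne'] at this
  linarith [Real.log_le_sub_one_of_pos hc]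

lemma log_le_max {x y z : ℝ} (hx : 0 < x) (hy : 0 < y) (hz : 0 < z) (h : x ≤ y + z) :
    Real.log x ≤ max (Real.log y) (Real.log z) + 1 := by
  rcases le_total y z with hyz | hyz
  · linarith [log_le_log_add (c := 2) hx hz two_pos (by linarith),
      le_max_right (Real.log y) (Real.log z)]
  · linarith [log_le_log_add (c := 2) hx hy two_pos (by linarith),
      le_max_left (Real.log y) (Real.log z)]

/-- The exponent of the kernel, in terms of the logarithms of the brackets. -/
noncomputable def kernelExp (la lb ln d s0 s1 : ℝ) : ℝ :=
  3 / 2 * la - 3 / 2 * ln + 7 / 2 * lb - 2 * d - s0 - s1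

/-- The case of dominant σ₂: the two powers of exp d absorb (⟨ξ⟩⟨ξ₂⟩)² and leave ⟨ξ⟩^(-1/2). The
larger of σ, σ₁ controls the frequency distance lx; the smaller one becomes the modulation factor.
-/
lemma kernelExp_le_of_output_mod_dominated {la lb ln d s0 s1 s2 lx : ℝ}
    (hlb : lb ≤ ln) (h0 : 0 ≤ s0) (h1 : 0 ≤ s1) (hd : s2 ≤ d) (hs : la + lb ≤ s2 + 20)
    (hlx : lx ≤ max s0 s1 + 1) :
    ∃ f ∈ ({la, lx} : Set ℝ), ∃ m ∈ ({s0, s1} : Set ℝ),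
      kernelExp la lb ln d s0 s1 ≤ 50 - 65 / 64 * f - 65 / 64 * m := by
  unfold kernelExp
  simp only [Set.mem_insert_iff, Set.mem_singleton_iff, exists_eq_or_imp, exists_eq_left]
  rcases le_total s0 s1 with h | h <;> rcases le_total la lx with h' | h' <;>
    simp only [max_eq_left h, max_eq_right h] at hlx
  · left; left; linarith
  · right; left; linarith
  · left; right; linarith
  · right; right; linarith

/-- For very small output the resonance gains a full power of ⟨ξ₂⟩ ≥ ⟨ξ⟩⁸, which pays for the
integrable decay in ξ itself. -/
lemma kernelExp_le_of_low_output {la lb ln d s0 s1 : ℝ}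
    (hlb : lb ≤ ln) (h0 : 0 ≤ s0) (h1 : 0 ≤ s1) (hd : lb ≤ d) (hlow : 8 * la ≤ lb)
    (hs : la + lb ≤ max s0 s1 + 20) :
    ∃ m ∈ ({s0, s1} : Set ℝ), kernelExp la lb ln d s0 s1 ≤ 50 - 65 / 64 * la - 65 / 64 * m := by
  unfold kernelExp
  simp only [Set.mem_insert_iff, Set.mem_singleton_iff, exists_eq_or_imp, exists_eq_left]
  rcases le_total s0 s1 with h | h <;> simp only [max_eq_left h, max_eq_right h] at hs
  · left; linarith
  · right; linarith

/-- The case of dominant σ. One of exp d and ⟨σ₁⟩ pays for X = ⟨ξ₂⟩ + |σ₁ + σ₂|; what is left of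
them gives almost one power of ⟨ξ₂⟩ and the modulation factor. The remaining exponent is la/2 +
lb/64 - Z, and lb ≤ 8 la lets the gain in la cover all losses of 1/64. -/
lemma kernelExp_le_of_output_mod {la lb ln d s0 s1 s2 lX lq Z : ℝ} (hla : 0 ≤ la) (hlb0 : 0 ≤ lb)
    (hlb : lb ≤ ln) (h1 : 0 ≤ s1) (h2 : 0 ≤ s2) (hd : lb ≤ d) (hd2 : s2 ≤ d)
    (hhigh : lb ≤ 8 * la) (hs : la + lb ≤ s0 + 20) (hlX : lX ≤ max d s1 + 1)
    (hZ1 : lb ≤ Z) (hZ2 : la + lq ≤ Z) (hZ : lb + Z ≤ ln + lX + 1) :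
    ∃ f ∈ ({lb, lq} : Set ℝ), ∃ m ∈ ({s1, s2} : Set ℝ),
      kernelExp la lb ln d s0 s1 ≤ 50 - 65 / 64 * f - 65 / 64 * m := by
  unfold kernelExp
  simp only [Set.mem_insert_iff, Set.mem_singleton_iff, exists_eq_or_imp, exists_eq_left]
  obtain ⟨m, hm, hX⟩ : ∃ m ∈ ({s1, s2} : Set ℝ),
      - 2 * d - s1 ≤ 1 - lX - (1 - 1 / 64) * lb - 65 / 64 * m := by
    simp only [Set.mem_insert_iff, Set.mem_singleton_iff, exists_eq_or_imp, exists_eq_left]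
    rcases le_total d s1 with h | h <;> simp only [max_eq_left h, max_eq_right h] at hlX
    · right; linarith
    · rcases le_total s1 s2 with h' | h'
      · left; linarith
      · right; linarith
  obtain ⟨f, hf, hF⟩ : ∃ f ∈ ({lb, lq} : Set ℝ), la / 2 + lb / 64 - Z ≤ -(65 / 64) * f := by
    simp only [Set.mem_insert_iff, Set.mem_singleton_iff, exists_eq_or_imp, exists_eq_left]
    rcases le_total lb lq with h | h
    · left; linarith
    · right; linarith
  have key : 3 / 2 * la - 3 / 2 * ln + 7 / 2 * lb - 2 * d - s0 - s1 ≤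
      50 - 65 / 64 * f - 65 / 64 * m := by linarith
  simp only [Set.mem_insert_iff, Set.mem_singleton_iff] at hf hm
  rcases hf with rfl | rfl <;> rcases hm with rfl | rfl <;> tauto

/-- The case of dominant σ₁, with no frequency decay extracted yet: about half a power of ⟨ξ₁⟩ is
still to be beaten by V, which contains the resonance function. -/
lemma kernelExp_le_of_input_mod {la lb ln d s0 s1 s2 lX lV : ℝ} (hln : la ≤ ln)
    (hlb : lb ≤ ln) (h0 : 0 ≤ s0) (h2 : 0 ≤ s2) (hd : lb ≤ d) (hd2 : s2 ≤ d)
    (hs : la + lb ≤ s1 + 20) (hlX : lX ≤ max d s0 + 1) (hV : lb + lV ≤ ln + lX) :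
    ∃ m ∈ ({s0, s2} : Set ℝ),
      kernelExp la lb ln d s0 s1 ≤ 21 + (1 / 2 + 1 / 64) * ln - lV - 65 / 64 * m := by
  unfold kernelExp
  simp only [Set.mem_insert_iff, Set.mem_singleton_iff, exists_eq_or_imp, exists_eq_left]
  obtain ⟨m, hm, hX⟩ : ∃ m ∈ ({s0, s2} : Set ℝ),
      - 2 * d - s0 ≤ 1 - lX - (1 - 1 / 64) * lb - 65 / 64 * m := by
    simp only [Set.mem_insert_iff, Set.mem_singleton_iff, exists_eq_or_imp, exists_eq_left]
    rcases le_total d s0 with h | h <;> simp only [max_eq_left h, max_eq_right h] at hlX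
    · right; linarith
    · rcases le_total s0 s2 with h' | h'
      · left; linarith
      · right; linarith
  have key : 3 / 2 * la - 3 / 2 * ln + 7 / 2 * lb - 2 * d - s0 - s1 ≤
      21 + (1 / 2 + 1 / 64) * ln - lV - 65 / 64 * m := by linarith
  simp only [Set.mem_insert_iff, Set.mem_singleton_iff] at hm
  rcases hm with rfl | rfl <;> tauto

/-- The kernel that is square integrable in `(ξ₂, τ₂)`. -/
noncomputable def kernelA (ξ ξ₂ σ σ₁ σ₂ : ℝ) : ℝ :=
  (decay ξ₂ + decay (ξ₂ - σ / (2 * ξ))) * (decay σ₁ + decay σ₂)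

/-- The points `±√((ξ₁² - 2σ₁)₊)`, at which the resonance function is critical. -/
noncomputable def resonanceRoot (ξ₁ σ₁ : ℝ) : ℝ := √(max (ξ₁ ^ 2 - 2 * σ₁) 0)

/-- The kernel that is square integrable in `(ξ, τ)` for fixed `(ξ₁, τ₁)`. -/
noncomputable def kernelB (ξ ξ₁ σ σ₁ σ₂ : ℝ) : ℝ :=
  (decay (ξ - ξ₁ / 2) + decay (ξ - (ξ₁ + resonanceRoot ξ₁ σ₁) / 2)
    + decay (ξ - (ξ₁ - resonanceRoot ξ₁ σ₁) / 2)) * (decay σ + decay σ₂)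

/-- The kernel that is square integrable in `(ξ, τ)` for fixed `(ξ₂, τ₂)`. -/
noncomputable def kernelC (ξ ξ₂ σ σ₁ σ₂ : ℝ) : ℝ :=
  (decay ξ + decay (ξ + σ₂ / (2 * ξ₂))) * (decay σ + decay σ₁)

lemma kernelA_nonneg (ξ ξ₂ σ σ₁ σ₂ : ℝ) : 0 ≤ kernelA ξ ξ₂ σ σ₁ σ₂ :=
  mul_nonneg (add_nonneg (decay_nonneg _) (decay_nonneg _))
    (add_nonneg (decay_nonneg _) (decay_nonneg _))

lemma kernelB_nonneg (ξ ξ₁ σ σ₁ σ₂ : ℝ) : 0 ≤ kernelB ξ ξ₁ σ σ₁ σ₂ :=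
  mul_nonneg (add_nonneg (add_nonneg (decay_nonneg _) (decay_nonneg _)) (decay_nonneg _))
    (add_nonneg (decay_nonneg _) (decay_nonneg _))

lemma kernelC_nonneg (ξ ξ₂ σ σ₁ σ₂ : ℝ) : 0 ≤ kernelC ξ ξ₂ σ σ₁ σ₂ :=
  mul_nonneg (add_nonneg (decay_nonneg _) (decay_nonneg _))
    (add_nonneg (decay_nonneg _) (decay_nonneg _))

lemma exp_le_of_le_decay {E c x y A B : ℝ} (hx : decay x ≤ A) (hy : decay y ≤ B)
    (h : E ≤ c - 65 / 64 * Real.log (bracket x) - 65 / 64 * Real.log (bracket y)) :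
    Real.exp E ≤ Real.exp c * (A * B) := by
  calc Real.exp E ≤ Real.exp (c + (-(65 / 64) * Real.log (bracket x)
        + -(65 / 64) * Real.log (bracket y))) := Real.exp_le_exp.2 (by linarith)
    _ = Real.exp c * (decay x * decay y) := by
        rw [Real.exp_add, Real.exp_add, decay_eq_exp, decay_eq_exp]
    _ ≤ _ := by
        have := mul_le_mul hx hy (decay_nonneg y) ((decay_nonneg x).trans hx)
        exact mul_le_mul_of_nonneg_left this (Real.exp_pos _).le

lemma exists_mem_fourthPowers {x : ℝ} (hx : 0 ≤ x) :
    ∃ j : ℕ, (j : ℝ) ^ 4 ≤ x ∧ x < ((j : ℝ) + 1) ^ 4 := by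
  have h4 : (x ^ (1 / 4 : ℝ)) ^ 4 = x := by
    rw [← Real.rpow_natCast, ← Real.rpow_mul hx]; norm_num
  have h0 : 0 ≤ x ^ (1 / 4 : ℝ) := Real.rpow_nonneg hx _
  refine ⟨⌊x ^ (1 / 4 : ℝ)⌋₊, ?_, ?_⟩
  · rw [← h4]
    conv_lhs => rw [h4]
    exact pow_le_pow_left₀ (Nat.cast_nonneg _) (Nat.floor_le h0) 4
  · conv_lhs => rw [← h4]
    exact pow_lt_pow_left₀ (Nat.lt_floor_add_one _) h0 (by norm_num)

/-- The length of a block is at most 5j³, and for j ≥ 100 this is a small fraction of its position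
j⁴. -/
lemma pow_four_bounds {j : ℝ} (hj : 100 ≤ j) :
    j ^ 3 ≤ j ^ 4 / 100 ∧ 1 ≤ j ^ 3 ∧ (j + 1) ^ 4 ≤ j ^ 4 + 5 * j ^ 3 := by
  have h1 : 1 ≤ j := by linarith
  have h2 : j ≤ j ^ 2 / 100 := by nlinarith
  have h3 : j ^ 2 ≤ j ^ 3 / 100 := by nlinarith [sq_nonneg j]
  refine ⟨by nlinarith [pow_nonneg (zero_le_one.trans h1) 3], one_le_pow₀ h1, ?_⟩
  have : (j + 1) ^ 4 = j ^ 4 + 4 * j ^ 3 + 6 * j ^ 2 + 4 * j + 1 := by ring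
  rw [this]
  nlinarith [one_le_pow₀ (n := 2) h1]

/-- The frequencies `ξ₁` and `ξ` lie in the `j`-th pair of almost opposite blocks. -/
def NearPair (j : ℕ) (ξ ξ₁ : ℝ) : Prop :=
  100 ≤ j ∧ (j : ℝ) ^ 4 ≤ ξ₁ ∧ ξ₁ < ((j : ℝ) + 1) ^ 4 ∧ |2 * ξ - (j : ℝ) ^ 4| ≤ 23 * (j : ℝ) ^ 3

/-- With y = 2ξ - ξ₁ and Y = ξ₁² - 2σ₁, twice the resonance function is y² - Y. If Y ≥ 0, factor it:
of y ± √Y, the factor whose two terms have the same sign is at least |y|. If Y < 0 the root is 0 and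
y² - Y ≥ y². -/
lemma resonanceRoot_spec (y ξ₁ σ₁ : ℝ) :
    |y| * |y - resonanceRoot ξ₁ σ₁| ≤ |y ^ 2 - (ξ₁ ^ 2 - 2 * σ₁)| ∨
      |y| * |y + resonanceRoot ξ₁ σ₁| ≤ |y ^ 2 - (ξ₁ ^ 2 - 2 * σ₁)| := by
  unfold resonanceRoot
  set Y := ξ₁ ^ 2 - 2 * σ₁
  rcases le_total 0 Y with hY | hY
  · rw [max_eq_left hY]
    have hz := Real.sqrt_nonneg Y
    have e : y ^ 2 - Y = (y + √Y) * (y - √Y) := by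
      nlinarith [Real.sq_sqrt hY]
    rw [e, abs_mul]
    rcases le_total 0 y with hy | hy
    · left
      refine mul_le_mul_of_nonneg_right ?_ (abs_nonneg _)
      rw [abs_of_nonneg hy, abs_of_nonneg (by linarith)]
      linarith
    · right
      rw [mul_comm]
      refine mul_le_mul_of_nonneg_left ?_ (abs_nonneg _)
      rw [abs_of_nonpos hy, abs_of_nonpos (by linarith)]
      linarith
  · left
    rw [max_eq_right hY, Real.sqrt_zero, sub_zero, ← abs_mul, ← sq, abs_of_nonneg (sq_nonneg y),
      abs_of_nonneg (by nlinarith [sq_nonneg y])]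
    linarith

end BOTorus

/-! ### The pointwise kernel bound, by dominant modulation. -/

namespace BOTorus

section KernelBound

variable {ξ ξ₂ σ₁ σ₂ : ℝ}

lemma exp_le_kernelA {E c ξ ξ₂ σ σ₁ σ₂ f m : ℝ}
    (hf : f ∈ ({Real.log (bracket ξ₂), Real.log (bracket (ξ₂ - σ / (2 * ξ)))} : Set ℝ))
    (hm : m ∈ ({Real.log (bracket σ₁), Real.log (bracket σ₂)} : Set ℝ))
    (h : E ≤ c - 65 / 64 * f - 65 / 64 * m) :
    Real.exp E ≤ Real.exp c * kernelA ξ ξ₂ σ σ₁ σ₂ := by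
  have d1 := decay_nonneg ξ₂
  have d2 := decay_nonneg (ξ₂ - σ / (2 * ξ))
  have d3 := decay_nonneg σ₁
  have d4 := decay_nonneg σ₂
  rcases hf with rfl | rfl <;> rcases hm with rfl | rfl <;>
    exact exp_le_of_le_decay (by linarith) (by linarith) h

lemma exp_le_kernelB {E c ξ ξ₁ σ σ₁ σ₂ f m : ℝ}
    (hf : f ∈ ({Real.log (bracket (ξ - ξ₁ / 2)),
      Real.log (bracket (ξ - (ξ₁ + resonanceRoot ξ₁ σ₁) / 2)),
      Real.log (bracket (ξ - (ξ₁ - resonanceRoot ξ₁ σ₁) / 2))} : Set ℝ))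
    (hm : m ∈ ({Real.log (bracket σ), Real.log (bracket σ₂)} : Set ℝ))
    (h : E ≤ c - 65 / 64 * f - 65 / 64 * m) :
    Real.exp E ≤ Real.exp c * kernelB ξ ξ₁ σ σ₁ σ₂ := by
  have d1 := decay_nonneg (ξ - ξ₁ / 2)
  have d2 := decay_nonneg (ξ - (ξ₁ + resonanceRoot ξ₁ σ₁) / 2)
  have d5 := decay_nonneg (ξ - (ξ₁ - resonanceRoot ξ₁ σ₁) / 2)
  have d3 := decay_nonneg σ
  have d4 := decay_nonneg σ₂
  rcases hf with rfl | rfl | rfl <;> rcases hm with rfl | rfl <;>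
    exact exp_le_of_le_decay (by linarith) (by linarith) h

lemma exp_le_kernelC {E c ξ ξ₂ σ σ₁ σ₂ f m : ℝ}
    (hf : f ∈ ({Real.log (bracket ξ), Real.log (bracket (ξ + σ₂ / (2 * ξ₂)))} : Set ℝ))
    (hm : m ∈ ({Real.log (bracket σ), Real.log (bracket σ₁)} : Set ℝ))
    (h : E ≤ c - 65 / 64 * f - 65 / 64 * m) :
    Real.exp E ≤ Real.exp c * kernelC ξ ξ₂ σ σ₁ σ₂ := by
  have d1 := decay_nonneg ξ
  have d2 := decay_nonneg (ξ + σ₂ / (2 * ξ₂))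
  have d3 := decay_nonneg σ
  have d4 := decay_nonneg σ₁
  rcases hf with rfl | rfl <;> rcases hm with rfl | rfl <;>
    exact exp_le_of_le_decay (by linarith) (by linarith) h

lemma bracket_le_add {x y z : ℝ} (h : |x| ≤ |y| + |z|) : bracket x ≤ bracket y + bracket z := by
  unfold bracket; linarith

/-- The logarithms of the brackets that enter the kernel. -/
noncomputable def kernelLog (ξ ξ₂ σ₁ σ₂ : ℝ) : ℝ :=
  kernelExp (Real.log (bracket ξ)) (Real.log (bracket ξ₂)) (Real.log (bracket (ξ - ξ₂)))
    (Real.log (bracket ξ₂ + bracket σ₂)) (Real.log (bracket (σ₁ + σ₂ + 2 * ξ * ξ₂)))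
    (Real.log (bracket σ₁))

/-- The sum of the three kernels. -/
noncomputable def kernelSum (ξ ξ₂ σ₁ σ₂ : ℝ) : ℝ :=
  kernelA ξ ξ₂ (σ₁ + σ₂ + 2 * ξ * ξ₂) σ₁ σ₂ + kernelB ξ (ξ - ξ₂) (σ₁ + σ₂ + 2 * ξ * ξ₂) σ₁ σ₂
    + kernelC ξ ξ₂ (σ₁ + σ₂ + 2 * ξ * ξ₂) σ₁ σ₂

lemma mul_le_kernelSum_of_A {E c K : ℝ} (hc : c ≤ 2000000000)
    (h : K ≤ Real.exp E) (hE : Real.exp E ≤ Real.exp c *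
      kernelA ξ ξ₂ (σ₁ + σ₂ + 2 * ξ * ξ₂) σ₁ σ₂) :
    K ≤ Real.exp 2000000000 * kernelSum ξ ξ₂ σ₁ σ₂ := by
  refine (h.trans hE).trans (mul_le_mul (Real.exp_le_exp.2 hc) ?_ (kernelA_nonneg _ _ _ _ _)
    (Real.exp_pos _).le)
  unfold kernelSum
  linarith [kernelB_nonneg ξ (ξ - ξ₂) (σ₁ + σ₂ + 2 * ξ * ξ₂) σ₁ σ₂,
    kernelC_nonneg ξ ξ₂ (σ₁ + σ₂ + 2 * ξ * ξ₂) σ₁ σ₂]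

lemma mul_le_kernelSum_of_B {E c K : ℝ} (hc : c ≤ 2000000000)
    (h : K ≤ Real.exp E) (hE : Real.exp E ≤ Real.exp c *
      kernelB ξ (ξ - ξ₂) (σ₁ + σ₂ + 2 * ξ * ξ₂) σ₁ σ₂) :
    K ≤ Real.exp 2000000000 * kernelSum ξ ξ₂ σ₁ σ₂ := by
  refine (h.trans hE).trans (mul_le_mul (Real.exp_le_exp.2 hc) ?_ (kernelB_nonneg _ _ _ _ _)
    (Real.exp_pos _).le)
  unfold kernelSum
  linarith [kernelA_nonneg ξ ξ₂ (σ₁ + σ₂ + 2 * ξ * ξ₂) σ₁ σ₂,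
    kernelC_nonneg ξ ξ₂ (σ₁ + σ₂ + 2 * ξ * ξ₂) σ₁ σ₂]

lemma mul_le_kernelSum_of_C {E c K : ℝ} (hc : c ≤ 2000000000)
    (h : K ≤ Real.exp E) (hE : Real.exp E ≤ Real.exp c *
      kernelC ξ ξ₂ (σ₁ + σ₂ + 2 * ξ * ξ₂) σ₁ σ₂) :
    K ≤ Real.exp 2000000000 * kernelSum ξ ξ₂ σ₁ σ₂ := by
  refine (h.trans hE).trans (mul_le_mul (Real.exp_le_exp.2 hc) ?_ (kernelC_nonneg _ _ _ _ _)
    (Real.exp_pos _).le)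
  unfold kernelSum
  linarith [kernelA_nonneg ξ ξ₂ (σ₁ + σ₂ + 2 * ξ * ξ₂) σ₁ σ₂,
    kernelB_nonneg ξ (ξ - ξ₂) (σ₁ + σ₂ + 2 * ξ * ξ₂) σ₁ σ₂]

section Comparison

variable (hξ : 1 < ξ) (hξ₂ : ξ₂ < 0)
include hξ hξ₂

lemma log_bracket_output_le : Real.log (bracket ξ) ≤ Real.log (bracket (ξ - ξ₂)) := by
  refine Real.log_le_log (bracket_pos _) ?_
  unfold bracket
  rw [abs_of_pos (by linarith), abs_of_pos (by linarith)]
  linarith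

lemma log_bracket_neg_le : Real.log (bracket ξ₂) ≤ Real.log (bracket (ξ - ξ₂)) := by
  refine Real.log_le_log (bracket_pos _) ?_
  unfold bracket
  rw [abs_of_neg hξ₂, abs_of_pos (by linarith)]
  linarith

end Comparison

lemma log_le_log_bracket_add (x σ₂ : ℝ) :
    Real.log (bracket x) ≤ Real.log (bracket x + bracket σ₂) ∧
      Real.log (bracket σ₂) ≤ Real.log (bracket x + bracket σ₂) :=
  ⟨Real.log_le_log (bracket_pos _) (by linarith [bracket_pos σ₂]),
    Real.log_le_log (bracket_pos _) (by linarith [bracket_pos x])⟩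

/-- For bounded ξ₂ no resonance is needed: ⟨ξ⟩ ≤ ⟨ξ₁⟩, decay in ξ₂ is free, and the factor ⟨ξ₂⟩ +
⟨σ₂⟩ gives the decay in σ₂. The crude log x ≤ x - 1 is responsible for the huge constant. -/
lemma kernel_le_of_bounded (hξ : 1 < ξ) (hξ₂ : ξ₂ < 0) (hb : bracket ξ₂ ≤ 200000000) {K : ℝ}
    (hK : K ≤ Real.exp (kernelLog ξ ξ₂ σ₁ σ₂)) :
    K ≤ Real.exp 2000000000 * kernelSum ξ ξ₂ σ₁ σ₂ := by
  refine mul_le_kernelSum_of_A le_rfl hK (exp_le_kernelA (f := Real.log (bracket ξ₂))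
    (m := Real.log (bracket σ₂)) (by simp) (by simp) ?_)
  have h1 := log_bracket_output_le hξ hξ₂
  have h2 := log_le_log_bracket_add ξ₂ σ₂
  have h3 := Real.log_le_sub_one_of_pos (bracket_pos ξ₂)
  have h4 := log_bracket_nonneg (σ₁ + σ₂ + 2 * ξ * ξ₂)
  have h5 := log_bracket_nonneg σ₁
  have h6 := log_bracket_nonneg σ₂
  have h7 := log_bracket_nonneg ξ₂
  unfold kernelLog kernelExp
  linarith [h2.1, h2.2]

/-- With (ξ₂, τ₂) frozen, σ - σ₁ = 2ξ₂(ξ + σ₂/(2ξ₂)) is linear in ξ, so the larger of σ and σ₁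
dominates the distance of ξ to its zero. -/
lemma kernel_le_of_neg_mod (hξ : 1 < ξ) (hξ₂ : ξ₂ ≤ -1)
    (hs : Real.log (bracket ξ) + Real.log (bracket ξ₂) ≤ Real.log (bracket σ₂) + 20) {K : ℝ}
    (hK : K ≤ Real.exp (kernelLog ξ ξ₂ σ₁ σ₂)) :
    K ≤ Real.exp 2000000000 * kernelSum ξ ξ₂ σ₁ σ₂ := by
  have hlx : Real.log (bracket (ξ + σ₂ / (2 * ξ₂))) ≤
      max (Real.log (bracket (σ₁ + σ₂ + 2 * ξ * ξ₂))) (Real.log (bracket σ₁)) + 1 := by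
    refine log_le_max (bracket_pos _) (bracket_pos _) (bracket_pos _) (bracket_le_add ?_)
    have e : σ₂ + 2 * ξ * ξ₂ = (2 * ξ₂) * (ξ + σ₂ / (2 * ξ₂)) := by
      have : ξ₂ ≠ 0 := by linarith
      field_simp
      ring
    have h1 : |σ₂ + 2 * ξ * ξ₂| ≤ |σ₁ + σ₂ + 2 * ξ * ξ₂| + |σ₁| := by
      have := abs_sub (σ₁ + σ₂ + 2 * ξ * ξ₂) σ₁
      rwa [show σ₁ + σ₂ + 2 * ξ * ξ₂ - σ₁ = σ₂ + 2 * ξ * ξ₂ by ring] at this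
    refine le_trans ?_ h1
    rw [e, abs_mul]
    have h2 : 1 ≤ |2 * ξ₂| := by rw [abs_of_neg (by linarith)]; linarith
    nlinarith [abs_nonneg (ξ + σ₂ / (2 * ξ₂))]
  obtain ⟨f, hf, m, hm, h⟩ := kernelExp_le_of_output_mod_dominated
    (log_bracket_neg_le hξ (by linarith)) (log_bracket_nonneg (σ₁ + σ₂ + 2 * ξ * ξ₂))
    (log_bracket_nonneg σ₁) (log_le_log_bracket_add ξ₂ σ₂).2 hs hlx
  exact mul_le_kernelSum_of_C (by norm_num) hK (exp_le_kernelC hf hm h)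

lemma kernel_le_of_low_output (hξ : 1 < ξ) (hξ₂ : ξ₂ ≤ -1)
    (hlow : 8 * Real.log (bracket ξ) ≤ Real.log (bracket ξ₂))
    (hs : Real.log (bracket ξ) + Real.log (bracket ξ₂) ≤
      max (Real.log (bracket (σ₁ + σ₂ + 2 * ξ * ξ₂))) (Real.log (bracket σ₁)) + 20) {K : ℝ}
    (hK : K ≤ Real.exp (kernelLog ξ ξ₂ σ₁ σ₂)) :
    K ≤ Real.exp 2000000000 * kernelSum ξ ξ₂ σ₁ σ₂ := by
  obtain ⟨m, hm, h⟩ := kernelExp_le_of_low_output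
    (log_bracket_neg_le hξ (by linarith)) (log_bracket_nonneg (σ₁ + σ₂ + 2 * ξ * ξ₂))
    (log_bracket_nonneg σ₁) (log_le_log_bracket_add ξ₂ σ₂).1 hlow hs
  exact mul_le_kernelSum_of_C (by norm_num) hK (exp_le_kernelC (by simp) hm h)

/-- With (ξ, τ) frozen, σ₁ + σ₂ = -2ξq with q = ξ₂ - σ/(2ξ) is linear in ξ₂. Its slope 2ξ makes |σ₁
+ σ₂| comparable to ⟨ξ⟩⟨q⟩ up to an error ⟨ξ⟩. -/
lemma kernel_le_of_output_mod (hξ : 1 < ξ) (hξ₂ : ξ₂ ≤ -1)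
    (hhigh : Real.log (bracket ξ₂) ≤ 8 * Real.log (bracket ξ))
    (hs : Real.log (bracket ξ) + Real.log (bracket ξ₂) ≤
      Real.log (bracket (σ₁ + σ₂ + 2 * ξ * ξ₂)) + 20) {K : ℝ}
    (hK : K ≤ Real.exp (kernelLog ξ ξ₂ σ₁ σ₂)) :
    K ≤ Real.exp 2000000000 * kernelSum ξ ξ₂ σ₁ σ₂ := by
  set σ := σ₁ + σ₂ + 2 * ξ * ξ₂ with hσ
  set q := ξ₂ - σ / (2 * ξ) with hq
  have hM := bracket_pos ξ₂
  have hL := bracket_pos ξ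
  have hN := bracket_pos (ξ - ξ₂)
  have hX : 0 < bracket ξ₂ + |σ₁ + σ₂| := by linarith [abs_nonneg (σ₁ + σ₂)]
  have hLq : 0 < bracket ξ * bracket q := mul_pos hL (bracket_pos q)
  have hlX : Real.log (bracket ξ₂ + |σ₁ + σ₂|) ≤
      max (Real.log (bracket ξ₂ + bracket σ₂)) (Real.log (bracket σ₁)) + 1 := by
    refine log_le_max hX (by linarith [bracket_pos σ₂]) (bracket_pos _) ?_
    have := abs_add_le σ₁ σ₂
    simp only [bracket]
    linarith
  have hx : |σ₁ + σ₂| = 2 * ξ * |q| := by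
    have : σ₁ + σ₂ = -(2 * ξ * q) := by
      rw [hq, hσ]
      have : ξ ≠ 0 := by linarith
      field_simp
      ring
    rw [this, abs_neg, abs_mul, abs_of_pos (by linarith)]
  have hZ : Real.log (bracket ξ₂) + Real.log (bracket ξ₂ + bracket ξ * bracket q) ≤
      Real.log (bracket (ξ - ξ₂)) + Real.log (bracket ξ₂ + |σ₁ + σ₂|) + 1 := by
    rw [← Real.log_mul hM.ne' (by positivity), ← Real.log_mul hN.ne' hX.ne']
    refine (log_le_log_add (c := 2)
      (y := bracket (ξ - ξ₂) * (bracket ξ₂ + |σ₁ + σ₂|)) (by positivity) (by positivity) two_pos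
      ?_).trans (by linarith)
    have hN' : bracket (ξ - ξ₂) = 1 + ξ - ξ₂ := by
      unfold bracket; rw [abs_of_pos (by linarith)]; ring
    have hL' : bracket ξ = 1 + ξ := by unfold bracket; rw [abs_of_pos (by linarith)]
    have hM' : bracket ξ₂ = 1 - ξ₂ := by unfold bracket; rw [abs_of_neg (by linarith)]; ring
    have h1 : bracket ξ * bracket q ≤ bracket ξ + |σ₁ + σ₂| := by
      rw [hx, hL']
      unfold bracket
      nlinarith [abs_nonneg q]
    have h2 : bracket ξ₂ * bracket ξ ≤ bracket (ξ - ξ₂) * (bracket ξ₂ + |σ₁ + σ₂|) := by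
      have : bracket ξ ≤ bracket (ξ - ξ₂) := by rw [hL', hN']; linarith
      nlinarith [abs_nonneg (σ₁ + σ₂)]
    have h3 : bracket ξ₂ * (bracket ξ₂ + |σ₁ + σ₂|) ≤
        bracket (ξ - ξ₂) * (bracket ξ₂ + |σ₁ + σ₂|) := by
      refine mul_le_mul_of_nonneg_right ?_ hX.le
      rw [hM', hN']; linarith
    calc bracket ξ₂ * (bracket ξ₂ + bracket ξ * bracket q)
        ≤ bracket ξ₂ * (bracket ξ₂ + (bracket ξ + |σ₁ + σ₂|)) := by gcongr
      _ = bracket ξ₂ * (bracket ξ₂ + |σ₁ + σ₂|) + bracket ξ₂ * bracket ξ := by ring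
      _ ≤ _ := by linarith
  obtain ⟨f, hf, m, hm, h⟩ := kernelExp_le_of_output_mod
    (log_bracket_nonneg ξ) (log_bracket_nonneg ξ₂)
    (log_bracket_neg_le hξ (by linarith)) (log_bracket_nonneg σ₁) (log_bracket_nonneg σ₂)
    (log_le_log_bracket_add ξ₂ σ₂).1 (log_le_log_bracket_add ξ₂ σ₂).2 hhigh hs hlX
    (Real.log_le_log hM (by linarith : bracket ξ₂ ≤ bracket ξ₂ + bracket ξ * bracket q))
    (lq := Real.log (bracket q)) (by
      rw [← Real.log_mul hL.ne' (bracket_pos q).ne']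
      exact Real.log_le_log hLq (by linarith)) hZ
  exact mul_le_kernelSum_of_A (by norm_num) hK (exp_le_kernelA hf hm h)

lemma exists_kernelLog_le (hξ : 1 < ξ) (hξ₂ : ξ₂ ≤ -1)
    (hs : Real.log (bracket ξ) + Real.log (bracket ξ₂) ≤ Real.log (bracket σ₁) + 20) :
    ∃ m ∈ ({Real.log (bracket (σ₁ + σ₂ + 2 * ξ * ξ₂)), Real.log (bracket σ₂)} : Set ℝ),
      kernelLog ξ ξ₂ σ₁ σ₂ ≤ 21 + (1 / 2 + 1 / 64) * Real.log (bracket (ξ - ξ₂))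
        - Real.log (bracket (ξ - ξ₂) + |σ₁ + 2 * ξ * ξ₂|) - 65 / 64 * m := by
  set σ := σ₁ + σ₂ + 2 * ξ * ξ₂ with hσ
  set x := σ₁ + 2 * ξ * ξ₂ with hx
  have hM := bracket_pos ξ₂
  have hN := bracket_pos (ξ - ξ₂)
  have hx0 := abs_nonneg x
  have hlX : Real.log (bracket ξ₂ + |x|) ≤
      max (Real.log (bracket ξ₂ + bracket σ₂)) (Real.log (bracket σ)) + 1 := by
    refine log_le_max (by linarith) (by linarith [bracket_pos σ₂]) (bracket_pos _) ?_
    have := abs_sub σ σ₂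
    rw [show σ - σ₂ = x by rw [hσ, hx]; ring] at this
    simp only [bracket]
    linarith
  refine kernelExp_le_of_input_mod (lX := Real.log (bracket ξ₂ + |x|))
    (log_bracket_output_le hξ (by linarith)) (log_bracket_neg_le hξ (by linarith))
    (log_bracket_nonneg σ) (log_bracket_nonneg σ₂) (log_le_log_bracket_add ξ₂ σ₂).1
    (log_le_log_bracket_add ξ₂ σ₂).2 hs hlX ?_
  rw [← Real.log_mul hM.ne' (by positivity), ← Real.log_mul hN.ne' (by positivity)]
  refine Real.log_le_log (by positivity) ?_
  have : bracket ξ₂ ≤ bracket (ξ - ξ₂) := by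
    unfold bracket
    rw [abs_of_neg (by linarith), abs_of_pos (by linarith)]
    linarith
  nlinarith

/-- At the critical point the resonance function gives nothing and is dropped. The damping j⁻² and
the remaining ⟨ξ₁⟩^(-31/64), about j^(-31/16), together exceed the decay needed in ξ - ξ₁/2, which
is at most 14j³ in size. -/
lemma kernel_le_of_near {j : ℕ} (hξ : 1 < ξ) (hξ₂ : ξ₂ ≤ -1) (hj : NearPair j ξ (ξ - ξ₂))
    (hs : Real.log (bracket ξ) + Real.log (bracket ξ₂) ≤ Real.log (bracket σ₁) + 20) {K : ℝ}
    (hK : K ≤ Real.exp (kernelLog ξ ξ₂ σ₁ σ₂ - 2 * Real.log j)) :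
    K ≤ Real.exp 2000000000 * kernelSum ξ ξ₂ σ₁ σ₂ := by
  obtain ⟨hj0, hj1, hj2, hj3⟩ := hj
  have hj100 : (100 : ℝ) ≤ j := by exact_mod_cast hj0
  have hjp : (0 : ℝ) < j := by linarith
  obtain ⟨p1, p2, p3⟩ := pow_four_bounds hj100
  obtain ⟨m, hm, h⟩ := exists_kernelLog_le (σ₂ := σ₂) hξ hξ₂ hs
  have hN := bracket_pos (ξ - ξ₂)
  have hN' : bracket (ξ - ξ₂) = 1 + (ξ - ξ₂) := by
    unfold bracket; rw [abs_of_pos (by linarith)]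
  have l1 : Real.log (bracket (ξ - ξ₂)) ≤ 4 * Real.log j + 1 := by
    have := log_le_log_add (x := bracket (ξ - ξ₂)) (y := (j : ℝ) ^ 4) (c := 2) hN (by positivity)
      two_pos (by rw [hN']; linarith)
    rw [Real.log_pow] at this
    push_cast at this
    linarith
  have l2 : 4 * Real.log j ≤ Real.log (bracket (ξ - ξ₂)) := by
    have := Real.log_le_log (x := (j : ℝ) ^ 4) (by positivity)
      (by rw [hN']; linarith : (j : ℝ) ^ 4 ≤ bracket (ξ - ξ₂))
    rw [Real.log_pow] at this
    exact_mod_cast this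
  have l3 : Real.log (bracket (ξ - (ξ - ξ₂) / 2)) ≤ 3 * Real.log j + 14 := by
    have := log_le_log_add (x := bracket (ξ - (ξ - ξ₂) / 2)) (y := (j : ℝ) ^ 3) (c := 15)
      (bracket_pos _) (by positivity) (by norm_num) (by
        unfold bracket
        have : |ξ - (ξ - ξ₂) / 2| ≤ 14 * (j : ℝ) ^ 3 := by
          rw [abs_le] at hj3 ⊢
          constructor <;> linarith [hj3.1, hj3.2]
        linarith)
    rw [Real.log_pow] at this
    push_cast at this
    linarith
  have l4 : Real.log (bracket (ξ - ξ₂)) ≤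
      Real.log (bracket (ξ - ξ₂) + |σ₁ + 2 * ξ * ξ₂|) :=
    Real.log_le_log hN (by linarith [abs_nonneg (σ₁ + 2 * ξ * ξ₂)])
  have l5 : 0 ≤ Real.log j := Real.log_nonneg (by linarith)
  refine mul_le_kernelSum_of_B (c := 100) (by norm_num) hK (exp_le_kernelB
    (f := Real.log (bracket (ξ - (ξ - ξ₂) / 2))) (by simp) hm ?_)
  linarith

/-- Away from the critical point |2ξ - ξ₁| ≥ j³, so the resonance function is at least j³ times the
distance w to a root. Against ⟨ξ₁⟩^(1/2 + 1/64), of order j^(2 + 1/16), this leaves nearly one power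
of j to spare. -/
lemma kernel_le_of_far {j : ℕ} (hξ : 1 < ξ) (hξ₂ : ξ₂ ≤ -1) (hj0 : 100 ≤ j)
    (hj1 : (j : ℝ) ^ 4 ≤ ξ - ξ₂) (hj2 : ξ - ξ₂ < ((j : ℝ) + 1) ^ 4)
    (hj3 : 23 * (j : ℝ) ^ 3 < |2 * ξ - (j : ℝ) ^ 4|)
    (hs : Real.log (bracket ξ) + Real.log (bracket ξ₂) ≤ Real.log (bracket σ₁) + 20) {K : ℝ}
    (hK : K ≤ Real.exp (kernelLog ξ ξ₂ σ₁ σ₂)) :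
    K ≤ Real.exp 2000000000 * kernelSum ξ ξ₂ σ₁ σ₂ := by
  have hj100 : (100 : ℝ) ≤ j := by exact_mod_cast hj0
  have hjp : (0 : ℝ) < j := by linarith
  obtain ⟨p1, p2, p3⟩ := pow_four_bounds hj100
  obtain ⟨m, hm, h⟩ := exists_kernelLog_le (σ₂ := σ₂) hξ hξ₂ hs
  have hN := bracket_pos (ξ - ξ₂)
  have hN' : bracket (ξ - ξ₂) = 1 + (ξ - ξ₂) := by
    unfold bracket; rw [abs_of_pos (by linarith)]
  have l1 : Real.log (bracket (ξ - ξ₂)) ≤ 4 * Real.log j + 1 := by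
    have := log_le_log_add (x := bracket (ξ - ξ₂)) (y := (j : ℝ) ^ 4) (c := 2) hN (by positivity)
      two_pos (by rw [hN']; linarith)
    rw [Real.log_pow] at this
    push_cast at this
    linarith
  have hy : (j : ℝ) ^ 3 ≤ |2 * ξ - (ξ - ξ₂)| := by
    have h1 := abs_sub_abs_le_abs_sub (2 * ξ - (j : ℝ) ^ 4) (ξ - ξ₂ - (j : ℝ) ^ 4)
    rw [abs_of_nonneg (by linarith : 0 ≤ ξ - ξ₂ - (j : ℝ) ^ 4),
      show 2 * ξ - (j : ℝ) ^ 4 - (ξ - ξ₂ - (j : ℝ) ^ 4) = 2 * ξ - (ξ - ξ₂) by ring] at h1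
    linarith
  have l3 : Real.log (bracket (ξ - (ξ - ξ₂) / 2)) ≤ Real.log (bracket (ξ - ξ₂)) := by
    refine Real.log_le_log (bracket_pos _) ?_
    rw [hN']
    unfold bracket
    have : |ξ - (ξ - ξ₂) / 2| ≤ ξ - ξ₂ := by
      rw [abs_le]; constructor <;> linarith
    linarith
  have l5 : 0 ≤ Real.log j := Real.log_nonneg (by linarith)
  have hx : |σ₁ + 2 * ξ * ξ₂| =
      |(2 * ξ - (ξ - ξ₂)) ^ 2 - ((ξ - ξ₂) ^ 2 - 2 * σ₁)| / 2 := by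
    rw [← abs_two, ← abs_div, abs_two]
    congr 1
    ring
  obtain ⟨w, hw, hV⟩ : ∃ w, (w = ξ - ((ξ - ξ₂) + resonanceRoot (ξ - ξ₂) σ₁) / 2 ∨
      w = ξ - ((ξ - ξ₂) - resonanceRoot (ξ - ξ₂) σ₁) / 2) ∧
      (j : ℝ) ^ 3 * |w| ≤ |σ₁ + 2 * ξ * ξ₂| := by
    rcases resonanceRoot_spec (2 * ξ - (ξ - ξ₂)) (ξ - ξ₂) σ₁ with hr | hr
    · refine ⟨_, Or.inl rfl, ?_⟩
      rw [show ξ - ((ξ - ξ₂) + resonanceRoot (ξ - ξ₂) σ₁) / 2 =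
        (2 * ξ - (ξ - ξ₂) - resonanceRoot (ξ - ξ₂) σ₁) / 2 by ring, abs_div, abs_two, hx]
      have := mul_le_mul_of_nonneg_right hy
        (abs_nonneg (2 * ξ - (ξ - ξ₂) - resonanceRoot (ξ - ξ₂) σ₁))
      linarith
    · refine ⟨_, Or.inr rfl, ?_⟩
      rw [show ξ - ((ξ - ξ₂) - resonanceRoot (ξ - ξ₂) σ₁) / 2 =
        (2 * ξ - (ξ - ξ₂) + resonanceRoot (ξ - ξ₂) σ₁) / 2 by ring, abs_div, abs_two, hx]
      have := mul_le_mul_of_nonneg_right hy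
        (abs_nonneg (2 * ξ - (ξ - ξ₂) + resonanceRoot (ξ - ξ₂) σ₁))
      linarith
  have l4 : 3 * Real.log j + Real.log (bracket w) ≤
      Real.log (bracket (ξ - ξ₂) + |σ₁ + 2 * ξ * ξ₂|) := by
    have e : 3 * Real.log j = Real.log ((j : ℝ) ^ 3) := by rw [Real.log_pow]; norm_num
    rw [e, ← Real.log_mul (by positivity) (bracket_pos w).ne']
    refine Real.log_le_log (mul_pos (by positivity) (bracket_pos w)) ?_
    rw [hN', bracket, mul_add]
    linarith
  have l6 := log_bracket_nonneg w
  have l7 := log_bracket_nonneg (ξ - (ξ - ξ₂) / 2)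
  -- The missing ⟨·⟩^(1/64) is paid by the spare power of j, which requires a quantity bounded by
  -- ⟨ξ₁⟩. The distance w may be larger; then ξ - ξ₁/2 serves instead.
  rcases le_total (Real.log (bracket w)) (Real.log (bracket (ξ - (ξ - ξ₂) / 2))) with hc | hc
  · refine mul_le_kernelSum_of_B (c := 100) (by norm_num) hK (exp_le_kernelB
      (f := Real.log (bracket w)) (by rcases hw with rfl | rfl <;> simp) hm ?_)
    linarith
  · refine mul_le_kernelSum_of_B (c := 100) (by norm_num) hK (exp_le_kernelB
      (f := Real.log (bracket (ξ - (ξ - ξ₂) / 2))) (by simp) hm ?_)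
    linarith

/-- The kernel of the bilinear form is bounded by three kernels to each of which the
Cauchy-Schwarz inequality applies. -/
theorem kernel_le (hξ : 1 < ξ) (hξ₂ : ξ₂ < 0) {D : ℝ} (hD0 : 0 ≤ D) (hD1 : D ≤ 1)
    (hD : ∀ j : ℕ, NearPair j ξ (ξ - ξ₂) → (j : ℝ) ^ 8 / 10 ≤ |σ₁| → D ≤ 1 / j) :
    D ^ 2 * Real.exp (kernelLog ξ ξ₂ σ₁ σ₂) ≤ Real.exp 2000000000 * kernelSum ξ ξ₂ σ₁ σ₂ := by
  have hK : D ^ 2 * Real.exp (kernelLog ξ ξ₂ σ₁ σ₂) ≤ Real.exp (kernelLog ξ ξ₂ σ₁ σ₂) :=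
    mul_le_of_le_one_left (Real.exp_pos _).le (pow_le_one₀ hD0 hD1)
  have hM' : bracket ξ₂ = 1 - ξ₂ := by unfold bracket; rw [abs_of_neg hξ₂]; ring
  have hL' : bracket ξ = 1 + ξ := by unfold bracket; rw [abs_of_pos (by linarith)]
  obtain ⟨j, hj1, hj2⟩ := exists_mem_fourthPowers (x := ξ - ξ₂) (by linarith)
  -- Beyond this threshold ξ₁ > |ξ₂| > 100⁴, hence j ≥ 100.
  by_cases hb : bracket ξ₂ ≤ 200000000
  · exact kernel_le_of_bounded hξ hξ₂ hb hK
  have hξ₂' : ξ₂ ≤ -1 := by linarith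
  have hj0 : 100 ≤ j := by
    by_contra hcon
    have h1 : (j : ℝ) + 1 ≤ 100 := by
      have : j + 1 ≤ 100 := by omega
      exact_mod_cast this
    have h2 : ((j : ℝ) + 1) ^ 4 ≤ 100 ^ 4 := pow_le_pow_left₀ (by positivity) h1 4
    norm_num at h2
    linarith
  have hj100 : (100 : ℝ) ≤ j := by exact_mod_cast hj0
  obtain ⟨p1, p2, p3⟩ := pow_four_bounds hj100
  set σ := σ₁ + σ₂ + 2 * ξ * ξ₂ with hσ
  have hres : 2 * (ξ * -ξ₂) ≤ |σ| + |σ₁| + |σ₂| := by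
    have h1 : 2 * (ξ * -ξ₂) = -σ + σ₁ + σ₂ := by rw [hσ]; ring
    rw [h1]
    linarith [neg_le_abs σ, le_abs_self σ₁, le_abs_self σ₂]
  have hprod : bracket ξ * bracket ξ₂ ≤ 4 * (ξ * -ξ₂) := by rw [hL', hM']; nlinarith
  -- The factor 21 fits the near region, where ⟨ξ⟩⟨ξ₂⟩ ≤ 2j⁸ and a large σ₁ means |σ₁| ≥ j⁸/10; on
  -- the logarithmic side it costs 21 - 1 = 20.
  have tolog : ∀ y : ℝ, bracket ξ * bracket ξ₂ ≤ 21 * |y| →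
      Real.log (bracket ξ) + Real.log (bracket ξ₂) ≤ Real.log (bracket y) + 20 := fun y hy => by
    rw [← Real.log_mul (bracket_pos _).ne' (bracket_pos _).ne']
    have := log_le_log_add (x := bracket ξ * bracket ξ₂) (y := bracket y) (c := 21)
      (mul_pos (bracket_pos _) (bracket_pos _)) (bracket_pos _) (by norm_num) (by
        refine hy.trans ?_; unfold bracket; linarith)
    linarith
  have ofσ₂ : bracket ξ * bracket ξ₂ ≤ 21 * |σ₂| → D ^ 2 * Real.exp (kernelLog ξ ξ₂ σ₁ σ₂) ≤
      Real.exp 2000000000 * kernelSum ξ ξ₂ σ₁ σ₂ := fun h =>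
    kernel_le_of_neg_mod hξ hξ₂' (tolog _ h) hK
  have ofσ : bracket ξ * bracket ξ₂ ≤ 21 * |σ| → D ^ 2 * Real.exp (kernelLog ξ ξ₂ σ₁ σ₂) ≤
      Real.exp 2000000000 * kernelSum ξ ξ₂ σ₁ σ₂ := fun h => by
    rcases le_total (8 * Real.log (bracket ξ)) (Real.log (bracket ξ₂)) with hlow | hhigh
    · exact kernel_le_of_low_output hξ hξ₂' hlow
        ((tolog _ h).trans (by gcongr; exact le_max_left _ _)) hK
    · exact kernel_le_of_output_mod hξ hξ₂' hhigh (tolog _ h) hK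
  by_cases hnear : |2 * ξ - (j : ℝ) ^ 4| ≤ 23 * (j : ℝ) ^ 3
  · have hb := abs_le.1 hnear
    have a1 : 77 / 100 * (j : ℝ) ^ 4 ≤ 2 * ξ := by linarith [hb.1]
    have a2 : 77 / 100 * (j : ℝ) ^ 4 ≤ 2 * -ξ₂ := by linarith [hb.2]
    have a3 : 2 * ξ ≤ 123 / 100 * (j : ℝ) ^ 4 := by linarith [hb.2]
    have a4 : 2 * -ξ₂ ≤ 133 / 100 * (j : ℝ) ^ 4 := by linarith [hb.1]
    have j8 : (j : ℝ) ^ 8 = (j : ℝ) ^ 4 * (j : ℝ) ^ 4 := by ring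
    have jp : 0 ≤ (j : ℝ) ^ 4 := by positivity
    have b1 : 59 / 100 * (j : ℝ) ^ 8 ≤ 4 * (ξ * -ξ₂) := by
      rw [j8]; nlinarith [mul_le_mul a1 a2 (by positivity) (by linarith)]
    have b2 : 4 * (ξ * -ξ₂) ≤ 2 * (j : ℝ) ^ 8 := by
      rw [j8]; nlinarith [mul_le_mul a3 a4 (by linarith) (by positivity)]
    by_cases hbig : (j : ℝ) ^ 8 / 10 ≤ |σ₁|
    · have hn : NearPair j ξ (ξ - ξ₂) := ⟨hj0, hj1, hj2, hnear⟩
      refine kernel_le_of_near hξ hξ₂' hn (tolog _ (by linarith)) ?_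
      have hDj := hD j hn hbig
      have e : Real.exp (-2 * Real.log j) = (1 / (j : ℝ)) ^ 2 := by
        rw [show -2 * Real.log j = Real.log ((1 / (j : ℝ)) ^ 2) by
          rw [Real.log_pow, one_div, Real.log_inv]; push_cast; ring]
        exact Real.exp_log (by positivity)
      rw [show kernelLog ξ ξ₂ σ₁ σ₂ - 2 * Real.log j =
        -2 * Real.log j + kernelLog ξ ξ₂ σ₁ σ₂ by ring, Real.exp_add, e]
      gcongr
    · push Not at hbig
      -- Here |σ₁| < j⁸/10, while 2ξ|ξ₂| ≥ 0.295 j⁸, so the resonance must be carried by σ₂ or σ.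
      by_cases h2 : bracket ξ * bracket ξ₂ ≤ 21 * |σ₂|
      · exact ofσ₂ h2
      · refine ofσ ?_
        push Not at h2
        linarith
  · push Not at hnear
    by_cases h2 : bracket ξ * bracket ξ₂ ≤ 21 * |σ₂|
    · exact ofσ₂ h2
    by_cases h1 : bracket ξ * bracket ξ₂ ≤ 21 * |σ₁|
    · exact kernel_le_of_far hξ hξ₂' hj0 hj1 hj2 hnear (tolog _ h1) hK
    · refine ofσ ?_
      push Not at h1 h2
      have := mul_pos (bracket_pos ξ) (bracket_pos ξ₂)
      linarith

end KernelBound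

end BOTorus

/-! ### Cauchy-Schwarz for trilinear forms; sums of the weight over the lattice. -/

namespace BOTorus

section Schur

variable {α β : Type*} [MeasurableSpace α] [MeasurableSpace β] {μ : Measure α} {ν : Measure β}

/-- The `L²` seminorm of a nonnegative function. -/
noncomputable def normTwo (μ : Measure α) (f : α → ℝ≥0∞) : ℝ≥0∞ :=
  (∫⁻ x, f x ^ 2 ∂μ) ^ (1 / 2 : ℝ)

lemma normTwo_sq (f : α → ℝ≥0∞) : normTwo μ f ^ 2 = ∫⁻ x, f x ^ 2 ∂μ := by
  unfold normTwo
  rw [← ENNReal.rpow_natCast, ← ENNReal.rpow_mul]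
  norm_num

lemma lintegral_mul_le_normTwo {f g : α → ℝ≥0∞} (hf : AEMeasurable f μ) (hg : AEMeasurable g μ) :
    ∫⁻ x, f x * g x ∂μ ≤ normTwo μ f * normTwo μ g := by
  have := ENNReal.lintegral_mul_le_Lp_mul_Lq μ Real.HolderConjugate.two_two hf hg
  simpa [normTwo] using this

lemma sq_rpow_half (x : ℝ≥0∞) : (x ^ (1 / 2 : ℝ)) ^ 2 = x := by
  rw [← ENNReal.rpow_natCast, ← ENNReal.rpow_mul]
  norm_num

lemma rpow_half_sq (x : ℝ≥0∞) : (x ^ 2) ^ (1 / 2 : ℝ) = x := by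
  rw [← ENNReal.rpow_natCast, ← ENNReal.rpow_mul]
  norm_num

lemma rpow_half_mul_normTwo (f g : α → ℝ≥0∞) :
    ((∫⁻ x, f x ^ 2 ∂μ) * ∫⁻ x, g x ^ 2 ∂μ) ^ (1 / 2 : ℝ) = normTwo μ f * normTwo μ g :=
  ENNReal.mul_rpow_of_nonneg _ _ (by norm_num)

/-- Cauchy-Schwarz for a kernel whose square has bounded integrals in the second variable. -/
lemma lintegral_lintegral_kernel_le [SFinite μ] [SFinite ν] {k F : α × β → ℝ≥0∞} {f : α → ℝ≥0∞}
    {S : ℝ≥0∞} (hk : Measurable k) (hF : Measurable F) (hf : Measurable f)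
    (hS : ∀ a, ∫⁻ b, k (a, b) ∂ν ≤ S) :
    ∫⁻ a, ∫⁻ b, k (a, b) ^ (1 / 2 : ℝ) * (f a * F (a, b)) ∂ν ∂μ ≤
      S ^ (1 / 2 : ℝ) * normTwo μ f * (∫⁻ a, ∫⁻ b, F (a, b) ^ 2 ∂ν ∂μ) ^ (1 / 2 : ℝ) := by
  have h1 : ∀ a, ∫⁻ b, k (a, b) ^ (1 / 2 : ℝ) * (f a * F (a, b)) ∂ν ≤
      S ^ (1 / 2 : ℝ) * (f a * (∫⁻ b, F (a, b) ^ 2 ∂ν) ^ (1 / 2 : ℝ)) := fun a => by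
    have e : ∀ b, k (a, b) ^ (1 / 2 : ℝ) * (f a * F (a, b))
        = f a * (k (a, b) ^ (1 / 2 : ℝ) * F (a, b)) := fun b => by ring
    simp_rw [e]
    rw [lintegral_const_mul _ (by fun_prop)]
    have h := lintegral_mul_le_normTwo (μ := ν) (f := fun b => k (a, b) ^ (1 / 2 : ℝ))
      (g := fun b => F (a, b)) (by fun_prop) (by fun_prop)
    calc _ ≤ f a * (S ^ (1 / 2 : ℝ) * (∫⁻ b, F (a, b) ^ 2 ∂ν) ^ (1 / 2 : ℝ)) := by
          refine mul_le_mul_right (h.trans (mul_le_mul_left ?_ _)) _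
          unfold normTwo
          simp_rw [sq_rpow_half]
          exact ENNReal.rpow_le_rpow (hS a) (by norm_num)
      _ = _ := by ring
  refine (lintegral_mono h1).trans ?_
  have hm : Measurable fun a => (∫⁻ b, F (a, b) ^ 2 ∂ν) ^ (1 / 2 : ℝ) :=
    ((hF.pow_const 2).lintegral_prod_right').pow_const _
  rw [lintegral_const_mul _ (f := fun a => f a * (∫⁻ b, F (a, b) ^ 2 ∂ν) ^ (1 / 2 : ℝ)) (hf.mul hm),
    mul_assoc]
  refine mul_le_mul_right ?_ _
  refine (lintegral_mul_le_normTwo hf.aemeasurable hm.aemeasurable).trans (le_of_eq ?_)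
  congr 1
  unfold normTwo
  simp_rw [sq_rpow_half]

end Schur

section Trilinear

variable {G : Type*} [AddCommGroup G] [MeasurableSpace G] [MeasurableAdd₂ G]
  [MeasurableSub₂ G] {μ : Measure G} [SFinite μ] [μ.IsAddLeftInvariant]

/-- Cauchy-Schwarz in b for fixed a, then in a. The double integral of w(a - b)² g(b)² splits by
translation invariance. The next two lemmas do the same with a - b and with b as the frozen
variable. -/
lemma trilinear_le_of_output_fixed {k : G × G → ℝ≥0∞} {h w g : G → ℝ≥0∞} {S : ℝ≥0∞}
    (hk : Measurable k) (hh : Measurable h) (hw : Measurable w) (hg : Measurable g)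
    (hS : ∀ a, ∫⁻ b, k (a, b) ∂μ ≤ S) :
    ∫⁻ a, ∫⁻ b, k (a, b) ^ (1 / 2 : ℝ) * (h a * w (a - b) * g b) ∂μ ∂μ ≤
      S ^ (1 / 2 : ℝ) * normTwo μ h * normTwo μ w * normTwo μ g := by
  have := lintegral_lintegral_kernel_le (μ := μ) (F := fun p : G × G => w (p.1 - p.2) * g p.2)
    hk (by fun_prop) hh hS
  simp_rw [mul_assoc] at this ⊢
  refine this.trans (le_of_eq ?_)
  congr 2
  rw [← rpow_half_mul_normTwo]
  congr 1
  simp_rw [mul_pow]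
  rw [lintegral_lintegral_swap (by fun_prop)]
  have e : ∀ b, ∫⁻ a, w (a - b) ^ 2 * g b ^ 2 ∂μ = (∫⁻ a, w a ^ 2 ∂μ) * g b ^ 2 := fun b => by
    rw [lintegral_mul_const _ (by fun_prop), lintegral_sub_right_eq_self (fun x => w x ^ 2)]
  simp_rw [e]
  rw [lintegral_const_mul _ (by fun_prop)]

lemma trilinear_le_of_input_fixed {k : G × G → ℝ≥0∞} {h w g : G → ℝ≥0∞} {S : ℝ≥0∞}
    (hk : Measurable k) (hh : Measurable h) (hw : Measurable w) (hg : Measurable g)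
    (hS : ∀ c, ∫⁻ b, k (b + c, b) ∂μ ≤ S) :
    ∫⁻ a, ∫⁻ b, k (a, b) ^ (1 / 2 : ℝ) * (h a * w (a - b) * g b) ∂μ ∂μ ≤
      S ^ (1 / 2 : ℝ) * normTwo μ h * normTwo μ w * normTwo μ g := by
  rw [lintegral_lintegral_swap (by fun_prop)]
  have e : ∀ b, ∫⁻ a, k (a, b) ^ (1 / 2 : ℝ) * (h a * w (a - b) * g b) ∂μ =
      ∫⁻ c, k (b + c, b) ^ (1 / 2 : ℝ) * (w c * (h (b + c) * g b)) ∂μ := fun b => by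
    rw [← lintegral_add_left_eq_self _ b]
    refine lintegral_congr fun c => ?_
    rw [add_sub_cancel_left]
    ring
  simp_rw [e]
  rw [lintegral_lintegral_swap (by fun_prop)]
  have := lintegral_lintegral_kernel_le (μ := μ) (ν := μ)
    (k := fun p : G × G => k (p.2 + p.1, p.2))
    (F := fun p : G × G => h (p.2 + p.1) * g p.2) (f := w) (by fun_prop) (by fun_prop) hw hS
  refine this.trans (le_of_eq ?_)
  rw [show S ^ (1 / 2 : ℝ) * normTwo μ h * normTwo μ w * normTwo μ g =
    S ^ (1 / 2 : ℝ) * normTwo μ w * (normTwo μ h * normTwo μ g) by ring]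
  congr 1
  rw [← rpow_half_mul_normTwo]
  congr 1
  simp_rw [mul_pow]
  rw [lintegral_lintegral_swap (by fun_prop)]
  have e : ∀ b, ∫⁻ c, h (b + c) ^ 2 * g b ^ 2 ∂μ = (∫⁻ a, h a ^ 2 ∂μ) * g b ^ 2 := fun b => by
    rw [lintegral_mul_const _ (by fun_prop), lintegral_add_left_eq_self (fun x => h x ^ 2)]
  simp_rw [e]
  rw [lintegral_const_mul _ (by fun_prop)]

variable [MeasurableNeg G] [μ.IsNegInvariant]

lemma trilinear_le_of_neg_fixed {k : G × G → ℝ≥0∞} {h w g : G → ℝ≥0∞} {S : ℝ≥0∞}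
    (hk : Measurable k) (hh : Measurable h) (hw : Measurable w) (hg : Measurable g)
    (hS : ∀ b, ∫⁻ a, k (a, b) ∂μ ≤ S) :
    ∫⁻ a, ∫⁻ b, k (a, b) ^ (1 / 2 : ℝ) * (h a * w (a - b) * g b) ∂μ ∂μ ≤
      S ^ (1 / 2 : ℝ) * normTwo μ h * normTwo μ w * normTwo μ g := by
  rw [lintegral_lintegral_swap (by fun_prop)]
  have := lintegral_lintegral_kernel_le (μ := μ) (ν := μ) (k := fun p : G × G => k (p.2, p.1))
    (F := fun p : G × G => h p.2 * w (p.2 - p.1)) (f := g) (by fun_prop) (by fun_prop) hg hS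
  have e : ∀ b a, k (a, b) ^ (1 / 2 : ℝ) * (h a * w (a - b) * g b) =
      k (a, b) ^ (1 / 2 : ℝ) * (g b * (h a * w (a - b))) := fun b a => by ring
  simp_rw [e]
  refine this.trans (le_of_eq ?_)
  rw [show S ^ (1 / 2 : ℝ) * normTwo μ h * normTwo μ w * normTwo μ g =
    S ^ (1 / 2 : ℝ) * normTwo μ g * (normTwo μ h * normTwo μ w) by ring]
  congr 1
  rw [← rpow_half_mul_normTwo]
  congr 1
  simp_rw [mul_pow]
  rw [lintegral_lintegral_swap (by fun_prop)]
  have e : ∀ a, ∫⁻ b, h a ^ 2 * w (a - b) ^ 2 ∂μ = h a ^ 2 * (∫⁻ a, w a ^ 2 ∂μ) := fun b => by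
    rw [lintegral_const_mul _ (by fun_prop), lintegral_sub_left_eq_self (fun x => w x ^ 2)]
  simp_rw [e]
  rw [lintegral_mul_const _ (by fun_prop)]

end Trilinear

section Decay

lemma measurable_bracket : Measurable bracket := by unfold bracket; fun_prop

lemma measurable_decay : Measurable decay := by
  unfold decay; exact measurable_bracket.pow_const _

lemma lintegral_decay_lt_top : ∫⁻ x : ℝ, ENNReal.ofReal (decay x) < ∞ := by
  have h := integrable_one_add_norm (E := ℝ) (μ := volume) (r := 65 / 64)
    (by rw [Module.finrank_self]; norm_num)
  exact h.lintegral_lt_top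

lemma decay_neg (x : ℝ) : decay (-x) = decay x := by simp [decay, bracket]

lemma decay_le_of_abs_sub_le_one {x y : ℝ} (h : |x - y| ≤ 1) : decay x ≤ 4 * decay y := by
  rw [decay_eq_exp, decay_eq_exp]
  have h1 : Real.log (bracket y) ≤ Real.log (bracket x) + Real.log 2 := by
    rw [← Real.log_mul (bracket_pos _).ne' two_ne_zero]
    refine Real.log_le_log (bracket_pos _) ?_
    have := abs_sub_abs_le_abs_sub y x
    rw [abs_sub_comm] at h
    unfold bracket
    linarith [abs_nonneg x]
  have h2 : (4 : ℝ) = Real.exp (2 * Real.log 2) := by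
    rw [two_mul, Real.exp_add, Real.exp_log two_pos]; norm_num
  rw [h2, ← Real.exp_add]
  refine Real.exp_le_exp.2 ?_
  have : 0 ≤ Real.log 2 := Real.log_nonneg one_le_two
  linarith

lemma lintegral_comp_div_sub {lam : ℝ} (hl : 1 ≤ lam) (c : ℝ) (f : ℝ → ℝ≥0∞) (hf : Measurable f) :
    ∫⁻ y : ℝ, f (y / lam - c) = ENNReal.ofReal lam * ∫⁻ y, f y := by
  have hl0 : lam ≠ 0 := by linarith
  have h := Real.smul_map_volume_mul_right (a := lam⁻¹) (inv_ne_zero hl0)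
  have h' : Measure.map (fun x : ℝ => x * lam⁻¹) volume = ENNReal.ofReal lam • volume := by
    conv_rhs => rw [← h]
    rw [smul_smul, ← ENNReal.ofReal_mul (by linarith), abs_of_pos (by positivity),
      mul_inv_cancel₀ hl0]
    simp
  simp_rw [div_eq_mul_inv]
  rw [← lintegral_map (f := fun x => f (x - c)) (g := fun x => x * lam⁻¹) (by fun_prop)
    (by fun_prop), h', lintegral_smul_measure, lintegral_sub_right_eq_self]
  rfl

/-- Sums of the integrable weight over the frequency lattice. -/
lemma tsum_decay_le {lam : ℝ} (hl : 1 ≤ lam) (c : ℝ) :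
    ∑' n : ℤ, ENNReal.ofReal (decay (n / lam - c)) ≤
      4 * (∫⁻ x : ℝ, ENNReal.ofReal (decay x)) * ENNReal.ofReal lam := by
  -- Comparison with the integral over the unit cell: since λ ≥ 1, points of [n, n + 1) divided by λ
  -- are within distance 1 of n/λ, where the weight changes by a factor at most 4.
  have h1 : ∀ n : ℤ, ENNReal.ofReal (decay (n / lam - c)) ≤
      ∫⁻ y in Set.Ico (n : ℝ) (n + 1), 4 * ENNReal.ofReal (decay (y / lam - c)) := fun n => by
    have : ∫⁻ _ in Set.Ico (n : ℝ) (n + 1), ENNReal.ofReal (decay (n / lam - c)) =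
        ENNReal.ofReal (decay (n / lam - c)) := by
      simp
    rw [← this]
    refine setLIntegral_mono' measurableSet_Ico fun y hy => ?_
    rw [show (4 : ℝ≥0∞) = ENNReal.ofReal 4 by norm_num, ← ENNReal.ofReal_mul (by norm_num)]
    refine ENNReal.ofReal_le_ofReal (decay_le_of_abs_sub_le_one ?_)
    rw [show n / lam - c - (y / lam - c) = (n - y) / lam by ring, abs_div,
      abs_of_pos (by linarith : 0 < lam)]
    refine (div_le_one (by linarith)).2 (le_trans ?_ hl)
    rw [abs_le]
    constructor <;> linarith [hy.1, hy.2]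
  have hdisj : Pairwise (Function.onFun Disjoint fun n : ℤ => Set.Ico (n : ℝ) (n + 1)) := by
    intro m n hmn
    rw [Function.onFun, Set.disjoint_left]
    intro x hx hx'
    apply hmn
    have e1 : ⌊x⌋ = m := Int.floor_eq_iff.2 hx
    have e2 : ⌊x⌋ = n := Int.floor_eq_iff.2 hx'
    rw [← e1, e2]
  calc _ ≤ ∑' n : ℤ, ∫⁻ y in Set.Ico (n : ℝ) (n + 1), 4 * ENNReal.ofReal (decay (y / lam - c)) :=
        ENNReal.tsum_le_tsum h1
    _ = ∫⁻ y : ℝ, 4 * ENNReal.ofReal (decay (y / lam - c)) := by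
        rw [← lintegral_iUnion (fun _ => measurableSet_Ico) hdisj, iUnion_Ico_intCast,
          setLIntegral_univ]
    _ = _ := by
        have hm : Measurable fun x => 4 * ENNReal.ofReal (decay x) :=
          (measurable_decay.ennreal_ofReal).const_mul 4
        rw [lintegral_comp_div_sub hl c (fun x => 4 * ENNReal.ofReal (decay x)) hm,
          lintegral_const_mul _ measurable_decay.ennreal_ofReal]
        ring

/-- The measure on the space of the frequency indices `n` and `τ`. -/
noncomputable abbrev freqMeasure : Measure (ℤ × ℝ) := (Measure.count : Measure ℤ).prod volume

instance : freqMeasure.IsNegInvariant := by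
  constructor
  have h := Measure.map_prod_map (Measure.count : Measure ℤ) (volume : Measure ℝ)
    (measurable_neg) (measurable_neg)
  have e1 : Measure.map Neg.neg (Measure.count : Measure ℤ) = Measure.count :=
    Measure.map_neg_eq_self _
  have e2 : Measure.map Neg.neg (volume : Measure ℝ) = volume := Measure.map_neg_eq_self _
  rw [e1, e2] at h
  exact h.symm

lemma lintegral_freqMeasure {f : ℤ × ℝ → ℝ≥0∞} (hf : AEMeasurable f freqMeasure) :
    ∫⁻ a, f a ∂freqMeasure = ∑' n : ℤ, ∫⁻ τ : ℝ, f (n, τ) := by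
  rw [lintegral_prod _ hf, lintegral_count]

/-- A bound for the integrals of the squared kernels. -/
noncomputable def decayConst : ℝ≥0∞ :=
  4 * (∫⁻ x : ℝ, ENNReal.ofReal (decay x)) * ∫⁻ x : ℝ, ENNReal.ofReal (decay x)

lemma decayConst_ne_top : decayConst ≠ ∞ :=
  ENNReal.mul_ne_top (ENNReal.mul_ne_top (by norm_num) lintegral_decay_lt_top.ne)
    lintegral_decay_lt_top.ne

lemma lintegral_decay_mul_decay_le {lam : ℝ} (hl : 1 ≤ lam) (c : ℝ) (d : ℤ → ℝ) :
    ∫⁻ a : ℤ × ℝ, ENNReal.ofReal (decay (a.1 / lam - c) * decay (a.2 - d a.1)) ∂freqMeasure ≤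
      decayConst * ENNReal.ofReal lam := by
  have hd : Measurable d := measurable_of_countable d
  rw [lintegral_freqMeasure (by
    have := measurable_decay
    fun_prop)]
  simp only
  simp_rw [ENNReal.ofReal_mul (decay_nonneg _)]
  have e : ∀ n : ℤ, ∫⁻ τ : ℝ, ENNReal.ofReal (decay (n / lam - c)) *
      ENNReal.ofReal (decay (τ - d n)) = ENNReal.ofReal (decay (n / lam - c)) *
        ∫⁻ x : ℝ, ENNReal.ofReal (decay x) := fun n => by
    rw [lintegral_const_mul _ (by have := measurable_decay; fun_prop),
      lintegral_sub_right_eq_self fun x => ENNReal.ofReal (decay x)]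
  simp_rw [e]
  rw [ENNReal.tsum_mul_right]
  refine (mul_le_mul_left (tsum_decay_le hl c) _).trans (le_of_eq ?_)
  unfold decayConst
  ring

end Decay

end BOTorus

/-! ### The resonance identity and the non-resonant trilinear estimate. -/

namespace BOTorus

/-- The distance `τ + |ξ|ξ` to the characteristic curve of the Benjamin-Ono equation. -/
noncomputable def modulation (lam : ℝ) (a : ℤ × ℝ) : ℝ := a.2 + |a.1 / lam| * (a.1 / lam)

lemma measurable_modulation (lam : ℝ) : Measurable (modulation lam) := by
  unfold modulation; fun_prop

/-- The signs turn |ξ|ξ into ξ², ξ₁² and -ξ₂², and ξ² - (ξ - ξ₂)² + ξ₂² = 2ξξ₂. -/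
lemma resonance_identity {lam : ℝ} (hl : 0 < lam) {a b : ℤ × ℝ} (ha : 0 < a.1) (hb : b.1 < 0) :
    modulation lam a = modulation lam (a - b) + modulation lam b
      + 2 * (a.1 / lam) * (b.1 / lam) := by
  have ha' : (0 : ℝ) < a.1 / lam := div_pos (by exact_mod_cast ha) hl
  have hb' : (b.1 : ℝ) / lam < 0 := div_neg_of_neg_of_pos (by exact_mod_cast hb) hl
  unfold modulation
  simp only [Prod.fst_sub, Prod.snd_sub, Int.cast_sub, sub_div]
  rw [abs_of_pos ha', abs_of_neg hb', abs_of_pos (by linarith)]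
  ring

/-- The sum of the three squared kernels, on the frequency space. -/
noncomputable def totalKernel (lam : ℝ) (p : (ℤ × ℝ) × (ℤ × ℝ)) : ℝ :=
  kernelA (p.1.1 / lam) (p.2.1 / lam) (modulation lam p.1) (modulation lam (p.1 - p.2))
      (modulation lam p.2)
    + kernelB (p.1.1 / lam) ((p.1 - p.2).1 / lam) (modulation lam p.1)
      (modulation lam (p.1 - p.2)) (modulation lam p.2)
    + kernelC (p.1.1 / lam) (p.2.1 / lam) (modulation lam p.1) (modulation lam (p.1 - p.2))
      (modulation lam p.2)

lemma kernelSum_eq_totalKernel {lam : ℝ} (hl : 0 < lam) {a b : ℤ × ℝ} (ha : 0 < a.1)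
    (hb : b.1 < 0) :
    kernelSum (a.1 / lam) (b.1 / lam) (modulation lam (a - b)) (modulation lam b)
      = totalKernel lam (a, b) := by
  unfold kernelSum totalKernel
  simp only [← resonance_identity hl ha hb, Prod.fst_sub, Int.cast_sub, sub_div]

lemma lintegral_decay_mul_decay_le_of_eq {lam : ℝ} (hl : 1 ≤ lam) {f g : ℤ × ℝ → ℝ} (c : ℝ)
    (d : ℤ → ℝ) (hf : ∀ a, f a = decay (a.1 / lam - c)) (hg : ∀ a, g a = decay (a.2 - d a.1)) :
    ∫⁻ a : ℤ × ℝ, ENNReal.ofReal (f a * g a) ∂freqMeasure ≤ decayConst * ENNReal.ofReal lam := by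
  simp_rw [hf, hg]
  exact lintegral_decay_mul_decay_le hl c d

lemma lintegral_add_mul_add_le {f₁ f₂ g₁ g₂ : ℤ × ℝ → ℝ} {S : ℝ≥0∞}
    (hf₁ : ∀ a, 0 ≤ f₁ a) (hf₂ : ∀ a, 0 ≤ f₂ a) (hg₁ : ∀ a, 0 ≤ g₁ a) (hg₂ : ∀ a, 0 ≤ g₂ a)
    (mf₁ : Measurable f₁) (mf₂ : Measurable f₂) (mg₁ : Measurable g₁) (mg₂ : Measurable g₂)
    (h11 : ∫⁻ a, ENNReal.ofReal (f₁ a * g₁ a) ∂freqMeasure ≤ S)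
    (h12 : ∫⁻ a, ENNReal.ofReal (f₁ a * g₂ a) ∂freqMeasure ≤ S)
    (h21 : ∫⁻ a, ENNReal.ofReal (f₂ a * g₁ a) ∂freqMeasure ≤ S)
    (h22 : ∫⁻ a, ENNReal.ofReal (f₂ a * g₂ a) ∂freqMeasure ≤ S) :
    ∫⁻ a, ENNReal.ofReal ((f₁ a + f₂ a) * (g₁ a + g₂ a)) ∂freqMeasure ≤ 4 * S := by
  have e : ∀ a, ENNReal.ofReal ((f₁ a + f₂ a) * (g₁ a + g₂ a)) =
      ENNReal.ofReal (f₁ a * g₁ a) + ENNReal.ofReal (f₁ a * g₂ a) +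
        (ENNReal.ofReal (f₂ a * g₁ a) + ENNReal.ofReal (f₂ a * g₂ a)) := fun a => by
    have i1 := mul_nonneg (hf₁ a) (hg₁ a)
    have i2 := mul_nonneg (hf₁ a) (hg₂ a)
    have i3 := mul_nonneg (hf₂ a) (hg₁ a)
    have i4 := mul_nonneg (hf₂ a) (hg₂ a)
    rw [← ENNReal.ofReal_add i1 i2, ← ENNReal.ofReal_add i3 i4, ← ENNReal.ofReal_add
      (add_nonneg i1 i2) (add_nonneg i3 i4)]
    congr 1
    ring
  simp_rw [e]
  rw [lintegral_add_left (by fun_prop), lintegral_add_left (by fun_prop),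
    lintegral_add_left (by fun_prop)]
  calc _ ≤ (S + S) + (S + S) := by gcongr
    _ = _ := by ring

/-- For fixed a, both free modulations are ±τ plus a function of the lattice frequency. Integrating
in τ first removes that function and leaves a lattice sum. Expanding the product of two sums gives
the factor 4. -/
lemma lintegral_kernelA_le {lam : ℝ} (hl : 1 ≤ lam) (a : ℤ × ℝ) :
    ∫⁻ b, ENNReal.ofReal (kernelA (a.1 / lam) (b.1 / lam) (modulation lam a)
      (modulation lam (a - b)) (modulation lam b)) ∂freqMeasure ≤
      4 * (decayConst * ENNReal.ofReal lam) := by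
  have hd := measurable_decay
  have hm := measurable_modulation lam
  have e1 : ∀ b : ℤ × ℝ, decay (modulation lam (a - b)) =
      decay (b.2 - (a.2 + |((a.1 - b.1 : ℤ) : ℝ) / lam| * (((a.1 - b.1 : ℤ) : ℝ) / lam))) :=
    fun b => by
      rw [← decay_neg]
      congr 1
      simp only [modulation, Prod.fst_sub, Prod.snd_sub]
      ring
  have e2 : ∀ b : ℤ × ℝ, decay (modulation lam b) =
      decay (b.2 - -(|(b.1 : ℝ) / lam| * (b.1 / lam))) := fun b => by
    rw [sub_neg_eq_add]; rfl
  have e3 : ∀ b : ℤ × ℝ, decay (b.1 / lam) = decay (b.1 / lam - 0) := fun b => by rw [sub_zero]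
  exact lintegral_add_mul_add_le (fun _ => decay_nonneg _) (fun _ => decay_nonneg _)
    (fun _ => decay_nonneg _) (fun _ => decay_nonneg _) (by fun_prop) (by fun_prop) (by fun_prop)
    (by fun_prop)
    (lintegral_decay_mul_decay_le_of_eq hl _ (fun n : ℤ => a.2 + |((a.1 - n : ℤ) : ℝ) / lam| *
      (((a.1 - n : ℤ) : ℝ) / lam)) e3 e1)
    (lintegral_decay_mul_decay_le_of_eq hl _ (fun n : ℤ => -(|(n : ℝ) / lam| * (n / lam))) e3 e2)
    (lintegral_decay_mul_decay_le_of_eq hl _ (fun n : ℤ => a.2 + |((a.1 - n : ℤ) : ℝ) / lam| *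
      (((a.1 - n : ℤ) : ℝ) / lam)) (fun _ => rfl) e1)
    (lintegral_decay_mul_decay_le_of_eq hl _ (fun n : ℤ => -(|(n : ℝ) / lam| * (n / lam)))
      (fun _ => rfl) e2)

lemma lintegral_kernelC_le {lam : ℝ} (hl : 1 ≤ lam) (b : ℤ × ℝ) :
    ∫⁻ a, ENNReal.ofReal (kernelC (a.1 / lam) (b.1 / lam) (modulation lam a)
      (modulation lam (a - b)) (modulation lam b)) ∂freqMeasure ≤
      4 * (decayConst * ENNReal.ofReal lam) := by
  have hd := measurable_decay
  have hm := measurable_modulation lam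
  have e1 : ∀ a : ℤ × ℝ, decay (modulation lam (a - b)) =
      decay (a.2 - (b.2 - |((a.1 - b.1 : ℤ) : ℝ) / lam| * (((a.1 - b.1 : ℤ) : ℝ) / lam))) :=
    fun a => by
      congr 1
      simp only [modulation, Prod.fst_sub, Prod.snd_sub]
      ring
  have e2 : ∀ b : ℤ × ℝ, decay (modulation lam b) =
      decay (b.2 - -(|(b.1 : ℝ) / lam| * (b.1 / lam))) := fun b => by
    rw [sub_neg_eq_add]; rfl
  have e3 : ∀ b : ℤ × ℝ, decay (b.1 / lam) = decay (b.1 / lam - 0) := fun b => by rw [sub_zero]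
  have e4 : ∀ a : ℤ × ℝ, decay (a.1 / lam + modulation lam b / (2 * (b.1 / lam))) =
      decay (a.1 / lam - -(modulation lam b / (2 * (b.1 / lam)))) := fun a => by
    rw [sub_neg_eq_add]
  exact lintegral_add_mul_add_le (fun _ => decay_nonneg _) (fun _ => decay_nonneg _)
    (fun _ => decay_nonneg _) (fun _ => decay_nonneg _) (by fun_prop) (by fun_prop) (by fun_prop)
    (by fun_prop)
    (lintegral_decay_mul_decay_le_of_eq hl _ (fun n : ℤ => -(|(n : ℝ) / lam| * (n / lam))) e3 e2)
    (lintegral_decay_mul_decay_le_of_eq hl _ (fun n : ℤ => b.2 - |((n - b.1 : ℤ) : ℝ) / lam| *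
      (((n - b.1 : ℤ) : ℝ) / lam)) e3 e1)
    (lintegral_decay_mul_decay_le_of_eq hl _ (fun n : ℤ => -(|(n : ℝ) / lam| * (n / lam))) e4 e2)
    (lintegral_decay_mul_decay_le_of_eq hl _ (fun n : ℤ => b.2 - |((n - b.1 : ℤ) : ℝ) / lam| *
      (((n - b.1 : ℤ) : ℝ) / lam)) e4 e1)

lemma lintegral_kernelB_le {lam : ℝ} (hl : 1 ≤ lam) (c : ℤ × ℝ) :
    ∫⁻ b, ENNReal.ofReal (kernelB ((b + c).1 / lam) (c.1 / lam) (modulation lam (b + c))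
      (modulation lam c) (modulation lam b)) ∂freqMeasure ≤
      8 * (decayConst * ENNReal.ofReal lam) := by
  have hd := measurable_decay
  have hm := measurable_modulation lam
  set z := resonanceRoot (c.1 / lam) (modulation lam c)
  have e1 : ∀ b : ℤ × ℝ, decay (modulation lam (b + c)) =
      decay (b.2 - (-c.2 - |((b.1 + c.1 : ℤ) : ℝ) / lam| * (((b.1 + c.1 : ℤ) : ℝ) / lam))) :=
    fun a => by
      congr 1
      simp only [modulation, Prod.fst_add, Prod.snd_add]
      ring
  have e2 : ∀ b : ℤ × ℝ, decay (modulation lam b) =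
      decay (b.2 - -(|(b.1 : ℝ) / lam| * (b.1 / lam))) := fun b => by
    rw [sub_neg_eq_add]; rfl
  have e3 : ∀ r : ℝ, ∀ b : ℤ × ℝ, decay ((b + c).1 / lam - r) =
      decay (b.1 / lam - (r - c.1 / lam)) := fun r b => by
    congr 1
    simp only [Prod.fst_add, Int.cast_add]
    ring
  have key : ∀ r r' : ℝ, ∫⁻ b : ℤ × ℝ, ENNReal.ofReal ((decay ((b + c).1 / lam - r)
      + decay ((b + c).1 / lam - r')) * (decay (modulation lam (b + c))
        + decay (modulation lam b))) ∂freqMeasure ≤ 4 * (decayConst * ENNReal.ofReal lam) :=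
    fun r r' => lintegral_add_mul_add_le (fun _ => decay_nonneg _) (fun _ => decay_nonneg _)
    (fun _ => decay_nonneg _) (fun _ => decay_nonneg _) (by fun_prop) (by fun_prop) (by fun_prop)
    (by fun_prop)
    (lintegral_decay_mul_decay_le_of_eq hl _ (fun n : ℤ => -c.2 - |((n + c.1 : ℤ) : ℝ) / lam| *
      (((n + c.1 : ℤ) : ℝ) / lam)) (e3 r) e1)
    (lintegral_decay_mul_decay_le_of_eq hl _ (fun n : ℤ => -(|(n : ℝ) / lam| * (n / lam)))
      (e3 r) e2)
    (lintegral_decay_mul_decay_le_of_eq hl _ (fun n : ℤ => -c.2 - |((n + c.1 : ℤ) : ℝ) / lam| *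
      (((n + c.1 : ℤ) : ℝ) / lam)) (e3 r') e1)
    (lintegral_decay_mul_decay_le_of_eq hl _ (fun n : ℤ => -(|(n : ℝ) / lam| * (n / lam)))
      (e3 r') e2)
  -- The three centres are padded to two pairs by repeating the last one, so the two-term bound
  -- applies twice and gives 8 = 4 + 4.
  calc _ ≤ ∫⁻ b : ℤ × ℝ, (ENNReal.ofReal ((decay ((b + c).1 / lam - c.1 / lam / 2)
          + decay ((b + c).1 / lam - (c.1 / lam + z) / 2)) * (decay (modulation lam (b + c))
            + decay (modulation lam b)))
        + ENNReal.ofReal ((decay ((b + c).1 / lam - (c.1 / lam - z) / 2)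
          + decay ((b + c).1 / lam - (c.1 / lam - z) / 2)) * (decay (modulation lam (b + c))
            + decay (modulation lam b)))) ∂freqMeasure := by
        refine lintegral_mono fun b => ?_
        have n1 := decay_nonneg ((b + c).1 / lam - c.1 / lam / 2)
        have n2 := decay_nonneg ((b + c).1 / lam - (c.1 / lam + z) / 2)
        have n3 := decay_nonneg ((b + c).1 / lam - (c.1 / lam - z) / 2)
        have n4 := add_nonneg (decay_nonneg (modulation lam (b + c)))
          (decay_nonneg (modulation lam b))
        rw [← ENNReal.ofReal_add (mul_nonneg (add_nonneg n1 n2) n4)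
          (mul_nonneg (add_nonneg n3 n3) n4), ← add_mul]
        refine ENNReal.ofReal_le_ofReal (mul_le_mul_of_nonneg_right ?_ n4)
        linarith
    _ ≤ 4 * (decayConst * ENNReal.ofReal lam) + 4 * (decayConst * ENNReal.ofReal lam) := by
        rw [lintegral_add_left (by fun_prop)]
        gcongr
        · exact key _ _
        · exact key _ _
    _ = _ := by ring

lemma rpow_half_add_le (x y : ℝ≥0∞) :
    (x + y) ^ (1 / 2 : ℝ) ≤ x ^ (1 / 2 : ℝ) + y ^ (1 / 2 : ℝ) :=
  ENNReal.rpow_add_le_add_rpow _ _ (by norm_num) (by norm_num)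

lemma mul_rpow_half (x y : ℝ≥0∞) :
    (x * y) ^ (1 / 2 : ℝ) = x ^ (1 / 2 : ℝ) * y ^ (1 / 2 : ℝ) :=
  ENNReal.mul_rpow_of_nonneg _ _ (by norm_num)

lemma lintegral_lintegral_add_three {α : Type*} [MeasurableSpace α] {μ : Measure α} [SFinite μ]
    {F₁ F₂ F₃ : α × α → ℝ≥0∞} (h₁ : Measurable F₁) (h₂ : Measurable F₂) :
    ∫⁻ a, ∫⁻ b, F₁ (a, b) + F₂ (a, b) + F₃ (a, b) ∂μ ∂μ =
      ∫⁻ a, ∫⁻ b, F₁ (a, b) ∂μ ∂μ + ∫⁻ a, ∫⁻ b, F₂ (a, b) ∂μ ∂μ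
        + ∫⁻ a, ∫⁻ b, F₃ (a, b) ∂μ ∂μ := by
  have e : ∀ a, ∫⁻ b, F₁ (a, b) + F₂ (a, b) + F₃ (a, b) ∂μ =
      ∫⁻ b, F₁ (a, b) ∂μ + ∫⁻ b, F₂ (a, b) ∂μ + ∫⁻ b, F₃ (a, b) ∂μ := fun a => by
    rw [lintegral_add_left (by fun_prop), lintegral_add_left (by fun_prop)]
  simp_rw [e]
  have m₁ : Measurable fun a => ∫⁻ b, F₁ (a, b) ∂μ := h₁.lintegral_prod_right'
  have m₂ : Measurable fun a => ∫⁻ b, F₂ (a, b) ∂μ := h₂.lintegral_prod_right'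
  rw [lintegral_add_left (by fun_prop), lintegral_add_left m₁]

/-- The trilinear estimate with absolute values. -/
theorem trilinear_le {lam : ℝ} (hl : 1 ≤ lam) {h w g : ℤ × ℝ → ℝ≥0∞} (hh : Measurable h)
    (hw : Measurable w) (hg : Measurable g) :
    ∫⁻ a, ∫⁻ b, ENNReal.ofReal (totalKernel lam (a, b)) ^ (1 / 2 : ℝ) * (h a * w (a - b) * g b)
      ∂freqMeasure ∂freqMeasure ≤
      3 * (8 * decayConst) ^ (1 / 2 : ℝ) * ENNReal.ofReal lam ^ (1 / 2 : ℝ) *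
        (normTwo freqMeasure h * normTwo freqMeasure w * normTwo freqMeasure g) := by
  have hd := measurable_decay
  have hm := measurable_modulation lam
  have hmA : Measurable fun p : (ℤ × ℝ) × (ℤ × ℝ) => ENNReal.ofReal (kernelA (p.1.1 / lam)
      (p.2.1 / lam) (modulation lam p.1) (modulation lam (p.1 - p.2)) (modulation lam p.2)) := by
    unfold kernelA; fun_prop
  have hmB : Measurable fun p : (ℤ × ℝ) × (ℤ × ℝ) => ENNReal.ofReal (kernelB (p.1.1 / lam)
      ((p.1 - p.2).1 / lam) (modulation lam p.1) (modulation lam (p.1 - p.2))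
      (modulation lam p.2)) := by
    unfold kernelB resonanceRoot; fun_prop
  have hmC : Measurable fun p : (ℤ × ℝ) × (ℤ × ℝ) => ENNReal.ofReal (kernelC (p.1.1 / lam)
      (p.2.1 / lam) (modulation lam p.1) (modulation lam (p.1 - p.2)) (modulation lam p.2)) := by
    unfold kernelC; fun_prop
  have h48 : 4 * (decayConst * ENNReal.ofReal lam) ≤ 8 * (decayConst * ENNReal.ofReal lam) := by
    gcongr; norm_num
  have iA := trilinear_le_of_output_fixed (μ := freqMeasure) hmA hh hw hg
    (fun a => (lintegral_kernelA_le hl a).trans h48)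
  have iB := trilinear_le_of_input_fixed (μ := freqMeasure) hmB hh hw hg
    (S := 8 * (decayConst * ENNReal.ofReal lam)) (fun c => by
      simpa only [add_sub_cancel_left] using lintegral_kernelB_le hl c)
  have iC := trilinear_le_of_neg_fixed (μ := freqMeasure) hmC hh hw hg
    (fun a => (lintegral_kernelC_le hl a).trans h48)
  rw [← mul_assoc 8, mul_rpow_half] at iA iB iC
  set S := (8 * decayConst) ^ (1 / 2 : ℝ) * ENNReal.ofReal lam ^ (1 / 2 : ℝ)
  set N := normTwo freqMeasure h * normTwo freqMeasure w * normTwo freqMeasure g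
  have hsplit : ∀ a b : ℤ × ℝ,
      ENNReal.ofReal (totalKernel lam (a, b)) ^ (1 / 2 : ℝ) * (h a * w (a - b) * g b) ≤
      ENNReal.ofReal (kernelA (a.1 / lam) (b.1 / lam) (modulation lam a)
          (modulation lam (a - b)) (modulation lam b)) ^ (1 / 2 : ℝ) * (h a * w (a - b) * g b)
      + ENNReal.ofReal (kernelB (a.1 / lam) ((a - b).1 / lam) (modulation lam a)
          (modulation lam (a - b)) (modulation lam b)) ^ (1 / 2 : ℝ) * (h a * w (a - b) * g b)
      + ENNReal.ofReal (kernelC (a.1 / lam) (b.1 / lam) (modulation lam a)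
          (modulation lam (a - b)) (modulation lam b)) ^ (1 / 2 : ℝ) * (h a * w (a - b) * g b) := by
    intro a b
    rw [← add_mul, ← add_mul]
    refine mul_le_mul_left ?_ _
    unfold totalKernel
    rw [ENNReal.ofReal_add (add_nonneg (kernelA_nonneg _ _ _ _ _) (kernelB_nonneg _ _ _ _ _))
      (kernelC_nonneg _ _ _ _ _), ENNReal.ofReal_add (kernelA_nonneg _ _ _ _ _)
      (kernelB_nonneg _ _ _ _ _)]
    exact (rpow_half_add_le _ _).trans (by gcongr; exact rpow_half_add_le _ _)
  refine (lintegral_mono fun a => lintegral_mono fun b => hsplit a b).trans ?_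
  refine (lintegral_lintegral_add_three
    (F₁ := fun p : (ℤ × ℝ) × (ℤ × ℝ) => ENNReal.ofReal (kernelA (p.1.1 / lam)
      (p.2.1 / lam) (modulation lam p.1) (modulation lam (p.1 - p.2)) (modulation lam p.2))
        ^ (1 / 2 : ℝ) * (h p.1 * w (p.1 - p.2) * g p.2))
    (F₂ := fun p : (ℤ × ℝ) × (ℤ × ℝ) => ENNReal.ofReal (kernelB (p.1.1 / lam)
      ((p.1 - p.2).1 / lam) (modulation lam p.1) (modulation lam (p.1 - p.2)) (modulation lam p.2))
        ^ (1 / 2 : ℝ) * (h p.1 * w (p.1 - p.2) * g p.2))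
    (F₃ := fun p : (ℤ × ℝ) × (ℤ × ℝ) => ENNReal.ofReal (kernelC (p.1.1 / lam)
      (p.2.1 / lam) (modulation lam p.1) (modulation lam (p.1 - p.2)) (modulation lam p.2))
        ^ (1 / 2 : ℝ) * (h p.1 * w (p.1 - p.2) * g p.2))
    (by fun_prop) (by fun_prop)).trans_le ?_
  calc _ ≤ S * N + S * N + S * N :=
        add_le_add (add_le_add (iA.trans (le_of_eq (by ring))) (iB.trans (le_of_eq (by ring))))
          (iC.trans (le_of_eq (by ring)))
    _ = _ := by ring

/-! ### The embedding of H^(1/2) into L⁴ in time. -/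

section TimeSobolev

lemma sqrt_mul_sqrt_inv {x : ℝ} (hx : 0 < x) :
    ENNReal.ofReal (√x⁻¹) * ENNReal.ofReal (√x) = 1 := by
  rw [← ENNReal.ofReal_mul (Real.sqrt_nonneg _), ← Real.sqrt_mul (inv_nonneg.2 hx.le),
    inv_mul_cancel₀ hx.ne', Real.sqrt_one, ENNReal.ofReal_one]

lemma inv_bracket_mul_le (x y : ℝ) : (bracket x * bracket y)⁻¹ ≤ decay x + decay y := by
  have hx := bracket_pos x
  have hy := bracket_pos y
  have key : ∀ z, (bracket z)⁻¹ ^ 2 ≤ decay z := fun z => by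
    unfold decay
    rw [← Real.rpow_natCast, ← Real.rpow_neg_one, ← Real.rpow_mul (bracket_pos z).le]
    exact Real.rpow_le_rpow_of_exponent_le (one_le_bracket z) (by norm_num)
  rw [mul_inv]
  nlinarith [key x, key y, sq_nonneg ((bracket x)⁻¹ - (bracket y)⁻¹), sq_nonneg (bracket x)⁻¹,
    sq_nonneg (bracket y)⁻¹]

lemma ofReal_sqrt_sq {x : ℝ} (hx : 0 ≤ x) : ENNReal.ofReal (√x) ^ 2 = ENNReal.ofReal x := by
  rw [← ENNReal.ofReal_pow (Real.sqrt_nonneg _), Real.sq_sqrt hx]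

/-- The Sobolev embedding of `H^{1/2}` into `L⁴` on the line, for Fourier transforms of integrable
functions. -/
lemma lintegral_timeFt_pow_four_le {h : ℝ → ℂ} (hm : Measurable h) (hi : Integrable h) (r : ℝ)
    (hfin : ∫⁻ τ, ENNReal.ofReal (bracket (τ + r)) * ‖h τ‖ₑ ^ 2 ≠ ∞) :
    ∫⁻ t, ‖timeFt h t‖ₑ ^ 4 ≤ (ENNReal.ofReal (2 * Real.pi) *
      (2 * ∫⁻ x, ENNReal.ofReal (decay x))) *
        (∫⁻ τ, ENNReal.ofReal (bracket (τ + r)) * ‖h τ‖ₑ ^ 2) ^ 2 := by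
  have hd := measurable_decay
  have hb := measurable_bracket
  set H : ℝ → ℝ≥0∞ := fun τ => ENNReal.ofReal (bracket (τ + r)) * ‖h τ‖ₑ ^ 2 with hH
  have mH : Measurable H := by fun_prop
  -- The transform of h * h is the square of that of h, so the L⁴ bound is Plancherel for h * h.
  set k : ℝ → ℂ := convolution h h (ContinuousLinearMap.mul ℂ ℂ) volume with hk
  have hki : Integrable k := hi.integrable_convolution _ hi
  have hkft : ∀ t, timeFt k t = timeFt h t * timeFt h t := fun t => by
    rw [← fourier_div_two_pi, ← fourier_div_two_pi, hk, Real.fourier_mul_convolution_eq hi hi]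
  have hpt : ∀ τ, ‖k τ‖ₑ ^ 2 ≤ (2 * ∫⁻ x, ENNReal.ofReal (decay x)) *
      ∫⁻ t, H t * H (τ - t) := fun τ => by
    -- Cauchy-Schwarz with the weight (⟨t + r⟩⟨τ - t + r⟩)^(1/2). Its inverse square is integrable
    -- in t uniformly in τ, since ⟨x⟩⁻¹⟨y⟩⁻¹ is bounded by the sum of the two integrable weights.
    have h1 : ‖k τ‖ₑ ≤ ∫⁻ t, ENNReal.ofReal (√(bracket (t + r) * bracket (τ - t + r))⁻¹) *
        (ENNReal.ofReal (√(bracket (t + r) * bracket (τ - t + r))) *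
          (‖h t‖ₑ * ‖h (τ - t)‖ₑ)) := by
      refine (enorm_integral_le_lintegral_enorm _).trans (le_of_eq ?_)
      refine lintegral_congr fun t => ?_
      rw [← mul_assoc, sqrt_mul_sqrt_inv (mul_pos (bracket_pos _) (bracket_pos _)), one_mul,
        ContinuousLinearMap.mul_apply', enorm_mul]
    have h2 := h1.trans (lintegral_mul_le_normTwo (by fun_prop) (by fun_prop))
    refine (pow_le_pow_left' h2 2).trans ?_
    rw [mul_pow, normTwo_sq, normTwo_sq]
    gcongr
    · calc _ ≤ ∫⁻ t, (ENNReal.ofReal (decay (t + r)) + ENNReal.ofReal (decay (τ - t + r))) := by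
            refine lintegral_mono fun t => ?_
            rw [ofReal_sqrt_sq (inv_nonneg.2 (mul_pos (bracket_pos _) (bracket_pos _)).le),
              ← ENNReal.ofReal_add (decay_nonneg _) (decay_nonneg _)]
            exact ENNReal.ofReal_le_ofReal (inv_bracket_mul_le _ _)
        _ = _ := by
            rw [lintegral_add_left (by fun_prop),
              lintegral_add_right_eq_self (fun x => ENNReal.ofReal (decay x)) r,
              lintegral_sub_left_eq_self (fun x => ENNReal.ofReal (decay (x + r))) τ,
              lintegral_add_right_eq_self (fun x => ENNReal.ofReal (decay x)) r, two_mul]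
    · rw [mul_pow, mul_pow, ofReal_sqrt_sq (mul_pos (bracket_pos _) (bracket_pos _)).le,
        ENNReal.ofReal_mul (bracket_pos _).le]
      exact le_of_eq (by ring)
  have hconv : ∫⁻ τ, ∫⁻ t, H t * H (τ - t) = (∫⁻ τ, H τ) ^ 2 := by
    rw [lintegral_lintegral_swap (by fun_prop)]
    have e : ∀ t, ∫⁻ τ, H t * H (τ - t) = H t * ∫⁻ τ, H τ := fun t => by
      rw [lintegral_const_mul _ (by fun_prop), lintegral_sub_right_eq_self H]
    simp_rw [e]
    rw [lintegral_mul_const _ mH, sq]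
  have hk2 : ∫⁻ τ, ‖k τ‖ₑ ^ 2 ≤ (2 * ∫⁻ x, ENNReal.ofReal (decay x)) * (∫⁻ τ, H τ) ^ 2 := by
    refine (lintegral_mono hpt).trans (le_of_eq ?_)
    rw [lintegral_const_mul _ (Measurable.lintegral_prod_right' (f := fun p : ℝ × ℝ =>
      H p.2 * H (p.1 - p.2)) (by fun_prop)), hconv]
  have hkL : MemLp k 2 := memLp_two_iff_lintegral.2 ⟨hki.1, hk2.trans_lt (ENNReal.mul_lt_top
    (ENNReal.mul_lt_top (by norm_num) lintegral_decay_lt_top)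
    (ENNReal.pow_lt_top (lt_top_iff_ne_top.2 hfin)))⟩
  have hP := ((isTimeFourier_timeFt hki).lintegral_eq hkL).2
  calc ∫⁻ t, ‖timeFt h t‖ₑ ^ 4 = ∫⁻ t, ‖timeFt k t‖ₑ ^ 2 := by
        refine lintegral_congr fun t => ?_
        rw [hkft, enorm_mul]
        ring
    _ ≤ _ := by
        rw [hP, mul_assoc]
        gcongr

end TimeSobolev

end BOTorus

/-! ### Hölder, Bernstein and Parseval; the estimate in physical space. -/

namespace BOTorus

section Holder

variable {α : Type*} [MeasurableSpace α] {μ : Measure α}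

/-- Hölder's inequality with exponents `4, 2, 4`. -/
lemma lintegral_mul_mul_le_four_two_four {p q y : α → ℝ≥0∞} (hp : AEMeasurable p μ)
    (hq : AEMeasurable q μ) (hy : AEMeasurable y μ) :
    ∫⁻ x, p x * q x * y x ∂μ ≤ (∫⁻ x, p x ^ 4 ∂μ) ^ (1 / 4 : ℝ) * normTwo μ q *
      (∫⁻ x, y x ^ 4 ∂μ) ^ (1 / 4 : ℝ) := by
  have e : ∀ x, p x * q x * y x = q x * (p x * y x) := fun x => by ring
  simp_rw [e]
  refine (lintegral_mul_le_normTwo hq (hp.mul hy)).trans ?_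
  rw [mul_comm ((∫⁻ x, p x ^ 4 ∂μ) ^ (1 / 4 : ℝ)), mul_assoc]
  gcongr
  have h : ∫⁻ x, p x ^ 2 * y x ^ 2 ∂μ ≤
      (∫⁻ x, p x ^ 4 ∂μ) ^ (1 / 2 : ℝ) * (∫⁻ x, y x ^ 4 ∂μ) ^ (1 / 2 : ℝ) := by
    refine (lintegral_mul_le_normTwo (hp.pow_const 2) (hy.pow_const 2)).trans (le_of_eq ?_)
    simp only [normTwo, ← pow_mul]
  unfold normTwo
  simp_rw [Pi.mul_apply, mul_pow]
  refine (ENNReal.rpow_le_rpow h (by norm_num : (0 : ℝ) ≤ 1 / 2)).trans (le_of_eq ?_)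
  rw [mul_rpow_half, ← ENNReal.rpow_mul, ← ENNReal.rpow_mul]
  norm_num

/-- Minkowski's inequality for the squares of finitely many functions. -/
lemma lintegral_sum_sq_le {ι : Type*} (s : Finset ι) {f : ι → α → ℝ≥0∞}
    (hf : ∀ i, AEMeasurable (f i) μ) :
    ∫⁻ x, (∑ i ∈ s, f i x) ^ 2 ∂μ ≤ (∑ i ∈ s, normTwo μ (f i)) ^ 2 := by
  simp_rw [sq, Finset.sum_mul_sum]
  have hm : ∀ i j, AEMeasurable (fun x => f i x * f j x) μ := fun i j => (hf i).mul (hf j)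
  rw [lintegral_finsetSum' _ fun i _ => Finset.aemeasurable_fun_sum _ fun j _ => hm i j]
  refine Finset.sum_le_sum fun i _ => ?_
  rw [lintegral_finsetSum' _ fun j _ => hm i j]
  exact Finset.sum_le_sum fun j _ => lintegral_mul_le_normTwo (hf i) (hf j)

lemma rpow_quarter_pow_four (x : ℝ≥0∞) : (x ^ (1 / 4 : ℝ)) ^ 4 = x := by
  rw [← ENNReal.rpow_natCast, ← ENNReal.rpow_mul]
  norm_num

end Holder

section Circle

open AddCircle

lemma enorm_fourier {T : ℝ} (n : ℤ) (x : AddCircle T) : ‖fourier n x‖ₑ = 1 := by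
  rw [← ofReal_norm, fourier_apply, Circle.norm_coe, ENNReal.ofReal_one]

variable {T : ℝ} [hT : Fact (0 < T)]

lemma tsum_enorm_sq_fourierCoeff {f : AddCircle T → ℂ} (hf : MemLp f 2 haarAddCircle) :
    ∑' n : ℤ, ‖fourierCoeff f n‖ₑ ^ 2 = ∫⁻ x, ‖f x‖ₑ ^ 2 ∂haarAddCircle := by
  have h := hasSum_sq_fourierCoeff (hf.toLp f)
  rw [fourierCoeff_congr_ae hf.coeFn_toLp] at h
  have h1 : ∑' n : ℤ, ENNReal.ofReal (‖fourierCoeff f n‖ ^ 2) = ENNReal.ofReal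
      (∫ x, ‖hf.toLp f x‖ ^ 2 ∂haarAddCircle) := by
    rw [← h.tsum_eq, ENNReal.ofReal_tsum_of_nonneg (fun _ => sq_nonneg _) h.summable]
  have h2 : ∫ x, ‖hf.toLp f x‖ ^ 2 ∂haarAddCircle = ∫ x, ‖f x‖ ^ 2 ∂haarAddCircle := by
    refine integral_congr_ae ?_
    filter_upwards [hf.coeFn_toLp] with x hx
    rw [hx]
  rw [h2, ofReal_integral_eq_lintegral_ofReal hf.integrable_norm_pow'
    (Filter.Eventually.of_forall fun _ => sq_nonneg _)] at h1
  simpa only [ENNReal.ofReal_pow (norm_nonneg _), ofReal_norm] using h1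

lemma lintegral_sum_fourier_sq {ι : Type*} (A : Finset ι) {e : ι → ℤ}
    (he : Function.Injective e) (c : ι → ℂ) :
    ∫⁻ x : AddCircle T, ‖∑ i ∈ A, c i * fourier (e i) x‖ₑ ^ 2 ∂haarAddCircle
      = ∑ i ∈ A, ‖c i‖ₑ ^ 2 := by
  set f : Lp ℂ 2 (@haarAddCircle T hT) := ∑ i ∈ A, c i • fourierLp 2 (e i) with hf
  have hfe : f =ᵐ[haarAddCircle] fun x => ∑ i ∈ A, c i * fourier (e i) x := by
    have h1 : ∀ i ∈ A, (c i • fourierLp 2 (e i) : Lp ℂ 2 (@haarAddCircle T hT)) =ᵐ[haarAddCircle]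
        fun x => c i * fourier (e i) x := fun i _ => by
      filter_upwards [Lp.coeFn_smul (c i) (fourierLp (T := T) 2 (e i)),
        coeFn_fourierLp (T := T) 2 (e i)] with x hx hx'
      rw [hx, Pi.smul_apply, hx', smul_eq_mul]
    have h2 : ∀ᵐ x ∂(@haarAddCircle T hT), ∀ i ∈ A,
        (c i • fourierLp 2 (e i) : Lp ℂ 2 (@haarAddCircle T hT)) x = c i * fourier (e i) x :=
      (ae_ball_iff A.countable_toSet).2 h1
    filter_upwards [h2, Lp.coeFn_finsetSum A fun i =>
      (c i • fourierLp 2 (e i) : Lp ℂ 2 (@haarAddCircle T hT))] with x hx hx'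
    rw [hf, hx', Finset.sum_apply]
    exact Finset.sum_congr rfl hx
  have hn : ‖f‖ ^ 2 = ∑ i ∈ A, ‖c i‖ ^ 2 := by
    have h := (orthonormal_fourier (T := T)).comp e he |>.inner_sum c c A
    simp only [Function.comp_apply] at h
    rw [← hf, inner_self_eq_norm_sq_to_K] at h
    have h' : ((‖f‖ ^ 2 : ℝ) : ℂ) = ((∑ i ∈ A, ‖c i‖ ^ 2 : ℝ) : ℂ) := by
      push_cast
      rw [show ((‖f‖ : ℝ) : ℂ) ^ 2 = _ from h]
      exact Finset.sum_congr rfl fun i _ => Complex.conj_mul' _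
    exact_mod_cast h'
  have key : ‖f‖ₑ ^ 2 = ∫⁻ x, ‖f x‖ₑ ^ 2 ∂haarAddCircle := by
    rw [Lp.enorm_def, eLpNorm_eq_lintegral_rpow_enorm_toReal two_ne_zero ENNReal.ofNat_ne_top]
    simp only [ENNReal.toReal_ofNat, ENNReal.rpow_ofNat]
    rw [sq_rpow_half]
  calc _ = ∫⁻ x, ‖f x‖ₑ ^ 2 ∂haarAddCircle := by
        refine lintegral_congr_ae ?_
        filter_upwards [hfe] with x hx
        rw [hx]
    _ = _ := by
        rw [← key, ← ofReal_norm, ← ENNReal.ofReal_pow (norm_nonneg _), hn,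
          ENNReal.ofReal_sum_of_nonneg fun _ _ => sq_nonneg _]
        exact Finset.sum_congr rfl fun i _ => by
          rw [ENNReal.ofReal_pow (norm_nonneg _), ofReal_norm]

lemma enorm_sum_fourier_sq_le {ι : Type*} (A : Finset ι) (e : ι → ℤ) (c : ι → ℂ)
    (x : AddCircle T) :
    ‖∑ i ∈ A, c i * fourier (e i) x‖ₑ ^ 2 ≤ (A.card : ℝ≥0∞) * ∑ i ∈ A, ‖c i‖ₑ ^ 2 := by
  have h1 : ‖∑ i ∈ A, c i * fourier (e i) x‖ₑ ≤ ∑ i ∈ A, ‖c i‖ₑ := by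
    refine (enorm_sum_le _ _).trans (le_of_eq (Finset.sum_congr rfl fun i _ => ?_))
    rw [enorm_mul, enorm_fourier, mul_one]
  refine (pow_le_pow_left' h1 2).trans ?_
  have := ENNReal.inner_le_Lp_mul_Lq A (fun _ => 1) (fun i => ‖c i‖ₑ) Real.HolderConjugate.two_two
  simp only [one_mul, Finset.sum_const, nsmul_eq_mul, ENNReal.rpow_ofNat] at this
  refine (pow_le_pow_left' this 2).trans (le_of_eq ?_)
  simp only [mul_pow, sq_rpow_half, one_pow, mul_one]

/-- Bernstein's inequality from `L²` to `L⁴` for trigonometric polynomials. -/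
lemma lintegral_sum_fourier_pow_four_le {ι : Type*} (A : Finset ι) {e : ι → ℤ}
    (he : Function.Injective e) (c : ι → ℂ) :
    ∫⁻ x : AddCircle T, ‖∑ i ∈ A, c i * fourier (e i) x‖ₑ ^ 4 ∂haarAddCircle
      ≤ A.card * (∑ i ∈ A, ‖c i‖ₑ ^ 2) ^ 2 := by
  calc _ ≤ ∫⁻ x : AddCircle T, ((A.card : ℝ≥0∞) * ∑ i ∈ A, ‖c i‖ₑ ^ 2) *
        ‖∑ i ∈ A, c i * fourier (e i) x‖ₑ ^ 2 ∂haarAddCircle := by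
        refine lintegral_mono fun x => ?_
        rw [show 4 = 2 + 2 from rfl, pow_add]
        gcongr
        exact enorm_sum_fourier_sq_le A e c x
    _ = _ := by
        rw [lintegral_const_mul _ (by fun_prop), lintegral_sum_fourier_sq A he]
        ring

end Circle

section Torus

open AddCircle

variable {lam : ℝ} [hl : Fact (1 ≤ lam)]

lemma lam_pos : 0 < lam := zero_lt_one.trans_le hl.out

lemma volume_eq_smul_prod : (volume : Measure (ℝ × Torus lam)) =
    ENNReal.ofReal (2 * Real.pi * lam) • (volume : Measure ℝ).prod haarAddCircle := by
  rw [Measure.volume_eq_prod, volume_eq_smul_haarAddCircle, Measure.prod_smul_right]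

lemma period_pos : 0 < 2 * Real.pi * lam := mul_pos Real.two_pi_pos lam_pos

lemma aestronglyMeasurable_prod_haar {v : ℝ × Torus lam → ℂ} (hv : AEStronglyMeasurable v volume) :
    AEStronglyMeasurable v ((volume : Measure ℝ).prod haarAddCircle) := by
  rw [volume_eq_smul_prod] at hv
  refine hv.mono_ac (Measure.absolutelyContinuous_smul ?_)
  simpa using period_pos

lemma lintegral_volume_eq (f : ℝ × Torus lam → ℝ≥0∞) :
    ∫⁻ x, f x = ENNReal.ofReal (2 * Real.pi * lam) *
      ∫⁻ x, f x ∂(volume : Measure ℝ).prod haarAddCircle := by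
  rw [volume_eq_smul_prod, lintegral_smul_measure, smul_eq_mul]

lemma aestronglyMeasurable_coeffs {v : ℝ × Torus lam → ℂ} (hv : AEStronglyMeasurable v volume)
    (n : ℤ) : AEStronglyMeasurable (coeffs v n) volume := by
  have h := aestronglyMeasurable_prod_haar hv
  have h2 : AEStronglyMeasurable (fun p : ℝ × Torus lam => fourier (-n) p.2 • v p)
      ((volume : Measure ℝ).prod haarAddCircle) :=
    AEStronglyMeasurable.smul
      ((map_continuous (fourier (-n))).comp continuous_snd).aestronglyMeasurable h
  exact h2.integral_prod_right'

/-- Parseval's identity in space, integrated over time. -/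
lemma tsum_lintegral_coeffs_sq {v : ℝ × Torus lam → ℂ} (hv : MemLp v 2 volume) :
    ENNReal.ofReal (2 * Real.pi * lam) * ∑' n : ℤ, ∫⁻ t, ‖coeffs v n t‖ₑ ^ 2 =
      ∫⁻ x, ‖v x‖ₑ ^ 2 := by
  rw [memLp_two_iff_lintegral] at hv
  have hm := aestronglyMeasurable_prod_haar hv.1
  rw [lintegral_volume_eq]
  congr 1
  have hfin : ∫⁻ x, ‖v x‖ₑ ^ 2 ∂(volume : Measure ℝ).prod haarAddCircle < ∞ := by
    have := hv.2
    rw [lintegral_volume_eq] at this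
    exact ENNReal.lt_top_of_mul_ne_top_right this.ne (by simpa using period_pos)
  rw [lintegral_prod _ (hm.enorm.pow_const 2)] at hfin ⊢
  rw [← lintegral_tsum fun n =>
    ((aestronglyMeasurable_coeffs hv.1 n).enorm.pow_const 2)]
  refine lintegral_congr_ae ?_
  have hm' := hm.enorm.pow_const (2 : ℕ)
  filter_upwards [ae_lt_top' hm'.lintegral_prod_right' hfin.ne, hm.prodMk_left] with t ht hmt
  exact tsum_enorm_sq_fourierCoeff (memLp_two_iff_lintegral.2 ⟨hmt, ht⟩)

lemma memLp_coeffs {v : ℝ × Torus lam → ℂ} (hv : MemLp v 2 volume) (n : ℤ) :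
    MemLp (coeffs v n) 2 := by
  refine memLp_two_iff_lintegral.2 ⟨aestronglyMeasurable_coeffs hv.1 n, ?_⟩
  have h := (memLp_two_iff_lintegral.1 hv).2
  rw [← tsum_lintegral_coeffs_sq hv] at h
  have := ENNReal.lt_top_of_mul_ne_top_right h.ne (by simpa using period_pos)
  exact (ENNReal.le_tsum n).trans_lt this

/-- The estimate in physical space: a product of three functions, two of which are
trigonometric polynomials in space, is estimated by Hölder's inequality. -/
lemma enorm_sum_integral_le {v : ℝ × Torus lam → ℂ} (hv : AEStronglyMeasurable v volume)
    (hv4 : ∫⁻ x, ‖v x‖ₑ ^ 4 < ∞) (A B : Finset ℤ) {H V : ℤ → ℝ → ℂ}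
    (hH : ∀ n, Continuous (H n)) (hH4 : ∀ n, ∫⁻ t, ‖H n t‖ₑ ^ 4 < ∞) (hV : ∀ k, MemLp (V k) 2) :
    ‖∑ n ∈ A, ∑ k ∈ B, ∫ t, H n t * (V k t * coeffs v (n - k) t)‖ₑ ≤
      (A.card : ℝ≥0∞) ^ (1 / 4 : ℝ) *
        (∑ n ∈ A, (∫⁻ t, ‖H n t‖ₑ ^ 4) ^ (1 / 2 : ℝ)) ^ (1 / 2 : ℝ) *
        (∑ k ∈ B, ∫⁻ t, ‖V k t‖ₑ ^ 2) ^ (1 / 2 : ℝ) *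
        (∫⁻ x, ‖v x‖ₑ ^ 4 ∂(volume : Measure ℝ).prod haarAddCircle) ^ (1 / 4 : ℝ) := by
  have hm := aestronglyMeasurable_prod_haar hv
  set I := ∫⁻ x, ‖v x‖ₑ ^ 4 ∂(volume : Measure ℝ).prod haarAddCircle with hI
  have hIfin : I < ∞ := by
    rw [lintegral_volume_eq] at hv4
    exact ENNReal.lt_top_of_mul_ne_top_right hv4.ne (by simpa using period_pos)
  set y : ℝ → ℝ≥0∞ := fun t => (∫⁻ x, ‖v (t, x)‖ₑ ^ 4 ∂haarAddCircle) ^ (1 / 4 : ℝ) with hy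
  have hm4 := hm.enorm.pow_const (4 : ℕ)
  have my : AEMeasurable y volume := hm4.lintegral_prod_right'.pow_const _
  have hyI : ∫⁻ t, y t ^ 4 = I := by
    rw [hI, lintegral_prod _ hm4]
    exact lintegral_congr fun t => rpow_quarter_pow_four _
  have hsec : ∀ᵐ t : ℝ, AEStronglyMeasurable (fun x => v (t, x)) haarAddCircle := hm.prodMk_left
  have hL1 : ∀ᵐ t : ℝ, AEStronglyMeasurable (fun x => v (t, x)) haarAddCircle →
      ∫⁻ x, ‖v (t, x)‖ₑ ∂haarAddCircle ≤ y t := Filter.Eventually.of_forall fun t ht => by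
    have := lintegral_mul_mul_le_four_two_four (μ := @haarAddCircle (2 * Real.pi * lam) _)
      (p := fun _ => 1) (q := fun _ => 1) (by fun_prop) (by fun_prop) ht.enorm
    simpa [normTwo, hy] using this
  have hyfin : ∀ᵐ t : ℝ, y t < ∞ := by
    have h4 : ∫⁻ t, y t ^ 4 ≠ ∞ := by rw [hyI]; exact hIfin.ne
    filter_upwards [ae_lt_top' (my.pow_const 4) h4] with t ht
    exact (ENNReal.pow_lt_top_iff.1 ht).resolve_right (by norm_num)
  have hcoef : ∀ n : ℤ, ∀ᵐ t : ℝ, ‖coeffs v n t‖ₑ ≤ y t := fun n => by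
    filter_upwards [hsec, hL1] with t h1 h2
    refine le_trans (enorm_integral_le_lintegral_enorm _) (le_trans (le_of_eq ?_) (h2 h1))
    refine lintegral_congr fun x => ?_
    rw [enorm_smul, enorm_fourier, one_mul]
  have hint : ∀ n k, Integrable (fun t => H n t * (V k t * coeffs v (n - k) t)) := fun n k => by
    refine ⟨(hH n).aestronglyMeasurable.mul ((hV k).1.mul (aestronglyMeasurable_coeffs hv _)), ?_⟩
    calc ∫⁻ t, ‖H n t * (V k t * coeffs v (n - k) t)‖ₑ ≤ ∫⁻ t, ‖H n t‖ₑ * ‖V k t‖ₑ * y t := by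
          refine lintegral_mono_ae ?_
          filter_upwards [hcoef (n - k)] with t ht
          rw [enorm_mul, enorm_mul, ← mul_assoc]
          gcongr
      _ ≤ _ := lintegral_mul_mul_le_four_two_four (hH n).enorm.measurable.aemeasurable
          (hV k).1.enorm my
      _ < ∞ := by
          refine ENNReal.mul_lt_top (ENNReal.mul_lt_top ?_ ?_) ?_
          · exact ENNReal.rpow_lt_top_of_nonneg (by norm_num) (hH4 n).ne
          · exact ENNReal.rpow_lt_top_of_nonneg (by norm_num)
              (memLp_two_iff_lintegral.1 (hV k)).2.ne
          · rw [hyI]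
            exact ENNReal.rpow_lt_top_of_nonneg (by norm_num) hIfin.ne
  have hsum : ∑ n ∈ A, ∑ k ∈ B, ∫ t, H n t * (V k t * coeffs v (n - k) t) =
      ∫ t, ∑ n ∈ A, ∑ k ∈ B, H n t * (V k t * coeffs v (n - k) t) := by
    rw [integral_finsetSum _ fun n _ => integrable_finsetSum _ fun k _ => hint n k]
    exact Finset.sum_congr rfl fun n _ => (integral_finsetSum _ fun k _ => hint n k).symm
  rw [hsum]
  refine (enorm_integral_le_lintegral_enorm _).trans ?_
  have hpt : ∀ᵐ t : ℝ, ‖∑ n ∈ A, ∑ k ∈ B, H n t * (V k t * coeffs v (n - k) t)‖ₑ ≤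
      ((A.card : ℝ≥0∞) ^ (1 / 4 : ℝ) * (∑ n ∈ A, ‖H n t‖ₑ ^ 2) ^ (1 / 2 : ℝ)) *
        (∑ k ∈ B, ‖V k t‖ₑ ^ 2) ^ (1 / 2 : ℝ) * y t := by
    filter_upwards [hsec, hL1, hyfin] with t h1 h2 h3
    have hi : Integrable (fun x => v (t, x)) haarAddCircle := ⟨h1, (h2 h1).trans_lt h3⟩
    -- At fixed time the convolution sum is a torus integral of v against two trigonometric
    -- polynomials, with frequencies -n and k, to which Hölder applies.
    have e : ∑ n ∈ A, ∑ k ∈ B, H n t * (V k t * coeffs v (n - k) t) =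
        ∫ x, (∑ n ∈ A, H n t * fourier (-n) x) * (∑ k ∈ B, V k t * fourier k x) * v (t, x)
          ∂haarAddCircle := by
      have e1 : ∀ x : Torus lam, (∑ n ∈ A, H n t * fourier (-n) x) *
          (∑ k ∈ B, V k t * fourier k x) * v (t, x) =
          ∑ n ∈ A, ∑ k ∈ B, H n t * V k t * (fourier (-(n - k)) x • v (t, x)) := fun x => by
        rw [Finset.sum_mul_sum, Finset.sum_mul]
        refine Finset.sum_congr rfl fun n _ => ?_
        rw [Finset.sum_mul]
        refine Finset.sum_congr rfl fun k _ => ?_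
        rw [show -(n - k) = -n + k by ring, fourier_add, smul_eq_mul]
        ring
      simp_rw [e1]
      have i1 : ∀ n k : ℤ, Integrable (fun x : Torus lam => H n t * V k t *
          (fourier (-(n - k)) x • v (t, x))) haarAddCircle := fun n k =>
        (hi.fourier_smul _).const_mul _
      rw [integral_finsetSum _ fun n _ => integrable_finsetSum _ fun k _ => i1 n k]
      refine Finset.sum_congr rfl fun n _ => ?_
      rw [integral_finsetSum _ fun k _ => i1 n k]
      refine Finset.sum_congr rfl fun k _ => ?_
      rw [integral_const_mul, ← mul_assoc]
      rfl
    rw [e]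
    refine (enorm_integral_le_lintegral_enorm _).trans ?_
    simp_rw [enorm_mul]
    refine (lintegral_mul_mul_le_four_two_four (by fun_prop) (by fun_prop) h1.enorm).trans ?_
    unfold normTwo
    rw [lintegral_sum_fourier_sq B (e := fun k => k) (fun _ _ h => h) (fun k => V k t)]
    gcongr
    refine (ENNReal.rpow_le_rpow (lintegral_sum_fourier_pow_four_le A neg_injective _)
      (by norm_num : (0 : ℝ) ≤ 1 / 4)).trans (le_of_eq ?_)
    rw [ENNReal.mul_rpow_of_nonneg _ _ (by norm_num), ← ENNReal.rpow_natCast, ← ENNReal.rpow_mul]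
    norm_num
  have mp : Measurable fun t => ∑ n ∈ A, ‖H n t‖ₑ ^ 2 :=
    Finset.measurable_fun_sum _ fun n _ => (hH n).enorm.measurable.pow_const 2
  have mq : AEMeasurable (fun t => ∑ k ∈ B, ‖V k t‖ₑ ^ 2) volume :=
    Finset.aemeasurable_fun_sum _ fun k _ => (hV k).1.enorm.pow_const 2
  refine (lintegral_mono_ae hpt).trans ?_
  refine (lintegral_mul_mul_le_four_two_four ((mp.pow_const _).const_mul _).aemeasurable
    (mq.pow_const _) my).trans ?_
  rw [hyI]
  gcongr
  · simp_rw [mul_pow, rpow_quarter_pow_four]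
    rw [lintegral_const_mul _ ((mp.pow_const _).pow_const 4),
      ENNReal.mul_rpow_of_nonneg _ _ (by norm_num)]
    gcongr
    have e : ∀ t, ((∑ n ∈ A, ‖H n t‖ₑ ^ 2) ^ (1 / 2 : ℝ)) ^ 4 =
        (∑ n ∈ A, ‖H n t‖ₑ ^ 2) ^ 2 := fun t => by
      rw [show 4 = 2 * 2 from rfl, pow_mul, sq_rpow_half]
    simp_rw [e]
    -- Minkowski moves the time norm inside the sum over n, so the Sobolev embedding in time can be
    -- used one frequency at a time.
    have h := lintegral_sum_sq_le (μ := volume) A (f := fun n t => ‖H n t‖ₑ ^ 2)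
      fun n => ((hH n).enorm.measurable.pow_const 2).aemeasurable
    refine (ENNReal.rpow_le_rpow h (by norm_num : (0 : ℝ) ≤ 1 / 4)).trans (le_of_eq ?_)
    rw [← ENNReal.rpow_natCast, ← ENNReal.rpow_mul]
    unfold normTwo
    simp_rw [← pow_mul]
    norm_num
  · unfold normTwo
    simp_rw [sq_rpow_half]
    rw [lintegral_finsetSum' _ fun k _ => (hV k).1.enorm.pow_const 2]

end Torus

end BOTorus

/-! ### Weights, the symbol bound, and freezing of the symbol. -/

namespace BOTorus

/-- The weight of the norm dual to `X^{s+1/2,-1/2}`. -/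
noncomputable def weightDual (lam s : ℝ) (a : ℤ × ℝ) : ℝ≥0∞ :=
  ENNReal.ofReal (bracket (modulation lam a) ^ (1 / 2 : ℝ) * bracket (a.1 / lam) ^ (-(s + 1 / 2)))

/-- The weight of `X^{s+1/2,1/2}`. -/
noncomputable def weightIn (lam s : ℝ) (a : ℤ × ℝ) : ℝ≥0∞ :=
  ENNReal.ofReal (bracket (modulation lam a) ^ (1 / 2 : ℝ) * bracket (a.1 / lam) ^ (s + 1 / 2))

/-- The weight of the sum of `X^{s,0}` and `X^{s-1,1}`. -/
noncomputable def weightNeg (lam s : ℝ) (a : ℤ × ℝ) : ℝ≥0∞ :=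
  ENNReal.ofReal (bracket (a.1 / lam) ^ (s - 1) *
    (bracket (a.1 / lam) + bracket (modulation lam a)))

lemma measurable_weightDual (lam s : ℝ) : Measurable (weightDual lam s) := by
  have h1 := measurable_bracket
  have h2 := measurable_modulation lam
  unfold weightDual; fun_prop

lemma measurable_weightIn (lam s : ℝ) : Measurable (weightIn lam s) := by
  have h1 := measurable_bracket
  have h2 := measurable_modulation lam
  unfold weightIn; fun_prop

lemma measurable_weightNeg (lam s : ℝ) : Measurable (weightNeg lam s) := by
  have h1 := measurable_bracket
  have h2 := measurable_modulation lam
  unfold weightNeg; fun_prop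

lemma measurable_enorm_uncurry {F : ℤ → ℝ → ℂ} (hF : ∀ n, Measurable (F n)) :
    Measurable fun a : ℤ × ℝ => ‖F a.1 a.2‖ₑ :=
  (measurable_from_prod_countable_right hF).enorm

lemma bracket_rpow_eq_exp (x r : ℝ) : bracket x ^ r = Real.exp (Real.log (bracket x) * r) :=
  Real.rpow_def_of_pos (bracket_pos x) r

lemma log_bracket_le_add (x y : ℝ) :
    Real.log (bracket x) ≤ Real.log (bracket (x - y)) + Real.log (bracket y) := by
  rw [← Real.log_mul (bracket_pos _).ne' (bracket_pos _).ne']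
  refine Real.log_le_log (bracket_pos _) ?_
  unfold bracket
  have h1 : |x| ≤ |x - y| + |y| := by simpa using abs_add_le (x - y) y
  nlinarith [mul_nonneg (abs_nonneg (x - y)) (abs_nonneg y)]

/-- For s = 1/4 the weights cancel the exponential up to |ξ₂| ≤ ⟨ξ₂⟩. For general s there remains
(⟨ξ₁⟩⟨ξ₂⟩/⟨ξ⟩)^(s - 1/4) ≥ 1. -/
lemma exp_kernelLog_half_ge {ξ ξ₂ σ₁ σ₂ s : ℝ} (hs : 1 / 4 ≤ s) :
    |ξ₂| ≤ Real.exp (kernelLog ξ ξ₂ σ₁ σ₂ / 2) *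
      ((bracket (σ₁ + σ₂ + 2 * ξ * ξ₂) ^ (1 / 2 : ℝ) * bracket ξ ^ (-(s + 1 / 2))) *
        (bracket σ₁ ^ (1 / 2 : ℝ) * bracket (ξ - ξ₂) ^ (s + 1 / 2)) *
        (bracket ξ₂ ^ (s - 1) * (bracket ξ₂ + bracket σ₂))) := by
  have hb : 0 < bracket ξ₂ + bracket σ₂ := add_pos (bracket_pos _) (bracket_pos _)
  have h1 : |ξ₂| ≤ Real.exp (Real.log (bracket ξ₂)) := by
    rw [Real.exp_log (bracket_pos _)]
    unfold bracket; linarith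
  refine h1.trans ?_
  simp only [bracket_rpow_eq_exp]
  conv_rhs => rw [← Real.exp_log hb]
  simp only [← Real.exp_add]
  refine Real.exp_le_exp.2 ?_
  unfold kernelLog kernelExp
  have h2 := log_bracket_le_add ξ ξ₂
  nlinarith

/-- The pointwise bound for the symbol of the product, in terms of the kernels. -/
lemma symbol_le {lam s D : ℝ} (hl : 0 < lam) (hs : 1 / 4 ≤ s) {a b : ℤ × ℝ} (ha : 1 < a.1 / lam)
    (hb : b.1 < 0) (hD0 : 0 ≤ D) (hD1 : D ≤ 1)
    (hD : ∀ j : ℕ, NearPair j (a.1 / lam) ((a - b).1 / lam) →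
      (j : ℝ) ^ 8 / 10 ≤ |modulation lam (a - b)| → D ≤ 1 / j) :
    ENNReal.ofReal (|b.1 / lam| * D) ≤ ENNReal.ofReal (Real.exp 1000000000) *
      (ENNReal.ofReal (totalKernel lam (a, b)) ^ (1 / 2 : ℝ) *
        (weightDual lam s a * weightIn lam s (a - b) * weightNeg lam s b)) := by
  have ha0 : 0 < a.1 := by
    have : (0 : ℝ) < a.1 := by
      have := mul_pos (zero_lt_one.trans ha) hl
      rwa [div_mul_cancel₀ _ hl.ne'] at this
    exact_mod_cast this
  have hb' : (b.1 : ℝ) / lam < 0 := div_neg_of_neg_of_pos (by exact_mod_cast hb) hl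
  have e1 : ((a - b).1 : ℝ) / lam = a.1 / lam - b.1 / lam := by
    rw [Prod.fst_sub, Int.cast_sub, sub_div]
  have hk := kernel_le (σ₁ := modulation lam (a - b)) (σ₂ := modulation lam b) ha hb' hD0 hD1
    (by rwa [← e1])
  rw [kernelSum_eq_totalKernel hl ha0 hb] at hk
  have hK0 : 0 ≤ totalKernel lam (a, b) := by
    have : 0 ≤ Real.exp 2000000000 * totalKernel lam (a, b) := le_trans (by positivity) hk
    exact nonneg_of_mul_nonneg_right this (Real.exp_pos _)
  set L := kernelLog (a.1 / lam) (b.1 / lam) (modulation lam (a - b)) (modulation lam b)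
  have hk2 : D * Real.exp (L / 2) ≤
      Real.exp 1000000000 * totalKernel lam (a, b) ^ (1 / 2 : ℝ) := by
    refine le_of_sq_le_sq ?_ (by positivity)
    rw [mul_pow, mul_pow, ← Real.exp_nat_mul, ← Real.exp_nat_mul, ← Real.sqrt_eq_rpow,
      Real.sq_sqrt hK0]
    refine le_of_eq_of_le ?_ (hk.trans_eq ?_)
    · congr 2; push_cast; ring
    · congr 2; norm_num
  have h3 := exp_kernelLog_half_ge (ξ := a.1 / lam) (ξ₂ := b.1 / lam)
    (σ₁ := modulation lam (a - b)) (σ₂ := modulation lam b) hs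
  rw [← resonance_identity hl ha0 hb] at h3
  unfold weightDual weightIn weightNeg
  have p := bracket_pos
  rw [ENNReal.ofReal_rpow_of_nonneg hK0 (by norm_num),
    ← ENNReal.ofReal_mul (by have := p (modulation lam a); have := p (a.1 / lam); positivity),
    ← ENNReal.ofReal_mul (by
      have := p (modulation lam a); have := p (a.1 / lam)
      have := p (modulation lam (a - b)); have := p ((a - b).1 / lam); positivity),
    ← ENNReal.ofReal_mul (by positivity), ← ENNReal.ofReal_mul (by positivity), e1]
  refine ENNReal.ofReal_le_ofReal ?_
  set Q := bracket (modulation lam a) ^ (1 / 2 : ℝ) * bracket (a.1 / lam) ^ (-(s + 1 / 2)) *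
    (bracket (modulation lam (a - b)) ^ (1 / 2 : ℝ) *
      bracket (a.1 / lam - b.1 / lam) ^ (s + 1 / 2)) *
    (bracket (b.1 / lam) ^ (s - 1) * (bracket (b.1 / lam) + bracket (modulation lam b))) with hQ
  have hQ0 : 0 ≤ Q := by
    have := p (modulation lam a); have := p (a.1 / lam)
    have := p (modulation lam (a - b)); have := p (a.1 / lam - b.1 / lam)
    have := p (b.1 / lam); have := p (modulation lam b)
    positivity
  calc |(b.1 : ℝ) / lam| * D ≤ Real.exp (L / 2) * Q * D := by gcongr
    _ = D * Real.exp (L / 2) * Q := by ring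
    _ ≤ Real.exp 1000000000 * totalKernel lam (a, b) ^ (1 / 2 : ℝ) * Q := by gcongr
    _ = _ := by ring

lemma enorm_integral_timeFt_mul_le {h f F g G : ℝ → ℂ} (hh : Integrable h) (hf : MemLp f 2)
    (hg : MemLp g 2) (hF : IsTimeFourier f F) (hG : IsTimeFourier g G) :
    ‖∫ t, timeFt h t * (f t * g t)‖ₑ ≤ ∫⁻ τ, ∫⁻ τ', ‖h τ‖ₑ * (‖F (τ - τ')‖ₑ * ‖G τ'‖ₑ) := by
  have hfg : Integrable fun t => f t * g t := hf.integrable_mul hg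
  rw [integral_mul_timeFt hh hfg]
  refine (enorm_integral_le_lintegral_enorm _).trans (lintegral_mono fun τ => ?_)
  rw [enorm_mul]
  refine le_trans ?_ (lintegral_const_mul_le _ _)
  gcongr
  have h2 := timeFt_mul_eq hf hg hF hG τ
  calc ‖timeFt (fun t => f t * g t) τ‖ₑ
      ≤ ‖2 * Real.pi * timeFt (fun t => f t * g t) τ‖ₑ := by
        rw [enorm_mul]
        refine le_mul_of_one_le_left zero_le ?_
        rw [← ofReal_norm, ← ENNReal.ofReal_one]
        refine ENNReal.ofReal_le_ofReal ?_
        rw [norm_mul, Complex.norm_real, Complex.norm_two, Real.norm_eq_abs,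
          abs_of_pos Real.pi_pos]
        linarith [Real.pi_gt_three]
    _ ≤ _ := by
        rw [h2]
        refine (enorm_integral_le_lintegral_enorm _).trans (le_of_eq ?_)
        simp_rw [enorm_mul]

/-- The symbol of `J^s`. -/
noncomputable def besselSymbol (s ξ : ℝ) : ℝ := (1 + |ξ| ^ 2) ^ (s / 2)

lemma besselSymbol_pos (s ξ : ℝ) : 0 < besselSymbol s ξ := by unfold besselSymbol; positivity

lemma abs_exp_sub_one_le_mul (x : ℝ) : |Real.exp x - 1| ≤ |x| * Real.exp |x| := by
  have h1 : Real.exp x - 1 ≤ x * Real.exp x := by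
    have := Real.add_one_le_exp (-x)
    have h2 := mul_le_mul_of_nonneg_right this (Real.exp_pos x).le
    rw [← Real.exp_add, neg_add_cancel, Real.exp_zero] at h2
    linarith
  have h2 := Real.add_one_le_exp x
  have h3 : x * Real.exp x ≤ |x| * Real.exp |x| := by
    gcongr <;> exact le_abs_self x
  have h4 : |x| ≤ |x| * Real.exp |x| :=
    le_mul_of_one_le_right (abs_nonneg _) (Real.one_le_exp (abs_nonneg _))
  rw [abs_le]
  constructor <;> linarith [neg_abs_le x]

lemma abs_log_le_of_abs_sub_one_le {ρ δ : ℝ} (h : |ρ - 1| ≤ δ) (hδ : δ ≤ 1 / 3) :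
    |Real.log ρ| ≤ 3 / 2 * δ := by
  obtain ⟨h1, h2⟩ := abs_le.1 h
  have hρ : 0 < ρ := by linarith
  have h3 := Real.log_le_sub_one_of_pos hρ
  have h4 := Real.log_le_sub_one_of_pos (inv_pos.2 hρ)
  rw [Real.log_inv] at h4
  have h5 : ρ⁻¹ - 1 ≤ 3 / 2 * δ := by
    rw [sub_le_iff_le_add, inv_le_iff_one_le_mul₀ hρ]
    nlinarith
  rw [abs_le]
  constructor <;> linarith [abs_nonneg (ρ - 1)]

/-- Constant in the comparison of `ξ` with `ξ₀ ⟨ξ⟩ˢ / ⟨ξ₀⟩ˢ` near `ξ₀`. -/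
noncomputable def freezeConst (s : ℝ) : ℝ := (s + 1) * 50 * Real.exp ((s + 1) * 50)

lemma one_le_freezeConst {s : ℝ} (hs : 0 ≤ s) : 1 ≤ freezeConst s := by
  unfold freezeConst
  have := Real.one_le_exp (show 0 ≤ (s + 1) * 50 by linarith)
  nlinarith

/-- The ratio of the frozen symbol to y is exp e with |e| ≤ (s + 1)|log(y/y₀)|, because log(1 + y²)
varies at most twice as fast as log y. The hypothesis makes |log(y/y₀)| at most (3/2)(33/j) ≤ 50/j.
-/
lemma abs_sub_frozen_le {s y y₀ j : ℝ} (hs : 0 ≤ s) (hj : 100 ≤ j) (hy₀ : 0 < y₀)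
    (h : |y - y₀| ≤ 33 / j * y₀) :
    |y - y₀ / besselSymbol s y₀ * besselSymbol s y| ≤ freezeConst s * y * (1 / j) := by
  have hj0 : 0 < j := by linarith
  have hδ : 33 / j ≤ 1 / 3 := by rw [div_le_div_iff₀ hj0 (by norm_num)]; linarith
  have hρ1 : |y / y₀ - 1| ≤ 33 / j := by
    rw [show y / y₀ - 1 = (y - y₀) / y₀ by field_simp, abs_div, abs_of_pos hy₀,
      div_le_iff₀ hy₀]
    exact h
  have hlog := abs_log_le_of_abs_sub_one_le hρ1 hδ
  have hy : 0 < y := by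
    have := (abs_le.1 hρ1).1
    have : 0 < y / y₀ := by linarith
    exact (div_pos_iff_of_pos_right hy₀).1 this
  have hθ : |Real.log (1 + |y| ^ 2) - Real.log (1 + |y₀| ^ 2)| ≤
      2 * |Real.log y - Real.log y₀| := by
    have key : ∀ {a b : ℝ}, 0 < a → a ≤ b →
        |Real.log (1 + |b| ^ 2) - Real.log (1 + |a| ^ 2)| ≤ 2 * |Real.log b - Real.log a| := by
      intro a b ha hab
      have hb := ha.trans_le hab
      rw [abs_of_pos ha, abs_of_pos hb]
      have h1 : Real.log (1 + a ^ 2) ≤ Real.log (1 + b ^ 2) :=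
        Real.log_le_log (by positivity) (by gcongr)
      have h2 : Real.log a ≤ Real.log b := Real.log_le_log ha hab
      have h3 : Real.log ((1 + b ^ 2) * a ^ 2) ≤ Real.log ((1 + a ^ 2) * b ^ 2) := by
        refine Real.log_le_log (by positivity) ?_
        nlinarith [pow_le_pow_left₀ ha.le hab 2]
      rw [Real.log_mul (by positivity) (by positivity),
        Real.log_mul (by positivity) (by positivity), Real.log_pow, Real.log_pow] at h3
      rw [abs_of_nonneg (sub_nonneg.2 h1), abs_of_nonneg (sub_nonneg.2 h2)]
      push_cast at h3
      linarith
    rcases le_total y y₀ with h | h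
    · rw [abs_sub_comm, abs_sub_comm (Real.log y)]
      exact key hy h
    · exact key hy₀ h
  rw [Real.log_div hy.ne' hy₀.ne'] at hlog
  set l := Real.log y - Real.log y₀ with hl
  set e := s / 2 * (Real.log (1 + |y| ^ 2) - Real.log (1 + |y₀| ^ 2)) - l with he
  have e1 : y - y₀ / besselSymbol s y₀ * besselSymbol s y = -(y * (Real.exp e - 1)) := by
    have h1 : besselSymbol s y / besselSymbol s y₀ =
        Real.exp (s / 2 * (Real.log (1 + |y| ^ 2) - Real.log (1 + |y₀| ^ 2))) := by
      unfold besselSymbol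
      rw [Real.rpow_def_of_pos (by positivity), Real.rpow_def_of_pos (by positivity),
        ← Real.exp_sub]
      congr 1; ring
    have h2 : Real.exp l = y / y₀ := by
      rw [hl, Real.exp_sub, Real.exp_log hy, Real.exp_log hy₀]
    rw [he, Real.exp_sub, ← h1, h2]
    field_simp
    ring
  have he2 : |e| ≤ (s + 1) * 50 / j := by
    calc |e| ≤ |s / 2 * (Real.log (1 + |y| ^ 2) - Real.log (1 + |y₀| ^ 2))| + |l| := abs_sub _ _
      _ ≤ s / 2 * (2 * |l|) + |l| := by
          rw [abs_mul, abs_of_nonneg (by positivity : 0 ≤ s / 2)]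
          gcongr
      _ = (s + 1) * |l| := by ring
      _ ≤ (s + 1) * (3 / 2 * (33 / j)) := by gcongr
      _ ≤ (s + 1) * 50 / j := by
          rw [mul_div_assoc]
          gcongr
          rw [← mul_div_assoc]
          gcongr
          norm_num
  have he3 : |e| ≤ (s + 1) * 50 := he2.trans (div_le_self (by positivity) (by linarith))
  rw [e1, abs_neg, abs_mul, abs_of_pos hy]
  calc y * |Real.exp e - 1| ≤ y * (|e| * Real.exp |e|) := by
        gcongr; exact abs_exp_sub_one_le_mul e
    _ ≤ y * ((s + 1) * 50 / j * Real.exp ((s + 1) * 50)) := by gcongr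
    _ = _ := by unfold freezeConst; ring

end BOTorus

/-! ### Blocks of input frequencies and subtraction of the resonant part. -/

namespace BOTorus

lemma IsTimeFourier.sub {f F g G : ℝ → ℂ} (hf : IsTimeFourier f F) (hg : IsTimeFourier g G) :
    IsTimeFourier (fun t => f t - g t) fun τ => F τ - G τ := by
  intro φ
  obtain ⟨a1, a2, a3⟩ := hf φ
  obtain ⟨b1, b2, b3⟩ := hg φ
  simp_rw [sub_mul]
  refine ⟨a1.sub b1, a2.sub b2, ?_⟩
  rw [integral_sub a1 b1, integral_sub a2 b2, a3, b3]

/-- The integer `j` such that `j⁴ ≤ k / lam < (j + 1)⁴`, and `0` if `k < 0`. -/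
noncomputable def fourthRoot (lam : ℝ) (k : ℤ) : ℕ :=
  (exists_mem_fourthPowers (le_max_right (k / lam : ℝ) 0)).choose

lemma fourthRoot_spec (lam : ℝ) (k : ℤ) : (fourthRoot lam k : ℝ) ^ 4 ≤ max (k / lam : ℝ) 0 ∧
    max (k / lam : ℝ) 0 < ((fourthRoot lam k : ℝ) + 1) ^ 4 :=
  (exists_mem_fourthPowers (le_max_right (k / lam : ℝ) 0)).choose_spec

lemma fourthRoot_bounds {lam : ℝ} {k : ℤ} (h : 100 ≤ fourthRoot lam k) :
    (fourthRoot lam k : ℝ) ^ 4 ≤ k / lam ∧ k / lam < ((fourthRoot lam k : ℝ) + 1) ^ 4 := by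
  obtain ⟨h1, h2⟩ := fourthRoot_spec lam k
  have h3 : (0 : ℝ) < (fourthRoot lam k : ℝ) ^ 4 := by
    have : (100 : ℝ) ≤ fourthRoot lam k := by exact_mod_cast h
    positivity
  rcases le_total (k / lam : ℝ) 0 with hc | hc
  · rw [max_eq_right hc] at h1
    linarith
  · rw [max_eq_left hc] at h1 h2
    exact ⟨h1, h2⟩

lemma eq_fourthRoot {lam : ℝ} {k : ℤ} {j : ℕ} (h1 : (j : ℝ) ^ 4 ≤ k / lam)
    (h2 : k / lam < ((j : ℝ) + 1) ^ 4) : j = fourthRoot lam k := by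
  obtain ⟨h3, h4⟩ := fourthRoot_spec lam k
  rw [max_eq_left (le_trans (by positivity) h1)] at h3 h4
  have i1 := lt_of_pow_lt_pow_left₀ 4 (by positivity) (h1.trans_lt h4)
  have i2 := lt_of_pow_lt_pow_left₀ 4 (by positivity) (h3.trans_lt h2)
  have i1' : j < fourthRoot lam k + 1 := by exact_mod_cast i1
  have i2' : fourthRoot lam k < j + 1 := by exact_mod_cast i2
  omega

/-- The output frequencies `n / lam` close to half of the input frequency `j⁴`. -/
def HalfFreq (lam : ℝ) (j : ℕ) (n : ℤ) : Prop :=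
  100 ≤ j ∧ |2 * (n / lam : ℝ) - (j : ℝ) ^ 4| ≤ 23 * (j : ℝ) ^ 3

/-- The times frequencies at which the input is far from the characteristic curve. -/
def highSet (lam : ℝ) (k : ℤ) : Set ℝ :=
  {τ | (fourthRoot lam k : ℝ) ^ 8 / 10 ≤ |modulation lam (k, τ)|}

lemma measurableSet_highSet (lam : ℝ) (k : ℤ) : MeasurableSet (highSet lam k) := by
  have h := (measurable_modulation lam).comp (measurable_prodMk_left (x := k))
  exact measurableSet_le measurable_const h.norm

open Classical in
/-- The factor gained by freezing the symbol. -/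
noncomputable def damping (lam : ℝ) (n k : ℤ) (τ : ℝ) : ℝ :=
  if HalfFreq lam (fourthRoot lam k) n ∧ τ ∈ highSet lam k then 1 / fourthRoot lam k else 1

lemma damping_nonneg (lam : ℝ) (n k : ℤ) (τ : ℝ) : 0 ≤ damping lam n k τ := by
  unfold damping; split_ifs <;> positivity

lemma damping_le_one (lam : ℝ) (n k : ℤ) (τ : ℝ) : damping lam n k τ ≤ 1 := by
  unfold damping
  split_ifs with h
  · have : (100 : ℝ) ≤ fourthRoot lam k := by exact_mod_cast h.1.1
    rw [div_le_one (by linarith)]; linarith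
  · exact le_rfl

lemma damping_le {lam : ℝ} {n k : ℤ} {τ : ℝ} (j : ℕ) (h : NearPair j (n / lam) (k / lam))
    (hσ : (j : ℝ) ^ 8 / 10 ≤ |modulation lam (k, τ)|) : damping lam n k τ ≤ 1 / j := by
  obtain ⟨h1, h2, h3, h4⟩ := h
  have e := eq_fourthRoot h2 h3
  unfold damping
  rw [if_pos, e]
  rw [← e]
  refine ⟨⟨h1, h4⟩, ?_⟩
  change (fourthRoot lam k : ℝ) ^ 8 / 10 ≤ _
  rwa [← e]

/-- The symbol of `P₋ ∂ₓ`. -/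
noncomputable def negSymbol (lam : ℝ) (m : ℤ) : ℂ :=
  if m < 0 then Complex.I * ((m / lam : ℝ) : ℂ) else 0

/-- The symbol of `J^{-s} ∂ₓ`, frozen at the frequency `-j⁴ / 2`. -/
noncomputable def frozenSymbol (s : ℝ) (j : ℕ) : ℂ :=
  -(Complex.I * (((j : ℝ) ^ 4 / 2 / besselSymbol s ((j : ℝ) ^ 4 / 2) : ℝ) : ℂ))

lemma besselSymbol_neg (s ξ : ℝ) : besselSymbol s (-ξ) = besselSymbol s ξ := by
  unfold besselSymbol; rw [abs_neg]

lemma norm_negSymbol {lam : ℝ} {m : ℤ} (hm : m < 0) : ‖negSymbol lam m‖ = |m / lam| := by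
  unfold negSymbol
  rw [if_pos hm, norm_mul, Complex.norm_I, one_mul, Complex.norm_real, Real.norm_eq_abs]

/-- Output within (23/2)j³ of j⁴/2 and input within 5j³ of j⁴ place -ξ₂ within (33/2)j³ of j⁴/2, a
relative distance of 33/j. In particular ξ₂ < 0 automatically, so P₋ plays no role there. -/
lemma HalfFreq.sub_neg {lam s : ℝ} (hl : 0 < lam) (hs : 0 ≤ s) {n k : ℤ}
    (h : HalfFreq lam (fourthRoot lam k) n) : n - k < 0 ∧
      ‖negSymbol lam (n - k) - frozenSymbol s (fourthRoot lam k) *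
        (besselSymbol s ((n - k : ℤ) / lam) : ℂ)‖ ≤
        freezeConst s * (|((n - k : ℤ) / lam : ℝ)| * (1 / fourthRoot lam k)) := by
  obtain ⟨h1, h2⟩ := h
  obtain ⟨h3, h4⟩ := fourthRoot_bounds h1
  set j := fourthRoot lam k
  have hj : (100 : ℝ) ≤ j := by exact_mod_cast h1
  obtain ⟨b1, b2, b3⟩ := pow_four_bounds hj
  obtain ⟨h5, h6⟩ := abs_le.1 h2
  have e : ((n - k : ℤ) / lam : ℝ) = n / lam - k / lam := by push_cast; rw [sub_div]
  have hneg : (n / lam - k / lam : ℝ) < 0 := by linarith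
  have hnk : n - k < 0 := by
    rw [← e] at hneg
    have := mul_neg_of_neg_of_pos hneg hl
    rw [div_mul_cancel₀ _ hl.ne'] at this
    exact_mod_cast this
  refine ⟨hnk, ?_⟩
  rw [negSymbol, if_pos hnk, frozenSymbol, e]
  set ξ₂ : ℝ := n / lam - k / lam with hξ₂
  have key := abs_sub_frozen_le (s := s) (y := -ξ₂) (y₀ := (j : ℝ) ^ 4 / 2) hs hj (by positivity) (by
    have : 33 / (j : ℝ) * ((j : ℝ) ^ 4 / 2) = 33 / 2 * (j : ℝ) ^ 3 := by field_simp
    rw [this, abs_le]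
    constructor <;> linarith)
  rw [besselSymbol_neg] at key
  rw [abs_of_neg hneg, ← mul_assoc]
  refine le_of_eq_of_le ?_ key
  rw [← Real.norm_eq_abs, ← Complex.norm_real, ← norm_neg]
  rw [← one_mul ‖((_ : ℝ) : ℂ)‖, ← Complex.norm_I, ← norm_mul]
  congr 1
  push_cast
  ring

section

variable {lam s : ℝ} {h : ℝ → ℂ} {n k : ℤ} {w W u U V vm : ℝ → ℂ}

lemma integrable_timeFt_mul (hh : Integrable h) {f g : ℝ → ℂ} (hf : MemLp f 2) (hg : MemLp g 2) :
    Integrable fun t => timeFt h t * (f t * g t) :=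
  (hf.integrable_mul hg).bdd_mul (c := ∫ t, ‖h t‖) (continuous_timeFt hh).aestronglyMeasurable
    (Filter.Eventually.of_forall (norm_timeFt_le h))

open Classical in
/-- The interaction of two frequencies, after subtraction of the resonant part with frozen
symbol. -/
lemma enorm_pair_sub_le (hl : 0 < lam) (hs : 0 ≤ s) (hh : Integrable h) (hw : MemLp w 2)
    (hW : IsTimeFourier w W) (hu : MemLp u 2) (hU : IsTimeFourier u U) (hV : MemLp V 2)
    (hVW : IsTimeFourier V ((highSet lam k).indicator W))
    (hvm : vm =ᵐ[volume] fun t => (besselSymbol s ((n - k : ℤ) / lam) : ℂ) * u t) :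
    ‖(∫ t, timeFt h t * (w t * (negSymbol lam (n - k) * u t))) -
      (if HalfFreq lam (fourthRoot lam k) n then
        frozenSymbol s (fourthRoot lam k) * ∫ t, timeFt h t * (V t * vm t) else 0)‖ₑ ≤
      ENNReal.ofReal (freezeConst s) * ∫⁻ τ, ∫⁻ τ', ‖h τ‖ₑ * (‖W (τ - τ')‖ₑ * (‖U τ'‖ₑ *
        (if n - k < 0 then
          ENNReal.ofReal (|((n - k : ℤ) / lam : ℝ)| * damping lam n k (τ - τ')) else 0))) := by
  have hc1 : (1 : ℝ≥0∞) ≤ ENNReal.ofReal (freezeConst s) := by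
    rw [← ENNReal.ofReal_one]; exact ENNReal.ofReal_le_ofReal (one_le_freezeConst hs)
  have hcne : ENNReal.ofReal (freezeConst s) ≠ ∞ := ENNReal.ofReal_ne_top
  rw [← lintegral_const_mul' _ _ hcne]
  simp_rw [← lintegral_const_mul' (ENNReal.ofReal (freezeConst s)) _ hcne]
  split_ifs with hn hnk hnk
  · have hsub := (hn.sub_neg hl hs).2
    set c := negSymbol lam (n - k)
    set q : ℂ := (besselSymbol s ((n - k : ℤ) / lam) : ℂ)
    set f := frozenSymbol s (fourthRoot lam k)
    -- Two disjoint remainders: w - V has its transform off the set of high modulation, where the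
    -- damping is 1, and V has it on that set, where the symbol error supplies 1/j.
    have e : (∫ t, timeFt h t * (w t * (c * u t))) - f * ∫ t, timeFt h t * (V t * vm t) =
        (∫ t, timeFt h t * ((w t - V t) * (c * u t))) +
          ∫ t, timeFt h t * (V t * ((c - f * q) * u t)) := by
      have i2 : Integrable fun t => timeFt h t * ((w t - V t) * (c * u t)) :=
        integrable_timeFt_mul hh (hw.sub hV) (hu.const_mul c)
      have e1 : ∫ t, timeFt h t * (V t * vm t) = ∫ t, timeFt h t * (V t * (q * u t)) := by
        refine integral_congr_ae ?_
        filter_upwards [hvm] with t ht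
        rw [ht]
      rw [e1, ← integral_const_mul, ← integral_sub (integrable_timeFt_mul hh hw (hu.const_mul c))
        ((integrable_timeFt_mul hh hV (hu.const_mul q)).const_mul f),
        ← integral_add i2
          (integrable_timeFt_mul hh hV (hu.const_mul (c - f * q)))]
      refine integral_congr_ae (Filter.Eventually.of_forall fun t => ?_)
      ring
    rw [e]
    refine (enorm_add_le _ _).trans ?_
    refine (add_le_add
      (enorm_integral_timeFt_mul_le hh (hw.sub hV) (hu.const_mul c) (hW.sub hVW) (hU.const_mul c))
      (enorm_integral_timeFt_mul_le hh hV (hu.const_mul (c - f * q)) hVW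
        (hU.const_mul (c - f * q)))).trans ?_
    refine (le_lintegral_add _ _).trans (lintegral_mono fun τ => ?_)
    refine (le_lintegral_add _ _).trans (lintegral_mono fun τ' => ?_)
    simp only [damping]
    by_cases hτ : τ - τ' ∈ highSet lam k
    · rw [if_pos ⟨hn, hτ⟩, Set.indicator_of_mem hτ, sub_self, enorm_zero, zero_mul, mul_zero,
        zero_add, enorm_mul]
      have : ‖c - f * q‖ₑ ≤ ENNReal.ofReal (freezeConst s) * ENNReal.ofReal
          (|((n - k : ℤ) / lam : ℝ)| * (1 / fourthRoot lam k)) := by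
        rw [← ENNReal.ofReal_mul (zero_le_one.trans (one_le_freezeConst hs)), ← ofReal_norm]
        exact ENNReal.ofReal_le_ofReal hsub
      calc _ ≤ ‖h τ‖ₑ * (‖W (τ - τ')‖ₑ * ((ENNReal.ofReal (freezeConst s) * ENNReal.ofReal
          (|((n - k : ℤ) / lam : ℝ)| * (1 / fourthRoot lam k))) * ‖U τ'‖ₑ)) := by gcongr
        _ = _ := by ring
    · rw [if_neg (fun h => hτ h.2), Set.indicator_of_notMem hτ, sub_zero, enorm_zero, zero_mul,
        mul_zero, add_zero, enorm_mul, mul_one]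
      have : ‖c‖ₑ = ENNReal.ofReal |((n - k : ℤ) / lam : ℝ)| := by
        rw [← ofReal_norm, norm_negSymbol hnk]
      rw [this]
      refine le_of_eq_of_le ?_ (le_mul_of_one_le_left zero_le hc1)
      ring
  · exact absurd (hn.sub_neg hl hs).1 hnk
  · rw [sub_zero]
    refine (enorm_integral_timeFt_mul_le hh hw (hu.const_mul _) hW (hU.const_mul _)).trans ?_
    refine lintegral_mono fun τ => lintegral_mono fun τ' => ?_
    simp only [damping]
    have : ‖negSymbol lam (n - k)‖ₑ = ENNReal.ofReal |((n - k : ℤ) / lam : ℝ)| := by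
      rw [← ofReal_norm, norm_negSymbol hnk]
    rw [if_neg (fun h => hn h.1), mul_one, enorm_mul, this]
    refine le_of_eq_of_le ?_ (le_mul_of_one_le_left zero_le hc1)
    ring
  · simp [negSymbol, hnk]

end

/-- For fixed n the map k ↦ n - k is a bijection of ℤ, so the finite sums are part of the full
integral over pairs of frequencies. -/
lemma sum_sum_lintegral_le {Φ : (ℤ × ℝ) × (ℤ × ℝ) → ℝ≥0∞} (hΦ : Measurable Φ)
    (A B : Finset ℤ) :
    ∑ n ∈ A, ∑ k ∈ B, ∫⁻ τ, ∫⁻ τ', Φ ((n, τ), (n - k, τ')) ≤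
      ∫⁻ a, ∫⁻ b, Φ (a, b) ∂freqMeasure ∂freqMeasure := by
  rw [lintegral_freqMeasure hΦ.lintegral_prod_right'.aemeasurable]
  refine le_trans (Finset.sum_le_sum fun n _ => ?_) (ENNReal.sum_le_tsum A)
  have e : ∀ τ, ∫⁻ b, Φ ((n, τ), b) ∂freqMeasure = ∑' m : ℤ, ∫⁻ τ', Φ ((n, τ), (m, τ')) :=
    fun τ => lintegral_freqMeasure (by fun_prop)
  simp_rw [e]
  have hm : ∀ m : ℤ, Measurable fun τ => ∫⁻ τ', Φ ((n, τ), (m, τ')) := fun m =>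
    Measurable.lintegral_prod_right' (f := fun p : ℝ × ℝ => Φ ((n, p.1), (m, p.2))) (by fun_prop)
  rw [lintegral_tsum fun m => (hm m).aemeasurable]
  rw [← (Equiv.subLeft n).tsum_eq]
  exact ENNReal.sum_le_tsum B

end BOTorus

/-! ### Summation of the remainders; counting and constants for the blocks. -/

namespace BOTorus

/-- The `L²` norm of a weighted family of functions on the frequency space. -/
noncomputable def weightedNorm (ω : ℤ × ℝ → ℝ≥0∞) (F : ℤ → ℝ → ℂ) : ℝ≥0∞ :=
  normTwo freqMeasure fun a => ω a * ‖F a.1 a.2‖ₑ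

lemma weightedNorm_sq {ω : ℤ × ℝ → ℝ≥0∞} (hω : Measurable ω) {F : ℤ → ℝ → ℂ}
    (hF : ∀ n, Measurable (F n)) :
    weightedNorm ω F ^ 2 = ∑' n : ℤ, ∫⁻ τ, (ω (n, τ) * ‖F n τ‖ₑ) ^ 2 := by
  unfold weightedNorm
  rw [normTwo_sq, lintegral_freqMeasure]
  exact ((hω.mul (measurable_enorm_uncurry hF)).pow_const 2).aemeasurable

/-- The constant in the bound for the non-resonant interactions. -/
noncomputable def trilinearConst : ℝ≥0∞ :=
  ENNReal.ofReal (Real.exp 1000000000) * (3 * (8 * decayConst) ^ (1 / 2 : ℝ))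

lemma sum_remainder_le {lam s : ℝ} (hl : 1 ≤ lam) (hs : 1 / 4 ≤ s) {h W U : ℤ → ℝ → ℂ}
    (mh : ∀ n, Measurable (h n)) (mW : ∀ n, Measurable (W n)) (mU : ∀ n, Measurable (U n))
    (A B : Finset ℤ) (hA : ∀ n ∈ A, 1 < (n / lam : ℝ)) :
    ∑ n ∈ A, ∑ k ∈ B, ∫⁻ τ, ∫⁻ τ', ‖h n τ‖ₑ * (‖W k (τ - τ')‖ₑ * (‖U (n - k) τ'‖ₑ *
        (if n - k < 0 then
          ENNReal.ofReal (|((n - k : ℤ) / lam : ℝ)| * damping lam n k (τ - τ')) else 0))) ≤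
      trilinearConst * ENNReal.ofReal lam ^ (1 / 2 : ℝ) * (weightedNorm (weightDual lam s) h *
        weightedNorm (weightIn lam s) W * weightedNorm (weightNeg lam s) U) := by
  have hl0 : 0 < lam := by linarith
  have m1 : Measurable fun a : ℤ × ℝ => weightDual lam s a * ‖h a.1 a.2‖ₑ :=
    (measurable_weightDual lam s).mul (measurable_enorm_uncurry mh)
  have m2 : Measurable fun a : ℤ × ℝ => weightIn lam s a * ‖W a.1 a.2‖ₑ :=
    (measurable_weightIn lam s).mul (measurable_enorm_uncurry mW)
  have m3 : Measurable fun a : ℤ × ℝ => weightNeg lam s a * ‖U a.1 a.2‖ₑ :=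
    (measurable_weightNeg lam s).mul (measurable_enorm_uncurry mU)
  have mK : Measurable fun p : (ℤ × ℝ) × (ℤ × ℝ) => ENNReal.ofReal (totalKernel lam p) := by
    have hd := measurable_decay
    have hm := measurable_modulation lam
    unfold totalKernel kernelA kernelB kernelC resonanceRoot; fun_prop
  set Φ : (ℤ × ℝ) × (ℤ × ℝ) → ℝ≥0∞ := fun p => ENNReal.ofReal (totalKernel lam p) ^ (1 / 2 : ℝ) *
    ((weightDual lam s p.1 * ‖h p.1.1 p.1.2‖ₑ) *
      (weightIn lam s (p.1 - p.2) * ‖W (p.1 - p.2).1 (p.1 - p.2).2‖ₑ) *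
      (weightNeg lam s p.2 * ‖U p.2.1 p.2.2‖ₑ)) with hΦ
  have mΦ : Measurable Φ := (mK.pow_const _).mul (((m1.comp measurable_fst).mul
    (m2.comp (measurable_fst.sub measurable_snd))).mul (m3.comp measurable_snd))
  calc _ ≤ ∑ n ∈ A, ∑ k ∈ B, ∫⁻ τ, ∫⁻ τ', ENNReal.ofReal (Real.exp 1000000000) *
        Φ ((n, τ), (n - k, τ')) := by
        refine Finset.sum_le_sum fun n hn => Finset.sum_le_sum fun k _ =>
          lintegral_mono fun τ => lintegral_mono fun τ' => ?_
        simp only [hΦ]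
        split_ifs with hnk
        · have key := symbol_le (s := s) (a := (n, τ)) (b := (n - k, τ')) hl0 hs (hA n hn) hnk
            (damping_nonneg lam n k (τ - τ')) (damping_le_one lam n k (τ - τ')) (by
              simp only [Prod.mk_sub_mk, sub_sub_cancel]
              exact fun j => damping_le j)
          simp only [Prod.mk_sub_mk, sub_sub_cancel] at key ⊢
          refine (mul_le_mul_right (mul_le_mul_right (mul_le_mul_right key _) _) _).trans
            (le_of_eq ?_)
          ring
        · simp
    _ ≤ ENNReal.ofReal (Real.exp 1000000000) *
        ∫⁻ a, ∫⁻ b, Φ (a, b) ∂freqMeasure ∂freqMeasure := by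
        simp_rw [lintegral_const_mul' _ _ ENNReal.ofReal_ne_top, ← Finset.mul_sum]
        gcongr
        exact sum_sum_lintegral_le mΦ A B
    _ ≤ _ := by
        refine (mul_le_mul_right (trilinear_le hl m1 m2 m3) _).trans (le_of_eq ?_)
        unfold trilinearConst weightedNorm
        ring

lemma card_le_of_forall_mem_Icc {A : Finset ℤ} {a b : ℝ} (hab : a ≤ b)
    (h : ∀ n ∈ A, a ≤ n ∧ (n : ℝ) ≤ b) : (A.card : ℝ) ≤ b - a + 1 := by
  have h1 : A ⊆ Finset.Icc ⌈a⌉ ⌊b⌋ := fun n hn =>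
    Finset.mem_Icc.2 ⟨Int.ceil_le.2 (h n hn).1, Int.le_floor.2 (h n hn).2⟩
  have h2 := Finset.card_le_card h1
  rw [Int.card_Icc] at h2
  have h3 : ((⌊b⌋ + 1 - ⌈a⌉).toNat : ℝ) ≤ b - a + 1 := by
    rcases le_total 0 (⌊b⌋ + 1 - ⌈a⌉) with hc | hc
    · have : (((⌊b⌋ + 1 - ⌈a⌉).toNat : ℤ) : ℝ) = ((⌊b⌋ + 1 - ⌈a⌉ : ℤ) : ℝ) := by
        rw [Int.toNat_of_nonneg hc]
      rw [Int.cast_natCast] at this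
      rw [this]
      push_cast
      linarith [Int.floor_le b, Int.le_ceil a]
    · rw [Int.toNat_of_nonpos hc, Nat.cast_zero]; linarith
  exact (by exact_mod_cast h2 : (A.card : ℝ) ≤ _).trans h3

/-- The interval for n has length 23λj³; the possible extra endpoint is absorbed by λj³ ≥ 1. This is
the number of frequencies entering Bernstein's inequality. -/
lemma HalfFreq.card_le {lam : ℝ} (hl : 1 ≤ lam) {j : ℕ} (hj : 100 ≤ j) {A : Finset ℤ}
    (hA : ∀ n ∈ A, HalfFreq lam j n) : (A.card : ℝ) ≤ 24 * lam * (j : ℝ) ^ 3 := by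
  have hl0 : 0 < lam := by linarith
  have hj' : (100 : ℝ) ≤ j := by exact_mod_cast hj
  have hj3 := (pow_four_bounds hj').2.1
  have h := card_le_of_forall_mem_Icc (A := A) (a := lam * ((j : ℝ) ^ 4 - 23 * (j : ℝ) ^ 3) / 2)
    (b := lam * ((j : ℝ) ^ 4 + 23 * (j : ℝ) ^ 3) / 2) (by gcongr; linarith) fun n hn => by
      obtain ⟨h1, h2⟩ := abs_le.1 (hA n hn).2
      have e : (n : ℝ) = lam * (n / lam) := by field_simp
      rw [e]
      constructor <;> nlinarith
  nlinarith

lemma HalfFreq.bracket_le {lam : ℝ} {j : ℕ} {n : ℤ} (h : HalfFreq lam j n) :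
    bracket (n / lam) ≤ (j : ℝ) ^ 4 := by
  obtain ⟨h1, h2⟩ := h
  have hj : (100 : ℝ) ≤ j := by exact_mod_cast h1
  obtain ⟨b1, b2, b3⟩ := pow_four_bounds hj
  obtain ⟨h5, h6⟩ := abs_le.1 h2
  unfold bracket
  rw [abs_of_nonneg (by linarith)]
  linarith

/-- The intervals of output frequencies belonging to different `j` overlap boundedly often. -/
lemma HalfFreq.card_filter_le (lam : ℝ) (n : ℤ) (S : Finset ℕ)
    [DecidablePred fun j => HalfFreq lam j n] :
    (S.filter fun j => HalfFreq lam j n).card ≤ 24 := by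
  set F := S.filter fun j => HalfFreq lam j n
  rcases F.eq_empty_or_nonempty with hF | hF
  · simp [hF]
  set j₀ := F.min' hF
  have hsub : F ⊆ Finset.Icc j₀ (j₀ + 23) := by
    intro j hj
    have h0 : j₀ ≤ j := F.min'_le j hj
    refine Finset.mem_Icc.2 ⟨h0, ?_⟩
    have ha := (Finset.mem_filter.1 (F.min'_mem hF)).2.2
    have hb := (Finset.mem_filter.1 hj).2
    have hj100 : (100 : ℝ) ≤ j := by exact_mod_cast hb.1
    obtain ⟨a1, a2⟩ := abs_le.1 ha
    obtain ⟨b1, b2⟩ := abs_le.1 hb.2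
    change -(23 * (j₀ : ℝ) ^ 3) ≤ 2 * (n / lam : ℝ) - (j₀ : ℝ) ^ 4 at a1
    have h0' : (j₀ : ℝ) ≤ j := by exact_mod_cast h0
    have hj₀ : (0 : ℝ) ≤ j₀ := by positivity
    have hp : 0 < (j : ℝ) ^ 3 + (j₀ : ℝ) ^ 3 := by positivity
    -- If 2ξ lies in both intervals then j⁴ - j₀⁴ ≤ 23(j³ + j₀³), whereas j⁴ - j₀⁴ is at least (j -
    -- j₀)(j³ + j₀³). Hence j - j₀ ≤ 23.
    have h1 : ((j : ℝ) - j₀) * ((j : ℝ) ^ 3 + (j₀ : ℝ) ^ 3) ≤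
        23 * ((j : ℝ) ^ 3 + (j₀ : ℝ) ^ 3) := by
      have : (j : ℝ) ^ 4 - (j₀ : ℝ) ^ 4 = ((j : ℝ) - j₀) * ((j : ℝ) ^ 3 + (j₀ : ℝ) ^ 3) +
          ((j : ℝ) - j₀) * ((j : ℝ) ^ 2 * j₀ + j * (j₀ : ℝ) ^ 2) := by ring
      have h2 : 0 ≤ ((j : ℝ) - j₀) * ((j : ℝ) ^ 2 * j₀ + j * (j₀ : ℝ) ^ 2) :=
        mul_nonneg (by linarith) (by positivity)
      linarith
    have h2 := le_of_mul_le_mul_right h1 hp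
    have h3 : (j : ℝ) ≤ (j₀ + 23 : ℕ) := by push_cast; linarith
    exact_mod_cast h3
  refine (Finset.card_le_card hsub).trans ?_
  rw [Nat.card_Icc]
  omega

/-- The constant in the Sobolev embedding of `H^{1/2}` into `L⁴`. -/
noncomputable def sobolevConst : ℝ≥0∞ :=
  ENNReal.ofReal (2 * Real.pi) * (2 * ∫⁻ x, ENNReal.ofReal (decay x))

/-- At y = j⁴/2 the frozen symbol is at most y^(1-s) ≤ y^(3/4); here s ≥ 1/4 is exactly what is
needed for j³. -/
lemma norm_frozenSymbol_le {s : ℝ} (hs : 1 / 4 ≤ s) {j : ℕ} (hj : 100 ≤ j) :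
    ‖frozenSymbol s j‖ₑ ≤ ENNReal.ofReal ((j : ℝ) ^ 3) := by
  have hj' : (100 : ℝ) ≤ j := by exact_mod_cast hj
  rw [← ofReal_norm]
  refine ENNReal.ofReal_le_ofReal ?_
  unfold frozenSymbol
  set y := (j : ℝ) ^ 4 / 2 with hy
  have hj3 := pow_four_bounds hj'
  have hy1 : 1 ≤ y := by rw [hy]; linarith
  have hy0 : 0 < y := by linarith
  rw [norm_neg, norm_mul, Complex.norm_I, one_mul, Complex.norm_real, Real.norm_eq_abs,
    abs_of_pos (div_pos hy0 (besselSymbol_pos _ _)), div_le_iff₀ (besselSymbol_pos _ _)]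
  have h1 : y ^ (1 / 4 : ℝ) ≤ besselSymbol s y := by
    unfold besselSymbol
    calc y ^ (1 / 4 : ℝ) ≤ y ^ s := Real.rpow_le_rpow_of_exponent_le hy1 hs
      _ = (y ^ 2) ^ (s / 2) := by
          rw [← Real.rpow_natCast, ← Real.rpow_mul hy0.le]; congr 1; push_cast; ring
      _ ≤ _ := by
          rw [abs_of_pos hy0]
          exact Real.rpow_le_rpow (by positivity) (by linarith) (by linarith)
  have h2 : y ^ (3 / 4 : ℝ) ≤ (j : ℝ) ^ 3 := by
    calc y ^ (3 / 4 : ℝ) ≤ ((j : ℝ) ^ 4) ^ (3 / 4 : ℝ) :=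
          Real.rpow_le_rpow hy0.le (by rw [hy]; linarith [pow_nonneg (by linarith : (0:ℝ) ≤ j) 4])
            (by norm_num)
      _ = _ := by
          rw [← Real.rpow_natCast, ← Real.rpow_mul (by linarith), ← Real.rpow_natCast]
          norm_num
  calc y = y ^ (3 / 4 : ℝ) * y ^ (1 / 4 : ℝ) := by
        rw [← Real.rpow_add hy0]; norm_num
    _ ≤ _ := by gcongr

/-- The power count of a block: symbol J³, Bernstein (λJ³)^(1/4), modulation J⁻⁴. The frequency
weights Z of output and input cancel. Bounding J^(3/4) by J still suffices. -/
lemma block_const_le {lam J Z : ℝ} (hl : 1 ≤ lam) (hJ : 1 ≤ J) (hZ : 0 < Z) :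
    ENNReal.ofReal (J ^ 3) * (ENNReal.ofReal (24 * lam * J ^ 3) ^ (1 / 4 : ℝ) *
      (ENNReal.ofReal Z ^ (1 / 2 : ℝ) * ENNReal.ofReal (10 / (J ^ 8 * Z)) ^ (1 / 2 : ℝ))) ≤
      240 * ENNReal.ofReal lam ^ (1 / 4 : ℝ) := by
  have hJ0 : 0 < J := by linarith
  have hl0 : 0 < lam := by linarith
  have e1 : ENNReal.ofReal Z ^ (1 / 2 : ℝ) * ENNReal.ofReal (10 / (J ^ 8 * Z)) ^ (1 / 2 : ℝ) ≤
      ENNReal.ofReal (10 / J ^ 4) := by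
    rw [← mul_rpow_half, ← ENNReal.ofReal_mul hZ.le]
    have : Z * (10 / (J ^ 8 * Z)) = 10 / J ^ 8 := by field_simp
    rw [this, ← rpow_half_sq (ENNReal.ofReal (10 / J ^ 4)), ← ENNReal.ofReal_pow (by positivity)]
    gcongr
    rw [div_pow, ← pow_mul]
    gcongr
    norm_num
  have e2 : ENNReal.ofReal (24 * lam * J ^ 3) ^ (1 / 4 : ℝ) ≤
      24 * ENNReal.ofReal lam ^ (1 / 4 : ℝ) * ENNReal.ofReal J := by
    have h24 : ENNReal.ofReal (24 * lam * J ^ 3) ≤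
        (24 : ℝ≥0∞) ^ 4 * ENNReal.ofReal lam * ENNReal.ofReal J ^ 4 := by
      rw [← ENNReal.ofReal_pow hJ0.le,
        show (24 : ℝ≥0∞) ^ 4 = ENNReal.ofReal (24 ^ 4) by
          rw [ENNReal.ofReal_pow (by norm_num)]; norm_num,
        ← ENNReal.ofReal_mul (by positivity), ← ENNReal.ofReal_mul (by positivity)]
      refine ENNReal.ofReal_le_ofReal ?_
      have : J ^ 3 ≤ J ^ 4 := pow_le_pow_right₀ hJ (by norm_num)
      gcongr
      norm_num
    have r4 : ∀ x : ℝ≥0∞, (x ^ 4) ^ (1 / 4 : ℝ) = x := fun x => by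
      rw [← ENNReal.rpow_natCast, ← ENNReal.rpow_mul]; norm_num
    refine (ENNReal.rpow_le_rpow h24 (by norm_num)).trans (le_of_eq ?_)
    rw [ENNReal.mul_rpow_of_nonneg _ _ (by norm_num), ENNReal.mul_rpow_of_nonneg _ _ (by norm_num),
      r4, r4]
  calc _ ≤ ENNReal.ofReal (J ^ 3) * (24 * ENNReal.ofReal lam ^ (1 / 4 : ℝ) * ENNReal.ofReal J *
        ENNReal.ofReal (10 / J ^ 4)) := by gcongr
    _ = 24 * ENNReal.ofReal lam ^ (1 / 4 : ℝ) *
        (ENNReal.ofReal (J ^ 3) * ENNReal.ofReal J * ENNReal.ofReal (10 / J ^ 4)) := by ring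
    _ = _ := by
        rw [← ENNReal.ofReal_mul (by positivity), ← ENNReal.ofReal_mul (by positivity)]
        have : J ^ 3 * J * (10 / J ^ 4) = 10 := by field_simp
        rw [this, ENNReal.ofReal_ofNat, mul_right_comm]
        norm_num

end BOTorus

/-! ### The resonant interactions, and the pairing for finitely many frequencies. -/

namespace BOTorus

/-- The squared weighted norm of a function of the time frequency. -/
noncomputable def fiberNormSq (ω : ℤ × ℝ → ℝ≥0∞) (F : ℤ → ℝ → ℂ) (n : ℤ) : ℝ≥0∞ :=
  ∫⁻ τ, (ω (n, τ) * ‖F n τ‖ₑ) ^ 2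

lemma sum_fiberNormSq_le {ω : ℤ × ℝ → ℝ≥0∞} (hω : Measurable ω) {F : ℤ → ℝ → ℂ}
    (hF : ∀ n, Measurable (F n)) (A : Finset ℤ) :
    ∑ n ∈ A, fiberNormSq ω F n ≤ weightedNorm ω F ^ 2 := by
  rw [weightedNorm_sq hω hF]
  exact ENNReal.sum_le_tsum A

lemma weightDual_sq (lam s : ℝ) (a : ℤ × ℝ) :
    ENNReal.ofReal (bracket (modulation lam a)) =
      ENNReal.ofReal (bracket (a.1 / lam) ^ (2 * s + 1)) * weightDual lam s a ^ 2 := by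
  have h1 := bracket_pos (modulation lam a)
  have h2 := bracket_pos (a.1 / lam : ℝ)
  unfold weightDual
  rw [← ENNReal.ofReal_pow (by positivity), ← ENNReal.ofReal_mul (by positivity), mul_pow,
    ← Real.rpow_natCast, ← Real.rpow_mul h1.le, ← Real.rpow_natCast (bracket (a.1 / lam) ^ _),
    ← Real.rpow_mul h2.le, mul_left_comm, ← Real.rpow_add h2]
  congr 1
  rw [show (2 * s + 1 + -(s + 1 / 2) * (2 : ℕ) : ℝ) = 0 by push_cast; ring, Real.rpow_zero]
  norm_num

lemma weightIn_sq (lam s : ℝ) (a : ℤ × ℝ) : weightIn lam s a ^ 2 =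
    ENNReal.ofReal (bracket (modulation lam a) * bracket (a.1 / lam) ^ (2 * s + 1)) := by
  have h1 := bracket_pos (modulation lam a)
  have h2 := bracket_pos (a.1 / lam : ℝ)
  unfold weightIn
  rw [← ENNReal.ofReal_pow (by positivity), mul_pow,
    ← Real.rpow_natCast, ← Real.rpow_mul h1.le, ← Real.rpow_natCast (bracket (a.1 / lam) ^ _),
    ← Real.rpow_mul h2.le]
  congr 3
  · norm_num
  · push_cast; ring

/-- On the high set ⟨σ₁⟩ ≥ j⁸/10 and ⟨ξ₁⟩ ≥ j⁴; this is how the L² norm of the cut-off input gains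
j⁻⁴ over its weighted norm. -/
lemma one_le_weightIn_sq {lam s : ℝ} (hs : 1 / 4 ≤ s) {k : ℤ} (hj : 100 ≤ fourthRoot lam k) {τ : ℝ}
    (hτ : τ ∈ highSet lam k) :
    1 ≤ ENNReal.ofReal (10 / ((fourthRoot lam k : ℝ) ^ 8 *
      ((fourthRoot lam k : ℝ) ^ 4) ^ (2 * s + 1))) * weightIn lam s (k, τ) ^ 2 := by
  obtain ⟨h1, -⟩ := fourthRoot_bounds hj
  change (fourthRoot lam k : ℝ) ^ 8 / 10 ≤ |modulation lam (k, τ)| at hτ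
  set j := fourthRoot lam k
  have hj' : (100 : ℝ) ≤ j := by exact_mod_cast hj
  have hZ : 0 < ((j : ℝ) ^ 4) ^ (2 * s + 1) := by positivity
  rw [weightIn_sq, ← ENNReal.ofReal_mul (by positivity), ← ENNReal.ofReal_one]
  refine ENNReal.ofReal_le_ofReal ?_
  have h2 : ((j : ℝ) ^ 4) ^ (2 * s + 1) ≤ bracket (k / lam) ^ (2 * s + 1) := by
    refine Real.rpow_le_rpow (by positivity) ?_ (by linarith)
    unfold bracket
    linarith [le_abs_self (k / lam : ℝ)]
  have h3 : (j : ℝ) ^ 8 / 10 ≤ bracket (modulation lam (k, τ)) := by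
    unfold bracket; linarith
  rw [div_mul_eq_mul_div, le_div_iff₀ (by positivity), one_mul]
  calc (j : ℝ) ^ 8 * ((j : ℝ) ^ 4) ^ (2 * s + 1)
      = 10 * ((j : ℝ) ^ 8 / 10 * ((j : ℝ) ^ 4) ^ (2 * s + 1)) := by ring
    _ ≤ _ := by
        have := bracket_pos (modulation lam (k, τ))
        gcongr

section

variable {lam : ℝ} [hl : Fact (1 ≤ lam)] {s : ℝ} {h W V : ℤ → ℝ → ℂ} {v : ℝ × Torus lam → ℂ}

/-- The resonant interactions belonging to one block of input frequencies. -/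
lemma enorm_block_le (hs : 1 / 4 ≤ s) (mh : ∀ n, Measurable (h n)) (hi : ∀ n, Integrable (h n))
    (hfin : ∀ n, ∫⁻ τ, ENNReal.ofReal (bracket (modulation lam (n, τ))) * ‖h n τ‖ₑ ^ 2 ≠ ∞)
    (hV : ∀ k, MemLp (V k) 2)
    (hVW : ∀ k, IsTimeFourier (V k) ((highSet lam k).indicator (W k)))
    (hv : AEStronglyMeasurable v volume) (hv4 : ∫⁻ x, ‖v x‖ₑ ^ 4 < ∞) {j : ℕ} (hj : 100 ≤ j)
    {A B : Finset ℤ} (hA : ∀ n ∈ A, HalfFreq lam j n) (hB : ∀ k ∈ B, fourthRoot lam k = j) :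
    ‖frozenSymbol s j *
        ∑ n ∈ A, ∑ k ∈ B, ∫ t, timeFt (h n) t * (V k t * coeffs v (n - k) t)‖ₑ ≤
      240 * ENNReal.ofReal lam ^ (1 / 4 : ℝ) * sobolevConst ^ (1 / 4 : ℝ) *
        ((∑ n ∈ A, fiberNormSq (weightDual lam s) h n) ^ (1 / 2 : ℝ) *
          (∑ k ∈ B, fiberNormSq (weightIn lam s) W k) ^ (1 / 2 : ℝ)) *
        (∫⁻ x, ‖v x‖ₑ ^ 4 ∂(volume : Measure ℝ).prod AddCircle.haarAddCircle) ^ (1 / 4 : ℝ) := by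
  have hj' : (100 : ℝ) ≤ j := by exact_mod_cast hj
  set Z : ℝ := ((j : ℝ) ^ 4) ^ (2 * s + 1) with hZdef
  have hZ : 0 < Z := by positivity
  have hH4 : ∀ n, ∫⁻ t, ‖timeFt (h n) t‖ₑ ^ 4 ≤ sobolevConst *
      (∫⁻ τ, ENNReal.ofReal (bracket (modulation lam (n, τ))) * ‖h n τ‖ₑ ^ 2) ^ 2 := fun n =>
    lintegral_timeFt_pow_four_le (mh n) (hi n) (|n / lam| * (n / lam)) (hfin n)
  have hSfin : sobolevConst ≠ ∞ := ENNReal.mul_ne_top ENNReal.ofReal_ne_top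
    (ENNReal.mul_ne_top (by norm_num) lintegral_decay_lt_top.ne)
  have key := enorm_sum_integral_le hv hv4 A B (H := fun n => timeFt (h n)) (V := V)
    (fun n => continuous_timeFt (hi n))
    (fun n => (hH4 n).trans_lt (ENNReal.mul_lt_top hSfin.lt_top
      (ENNReal.pow_lt_top (hfin n).lt_top))) hV
  have b1 : (A.card : ℝ≥0∞) ≤ ENNReal.ofReal (24 * lam * (j : ℝ) ^ 3) := by
    rw [← ENNReal.ofReal_natCast]
    exact ENNReal.ofReal_le_ofReal (HalfFreq.card_le hl.out hj hA)
  have b2 : ∑ n ∈ A, (∫⁻ t, ‖timeFt (h n) t‖ₑ ^ 4) ^ (1 / 2 : ℝ) ≤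
      sobolevConst ^ (1 / 2 : ℝ) * (ENNReal.ofReal Z *
        ∑ n ∈ A, fiberNormSq (weightDual lam s) h n) := by
    rw [Finset.mul_sum, Finset.mul_sum]
    refine Finset.sum_le_sum fun n hn => ?_
    refine (ENNReal.rpow_le_rpow (hH4 n) (by norm_num)).trans ?_
    rw [mul_rpow_half, rpow_half_sq]
    gcongr
    unfold fiberNormSq
    rw [← lintegral_const_mul' _ _ ENNReal.ofReal_ne_top]
    refine lintegral_mono fun τ => ?_
    rw [weightDual_sq lam s, mul_pow, mul_assoc]
    gcongr
    exact Real.rpow_le_rpow (bracket_pos _).le (hA n hn).bracket_le (by linarith)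
  have b3 : ∑ k ∈ B, ∫⁻ t, ‖V k t‖ₑ ^ 2 ≤ ENNReal.ofReal (10 / ((j : ℝ) ^ 8 * Z)) *
      ∑ k ∈ B, fiberNormSq (weightIn lam s) W k := by
    rw [Finset.mul_sum]
    refine Finset.sum_le_sum fun k hk => ?_
    have hkj := hB k hk
    calc ∫⁻ t, ‖V k t‖ₑ ^ 2 ≤ ENNReal.ofReal (2 * Real.pi) * ∫⁻ t, ‖V k t‖ₑ ^ 2 := by
          refine le_mul_of_one_le_left zero_le ?_
          rw [← ENNReal.ofReal_one]
          exact ENNReal.ofReal_le_ofReal (by linarith [Real.pi_gt_three])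
      _ = ∫⁻ τ, ‖(highSet lam k).indicator (W k) τ‖ₑ ^ 2 := ((hVW k).lintegral_eq (hV k)).2.symm
      _ ≤ _ := by
          unfold fiberNormSq
          rw [← lintegral_const_mul' _ _ ENNReal.ofReal_ne_top]
          refine lintegral_mono fun τ => ?_
          by_cases hτ : τ ∈ highSet lam k
          · rw [Set.indicator_of_mem hτ, mul_pow, ← mul_assoc]
            refine le_mul_of_one_le_left zero_le ?_
            have := one_le_weightIn_sq (s := s) hs (by omega) hτ
            rwa [hkj] at this
          · simp [Set.indicator_of_notMem hτ]
  rw [enorm_mul]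
  refine (mul_le_mul' (norm_frozenSymbol_le hs hj) (key.trans (mul_le_mul_left
    (mul_le_mul' (mul_le_mul' (ENNReal.rpow_le_rpow b1 (by norm_num))
      (ENNReal.rpow_le_rpow b2 (by norm_num))) (ENNReal.rpow_le_rpow b3 (by norm_num))) _))).trans ?_
  have hq : (sobolevConst ^ (1 / 2 : ℝ)) ^ (1 / 2 : ℝ) = sobolevConst ^ (1 / 4 : ℝ) := by
    rw [← ENNReal.rpow_mul]; norm_num
  simp only [mul_rpow_half, hq]
  have hc := block_const_le (J := j) hl.out (by linarith) hZ
  refine le_of_eq_of_le ?_ (le_trans (mul_le_mul_left hc (sobolevConst ^ (1 / 4 : ℝ) *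
    ((∑ n ∈ A, fiberNormSq (weightDual lam s) h n) ^ (1 / 2 : ℝ) *
          (∑ k ∈ B, fiberNormSq (weightIn lam s) W k) ^ (1 / 2 : ℝ)) *
        (∫⁻ x, ‖v x‖ₑ ^ 4 ∂(volume : Measure ℝ).prod AddCircle.haarAddCircle) ^ (1 / 4 : ℝ)))
      (le_of_eq ?_)) <;> ring

open Classical in
/-- The resonant interactions. -/
lemma enorm_sum_resonant_le (hs : 1 / 4 ≤ s) (mh : ∀ n, Measurable (h n))
    (hi : ∀ n, Integrable (h n)) (mW : ∀ n, Measurable (W n))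
    (hfin : ∀ n, ∫⁻ τ, ENNReal.ofReal (bracket (modulation lam (n, τ))) * ‖h n τ‖ₑ ^ 2 ≠ ∞)
    (hV : ∀ k, MemLp (V k) 2)
    (hVW : ∀ k, IsTimeFourier (V k) ((highSet lam k).indicator (W k)))
    (hv : AEStronglyMeasurable v volume) (hv4 : ∫⁻ x, ‖v x‖ₑ ^ 4 < ∞) (A B : Finset ℤ) :
    ‖∑ n ∈ A, ∑ k ∈ B, (if HalfFreq lam (fourthRoot lam k) n then
        frozenSymbol s (fourthRoot lam k) *
          ∫ t, timeFt (h n) t * (V k t * coeffs v (n - k) t) else 0)‖ₑ ≤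
      240 * 24 * ENNReal.ofReal lam ^ (1 / 4 : ℝ) * sobolevConst ^ (1 / 4 : ℝ) *
        (weightedNorm (weightDual lam s) h * weightedNorm (weightIn lam s) W) *
        (∫⁻ x, ‖v x‖ₑ ^ 4 ∂(volume : Measure ℝ).prod AddCircle.haarAddCircle) ^ (1 / 4 : ℝ) := by
  set T : ℤ → ℤ → ℂ := fun n k => ∫ t, timeFt (h n) t * (V k t * coeffs v (n - k) t)
  set S := B.image (fourthRoot lam) with hS
  set X : ℕ → ℝ≥0∞ := fun j =>
    ∑ n ∈ A.filter (HalfFreq lam j), fiberNormSq (weightDual lam s) h n with hX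
  set Y : ℕ → ℝ≥0∞ := fun j =>
    ∑ k ∈ B.filter (fun k => fourthRoot lam k = j), fiberNormSq (weightIn lam s) W k with hY
  have hmaps : ∀ k ∈ B, fourthRoot lam k ∈ S := fun k hk => Finset.mem_image_of_mem _ hk
  have e : ∑ n ∈ A, ∑ k ∈ B, (if HalfFreq lam (fourthRoot lam k) n then
        frozenSymbol s (fourthRoot lam k) * T n k else 0) =
      ∑ j ∈ S, frozenSymbol s j * ∑ n ∈ A.filter (HalfFreq lam j),
        ∑ k ∈ B.filter (fun k => fourthRoot lam k = j), T n k := by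
    rw [Finset.sum_comm, ← Finset.sum_fiberwise_of_maps_to hmaps]
    refine Finset.sum_congr rfl fun j _ => ?_
    rw [Finset.sum_comm (s := A.filter _), Finset.mul_sum]
    refine Finset.sum_congr rfl fun k hk => ?_
    rw [(Finset.mem_filter.1 hk).2, ← Finset.sum_filter, Finset.mul_sum]
  set c := 240 * ENNReal.ofReal lam ^ (1 / 4 : ℝ) * sobolevConst ^ (1 / 4 : ℝ) with hc
  set I := (∫⁻ x, ‖v x‖ₑ ^ 4 ∂(volume : Measure ℝ).prod AddCircle.haarAddCircle) ^ (1 / 4 : ℝ)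
  have hblock : ∀ j ∈ S, ‖frozenSymbol s j * ∑ n ∈ A.filter (HalfFreq lam j),
      ∑ k ∈ B.filter (fun k => fourthRoot lam k = j), T n k‖ₑ ≤
        c * (X j ^ (1 / 2 : ℝ) * Y j ^ (1 / 2 : ℝ)) * I := fun j _ => by
    rcases lt_or_ge j 100 with hj | hj
    · have : A.filter (HalfFreq lam j) = ∅ :=
        Finset.filter_eq_empty_iff.2 fun n _ hn => absurd hn.1 (by omega)
      simp [this]
    · exact enorm_block_le hs mh hi hfin hV hVW hv hv4 hj
        (fun n hn => (Finset.mem_filter.1 hn).2) fun k hk => (Finset.mem_filter.1 hk).2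
  -- The input blocks are disjoint, but an output frequency may belong to up to 24 of the intervals.
  have hXsum : ∑ j ∈ S, X j ≤ 24 * weightedNorm (weightDual lam s) h ^ 2 := by
    refine le_trans ?_ (mul_le_mul_right (sum_fiberNormSq_le (measurable_weightDual lam s) mh A) _)
    simp only [hX, Finset.sum_filter]
    rw [Finset.sum_comm, Finset.mul_sum]
    refine Finset.sum_le_sum fun n _ => ?_
    rw [← Finset.sum_filter, Finset.sum_const, nsmul_eq_mul]
    gcongr
    exact_mod_cast HalfFreq.card_filter_le lam n S
  have hYsum : ∑ j ∈ S, Y j ≤ weightedNorm (weightIn lam s) W ^ 2 := by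
    rw [Finset.sum_fiberwise_of_maps_to hmaps]
    exact sum_fiberNormSq_le (measurable_weightIn lam s) mW B
  have hCS : ∑ j ∈ S, X j ^ (1 / 2 : ℝ) * Y j ^ (1 / 2 : ℝ) ≤
      24 * (weightedNorm (weightDual lam s) h * weightedNorm (weightIn lam s) W) := by
    have := ENNReal.inner_le_Lp_mul_Lq S (fun j => X j ^ (1 / 2 : ℝ)) (fun j => Y j ^ (1 / 2 : ℝ))
      Real.HolderConjugate.two_two
    simp only [ENNReal.rpow_ofNat, sq_rpow_half] at this
    refine this.trans ((mul_le_mul' (ENNReal.rpow_le_rpow hXsum (by norm_num))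
      (ENNReal.rpow_le_rpow hYsum (by norm_num))).trans ?_)
    rw [mul_rpow_half, rpow_half_sq, rpow_half_sq, mul_assoc]
    gcongr
    calc (24 : ℝ≥0∞) ^ (1 / 2 : ℝ) ≤ 24 ^ (1 : ℝ) :=
          ENNReal.rpow_le_rpow_of_exponent_le (by norm_num) (by norm_num)
      _ = 24 := ENNReal.rpow_one _
  rw [e]
  refine (enorm_sum_le _ _).trans ((Finset.sum_le_sum hblock).trans ?_)
  rw [← Finset.sum_mul, ← Finset.mul_sum]
  refine (mul_le_mul_left (mul_le_mul_right hCS c) I).trans (le_of_eq ?_)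
  rw [hc]
  ring

open Classical in
/-- The trilinear estimate, for finitely many frequencies. -/
lemma enorm_pairing_le (hs : 1 / 4 ≤ s) {w u U : ℤ → ℝ → ℂ} (mh : ∀ n, Measurable (h n))
    (hi : ∀ n, Integrable (h n))
    (hfin : ∀ n, ∫⁻ τ, ENNReal.ofReal (bracket (modulation lam (n, τ))) * ‖h n τ‖ₑ ^ 2 ≠ ∞)
    (hw : ∀ k, MemLp (w k) 2) (hW : ∀ k, IsTimeFourier (w k) (W k)) (mW : ∀ k, Measurable (W k))
    (hu : ∀ m, MemLp (u m) 2) (hU : ∀ m, IsTimeFourier (u m) (U m)) (mU : ∀ m, Measurable (U m))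
    (hv : AEStronglyMeasurable v volume) (hv4 : ∫⁻ x, ‖v x‖ₑ ^ 4 < ∞)
    (hvu : ∀ m : ℤ, coeffs v m =ᵐ[volume] fun t => (besselSymbol s (m / lam) : ℂ) * u m t)
    (A B : Finset ℤ) (hA : ∀ n ∈ A, 1 < (n / lam : ℝ)) :
    ‖∑ n ∈ A, ∑ k ∈ B, ∫ t, timeFt (h n) t * (w k t * (negSymbol lam (n - k) * u (n - k) t))‖ₑ ≤
      weightedNorm (weightDual lam s) h * weightedNorm (weightIn lam s) W *
        (240 * 24 * ENNReal.ofReal lam ^ (1 / 4 : ℝ) * sobolevConst ^ (1 / 4 : ℝ) *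
          (∫⁻ x, ‖v x‖ₑ ^ 4 ∂(volume : Measure ℝ).prod AddCircle.haarAddCircle) ^ (1 / 4 : ℝ) +
        ENNReal.ofReal (freezeConst s) * trilinearConst * ENNReal.ofReal lam ^ (1 / 2 : ℝ) *
          weightedNorm (weightNeg lam s) U) := by
  -- The part of the input with large modulation has to exist as a function of time, since Hölder is
  -- applied in physical space.
  have hVex : ∀ k, ∃ V, MemLp V 2 ∧ IsTimeFourier V ((highSet lam k).indicator (W k)) := fun k =>
    exists_isTimeFourier_eq (((hW k).lintegral_eq (hw k)).1.indicator (measurableSet_highSet lam k))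
  choose V hV hVW using hVex
  have hres := enorm_sum_resonant_le hs mh hi mW hfin hV hVW hv hv4 A B
  have hrem := sum_remainder_le hl.out hs mh mW mU A B hA
  set T : ℤ → ℤ → ℂ := fun n k =>
    ∫ t, timeFt (h n) t * (w k t * (negSymbol lam (n - k) * u (n - k) t))
  set R : ℤ → ℤ → ℂ := fun n k => if HalfFreq lam (fourthRoot lam k) n then
        frozenSymbol s (fourthRoot lam k) *
          ∫ t, timeFt (h n) t * (V k t * coeffs v (n - k) t) else 0
  have e : ∑ n ∈ A, ∑ k ∈ B, T n k =
      ∑ n ∈ A, ∑ k ∈ B, R n k + ∑ n ∈ A, ∑ k ∈ B, (T n k - R n k) := by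
    simp_rw [← Finset.sum_add_distrib, add_sub_cancel]
  have hdiff : ‖∑ n ∈ A, ∑ k ∈ B, (T n k - R n k)‖ₑ ≤ ENNReal.ofReal (freezeConst s) *
      (trilinearConst * ENNReal.ofReal lam ^ (1 / 2 : ℝ) * (weightedNorm (weightDual lam s) h *
        weightedNorm (weightIn lam s) W * weightedNorm (weightNeg lam s) U)) := by
    refine le_trans ?_ (mul_le_mul_right hrem _)
    refine (enorm_sum_le _ _).trans ?_
    rw [Finset.mul_sum]
    refine Finset.sum_le_sum fun n _ => (enorm_sum_le _ _).trans ?_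
    rw [Finset.mul_sum]
    exact Finset.sum_le_sum fun k _ => enorm_pair_sub_le lam_pos (by linarith) (hi n) (hw k) (hW k)
      (hu _) (hU _) (hV k) (hVW k) (hvu _)
  rw [e]
  refine (enorm_add_le _ _).trans ((add_le_add hres hdiff).trans (le_of_eq ?_))
  ring

end

end BOTorus

/-! ### Absolute convergence of the product. -/

namespace BOTorus

section Series

lemma summable_of_tsum_enorm_ne_top {ι : Type*} {a : ι → ℂ} (h : ∑' i, ‖a i‖ₑ ≠ ∞) :
    Summable a := by
  have h1 : Summable fun i => ‖a i‖₊ := ENNReal.tsum_coe_ne_top_iff_summable.1 h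
  exact Summable.of_norm (NNReal.summable_coe.2 h1)

variable {α : Type*} [MeasurableSpace α] {μ : Measure α} {f : ℤ → α → ℂ}

lemma ae_tsum_enorm_ne_top (hf : ∀ m, AEStronglyMeasurable (f m) μ)
    (hfin : ∑' m, ∫⁻ t, ‖f m t‖ₑ ∂μ ≠ ∞) : ∀ᵐ t ∂μ, ∑' m, ‖f m t‖ₑ ≠ ∞ := by
  rw [← lintegral_tsum fun m => (hf m).enorm] at hfin
  have hm : AEMeasurable (fun t => ∑' m, ‖f m t‖ₑ) μ :=
    AEMeasurable.tsum fun m => (hf m).enorm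
  filter_upwards [ae_lt_top' hm hfin] with t ht using ht.ne

lemma integrable_tsum_of_lintegral (hf : ∀ m, AEStronglyMeasurable (f m) μ)
    (hfin : ∑' m, ∫⁻ t, ‖f m t‖ₑ ∂μ ≠ ∞) :
    (∀ᵐ t ∂μ, Summable fun m => f m t) ∧ Integrable (fun t => ∑' m, f m t) μ := by
  have h1 := ae_tsum_enorm_ne_top hf hfin
  have h2 : ∀ᵐ t ∂μ, Summable fun m => f m t := by
    filter_upwards [h1] with t ht using summable_of_tsum_enorm_ne_top ht
  refine ⟨h2, ?_, ?_⟩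
  · refine aestronglyMeasurable_of_tendsto_ae (u := (Filter.atTop : Filter (Finset ℤ)))
      (f := fun s t => ∑ m ∈ s, f m t)
      (fun s => Finset.aestronglyMeasurable_fun_sum s fun m _ => hf m) ?_
    filter_upwards [h2] with t ht using ht.hasSum
  · refine lt_of_le_of_lt (lintegral_mono fun t => enorm_tsum_le_tsum_enorm) ?_
    rw [lintegral_tsum fun m => (hf m).enorm]
    exact hfin.lt_top

lemma hasSum_integral_of_lintegral (hf : ∀ m, AEStronglyMeasurable (f m) μ)
    (hfin : ∑' m, ∫⁻ t, ‖f m t‖ₑ ∂μ ≠ ∞) :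
    HasSum (fun m => ∫ t, f m t ∂μ) (∫ t, ∑' m, f m t ∂μ) := by
  rw [integral_tsum hf hfin]
  refine (summable_of_tsum_enorm_ne_top (ne_top_of_le_ne_top hfin ?_)).hasSum
  exact ENNReal.tsum_le_tsum fun m => enorm_integral_le_lintegral_enorm _

end Series

section Product

variable {lam s : ℝ} {w u : ℤ → ℝ → ℂ}

lemma bracket_le_mul (x y : ℝ) : bracket x ≤ bracket (y - x) * bracket y := by
  have h := log_bracket_le_add x y
  have p := bracket_pos
  rw [← Real.log_mul (p _).ne' (p _).ne'] at h
  have h2 := (Real.log_le_log_iff (p _) (mul_pos (p _) (p _))).1 h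
  have e : bracket (x - y) = bracket (y - x) := by unfold bracket; rw [abs_sub_comm]
  rwa [e] at h2

/-- As 1 - s ≤ s + 1/2, one has ⟨ξ₂⟩ ≤ ⟨ξ₂⟩^(s+1/2)⟨ξ₂⟩^s, and ⟨ξ₂⟩ ≤ ⟨ξ₁⟩⟨ξ⟩ moves the first factor
to W and to the fixed output. Then 2xy ≤ x² + y². -/
lemma enorm_mul_negSymbol_mul_le (hs : 1 / 4 ≤ s) (n m : ℤ) (a b : ℂ) :
    ‖a * (negSymbol lam m * b)‖ₑ ≤ ENNReal.ofReal (bracket (n / lam) ^ (s + 1 / 2)) *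
      (ENNReal.ofReal (bracket ((n - m : ℤ) / lam) ^ (2 * s + 1)) * ‖a‖ₑ ^ 2 +
        ENNReal.ofReal (bracket (m / lam) ^ (2 * s)) * ‖b‖ₑ ^ 2) := by
  set x : ℝ := m / lam with hx
  set y : ℝ := n / lam with hy
  have hz : ((n - m : ℤ) / lam : ℝ) = y - x := by push_cast; rw [sub_div]
  rw [hz]
  have p := bracket_pos
  have h1 : ‖negSymbol lam m‖ ≤ bracket x := by
    rcases lt_or_ge m 0 with hm | hm
    · rw [norm_negSymbol hm]; unfold bracket; linarith
    · simp [negSymbol, not_lt.2 hm, (p x).le]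
  have h2 : bracket x ≤ bracket y ^ (s + 1 / 2) * (bracket (y - x) ^ (s + 1 / 2) * bracket x ^ s) := by
    calc bracket x = bracket x ^ (1 - s) * bracket x ^ s := by
          rw [← Real.rpow_add (p x)]; simp
      _ ≤ bracket x ^ (s + 1 / 2) * bracket x ^ s := by
          refine mul_le_mul_of_nonneg_right ?_ (Real.rpow_nonneg (p x).le _)
          exact Real.rpow_le_rpow_of_exponent_le (one_le_bracket x) (by linarith)
      _ ≤ (bracket (y - x) * bracket y) ^ (s + 1 / 2) * bracket x ^ s := by
          refine mul_le_mul_of_nonneg_right ?_ (Real.rpow_nonneg (p x).le _)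
          exact Real.rpow_le_rpow (p x).le (bracket_le_mul x y) (by linarith)
      _ = _ := by rw [Real.mul_rpow (p _).le (p _).le]; ring
  have key : ‖a * (negSymbol lam m * b)‖ ≤ bracket y ^ (s + 1 / 2) *
      (bracket (y - x) ^ (2 * s + 1) * ‖a‖ ^ 2 + bracket x ^ (2 * s) * ‖b‖ ^ 2) := by
    have e1 : bracket (y - x) ^ (2 * s + 1) = (bracket (y - x) ^ (s + 1 / 2)) ^ 2 := by
      rw [← Real.rpow_natCast, ← Real.rpow_mul (p _).le]; congr 1; push_cast; ring
    have e2 : bracket x ^ (2 * s) = (bracket x ^ s) ^ 2 := by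
      rw [← Real.rpow_natCast, ← Real.rpow_mul (p _).le]; congr 1; push_cast; ring
    rw [norm_mul, norm_mul, e1, e2]
    set A := bracket (y - x) ^ (s + 1 / 2)
    set B := bracket x ^ s
    have hc : 0 < bracket y ^ (s + 1 / 2) := by have := p y; positivity
    calc ‖a‖ * (‖negSymbol lam m‖ * ‖b‖) ≤
          ‖a‖ * ((bracket y ^ (s + 1 / 2) * (A * B)) * ‖b‖) := by
          gcongr; exact h1.trans h2
      _ = bracket y ^ (s + 1 / 2) * ((A * ‖a‖) * (B * ‖b‖)) := by ring
      _ ≤ _ := by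
          gcongr
          nlinarith [sq_nonneg (A * ‖a‖ - B * ‖b‖), sq_nonneg (A * ‖a‖), sq_nonneg (B * ‖b‖)]
  have q1 := p y
  have q2 := p x
  have q3 := p (y - x)
  rw [← ofReal_norm, ← ofReal_norm a, ← ofReal_norm b, ← ENNReal.ofReal_pow (norm_nonneg _),
    ← ENNReal.ofReal_pow (norm_nonneg _), ← ENNReal.ofReal_mul (by positivity),
    ← ENNReal.ofReal_mul (by positivity), ← ENNReal.ofReal_add (by positivity) (by positivity),
    ← ENNReal.ofReal_mul (by positivity)]
  exact ENNReal.ofReal_le_ofReal key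

/-- The series for the coefficients of the product converges absolutely in `L¹`. -/
lemma tsum_lintegral_product_ne_top (hs : 1 / 4 ≤ s) (hw : ∀ k, MemLp (w k) 2)
    (hw1 : ∑' k : ℤ, ENNReal.ofReal (bracket (k / lam) ^ (2 * s + 1)) * ∫⁻ t, ‖w k t‖ₑ ^ 2 ≠ ∞)
    (hu1 : ∑' m : ℤ, ENNReal.ofReal (bracket (m / lam) ^ (2 * s)) * ∫⁻ t, ‖u m t‖ₑ ^ 2 ≠ ∞)
    (n : ℤ) : ∑' m : ℤ, ∫⁻ t, ‖w (n - m) t * (negSymbol lam m * u m t)‖ₑ ≠ ∞ := by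
  set c := ENNReal.ofReal (bracket (n / lam) ^ (s + 1 / 2))
  have h1 : ∀ m : ℤ, ∫⁻ t, ‖w (n - m) t * (negSymbol lam m * u m t)‖ₑ ≤
      c * (ENNReal.ofReal (bracket ((n - m : ℤ) / lam) ^ (2 * s + 1)) *
          (∫⁻ t, ‖w (n - m) t‖ₑ ^ 2) +
        ENNReal.ofReal (bracket (m / lam) ^ (2 * s)) * ∫⁻ t, ‖u m t‖ₑ ^ 2) := fun m => by
    refine (lintegral_mono fun t => enorm_mul_negSymbol_mul_le hs n m _ _).trans (le_of_eq ?_)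
    rw [lintegral_const_mul' _ _ ENNReal.ofReal_ne_top,
      lintegral_add_left' (((hw _).1.enorm.pow_const 2).const_mul _),
      lintegral_const_mul' _ _ ENNReal.ofReal_ne_top,
      lintegral_const_mul' _ _ ENNReal.ofReal_ne_top]
  refine ne_top_of_le_ne_top ?_ (ENNReal.tsum_le_tsum h1)
  rw [ENNReal.tsum_mul_left, ENNReal.tsum_add]
  refine ENNReal.mul_ne_top ENNReal.ofReal_ne_top (ENNReal.add_ne_top.2 ⟨?_, hu1⟩)
  exact ne_of_eq_of_ne ((Equiv.subLeft n).tsum_eq fun k : ℤ =>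
    ENNReal.ofReal (bracket (k / lam) ^ (2 * s + 1)) * ∫⁻ t, ‖w k t‖ₑ ^ 2) hw1

/-- The pairing of the product with a test function is the limit of finite sums. -/
lemma hasSum_pairing (hw : ∀ k, MemLp (w k) 2) (hu : ∀ m, MemLp (u m) 2) {n : ℤ}
    (hfin : ∑' m : ℤ, ∫⁻ t, ‖w (n - m) t * (negSymbol lam m * u m t)‖ₑ ≠ ∞)
    {h : ℝ → ℂ} (hh : Integrable h) :
    HasSum (fun k => ∫ t, timeFt h t * (w k t * (negSymbol lam (n - k) * u (n - k) t)))
      (∫ τ, h τ * timeFt (fun t => ∑' m, w (n - m) t * (negSymbol lam m * u m t)) τ) := by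
  have hm : ∀ m, AEStronglyMeasurable (fun t => w (n - m) t * (negSymbol lam m * u m t)) :=
    fun m => (hw _).1.mul ((hu m).1.const_mul _)
  have hp := (integrable_tsum_of_lintegral hm hfin).2
  rw [← integral_mul_timeFt hh hp]
  have hc := continuous_timeFt hh
  have hsum := hasSum_integral_of_lintegral
    (f := fun m t => timeFt h t * (w (n - m) t * (negSymbol lam m * u m t)))
    (fun m => hc.aestronglyMeasurable.mul (hm m)) (by
      have hb : ∀ m : ℤ, ∫⁻ t, ‖timeFt h t * (w (n - m) t * (negSymbol lam m * u m t))‖ₑ ≤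
          ENNReal.ofReal (∫ t, ‖h t‖) * ∫⁻ t, ‖w (n - m) t * (negSymbol lam m * u m t)‖ₑ :=
        fun m => by
          rw [← lintegral_const_mul' _ _ ENNReal.ofReal_ne_top]
          refine lintegral_mono fun t => ?_
          rw [enorm_mul, ← ofReal_norm (timeFt h t)]
          gcongr
          exact norm_timeFt_le h t
      refine ne_top_of_le_ne_top ?_ (ENNReal.tsum_le_tsum hb)
      rw [ENNReal.tsum_mul_left]
      exact ENNReal.mul_ne_top ENNReal.ofReal_ne_top hfin)
  simp_rw [tsum_mul_left] at hsum
  rw [← (Equiv.subLeft n).hasSum_iff] at hsum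
  simpa only [Function.comp_def, Equiv.subLeft_apply, sub_sub_cancel] using hsum

end Product

end BOTorus

/-! ### The symbol of the projection, and duality for the output norm. -/

namespace BOTorus

section Cutoff

variable {η : ℝ → ℝ}

/-- The symbol of `P_{+hi}`. -/
noncomputable def posHighSymbol (η : ℝ → ℝ) (lam : ℝ) (n : ℤ) : ℂ :=
  Set.indicator (Set.Ioi (0 : ℝ)) 1 (n / lam : ℝ) *
    ((∑' k : ℕ, dyadicSymbol η (2 ^ (k + 1)) (n / lam) : ℝ) : ℂ)

lemma projPosHigh_apply (lam : ℝ) (c : Coeffs) (n : ℤ) (t : ℝ) :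
    projPosHigh η lam c n t = posHighSymbol η lam n * c n t := by
  unfold projPosHigh projPos projHigh multiplier posHighSymbol
  rw [mul_assoc]

/-- The sum telescopes and is finite, because η(ξ/2^k) = 1 as soon as 2^k ≥ ξ. Consequently the
projection is bounded by 1 and kills ξ ≤ 1, which justifies ξ > 1 in the kernel bounds. -/
lemma tsum_dyadicSymbol (hη : IsCutoff η) {ξ : ℝ} (hξ : 0 < ξ) :
    ∑' k : ℕ, dyadicSymbol η (2 ^ (k + 1)) ξ = 1 - η ξ := by
  obtain ⟨K, hK⟩ := pow_unbounded_of_one_lt ξ one_lt_two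
  have h1 : ∀ k, K ≤ k → η (ξ / 2 ^ k) = 1 := fun k hk => by
    refine hη.eq_one _ ⟨by have : 0 < ξ / 2 ^ k := by positivity
                           linarith, ?_⟩
    rw [div_le_one (by positivity)]
    exact hK.le.trans (pow_le_pow_right₀ one_le_two hk)
  have h2 : ∀ k : ℕ, dyadicSymbol η (2 ^ (k + 1)) ξ = η (ξ / 2 ^ (k + 1)) - η (ξ / 2 ^ k) :=
    fun k => by
      unfold dyadicSymbol
      congr 2
      rw [pow_succ]
      field_simp
  simp_rw [h2]
  rw [tsum_eq_sum (s := Finset.range K) fun k hk => by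
    have hk' : K ≤ k := not_lt.1 fun h => hk (Finset.mem_range.2 h)
    rw [h1 _ hk', h1 _ (hk'.trans (Nat.le_succ k)), sub_self],
    Finset.sum_range_sub fun k => η (ξ / 2 ^ k), h1 K le_rfl, pow_zero, div_one]

lemma norm_posHighSymbol_le (hη : IsCutoff η) (lam : ℝ) (n : ℤ) : ‖posHighSymbol η lam n‖ ≤ 1 := by
  unfold posHighSymbol
  by_cases h : (0 : ℝ) < n / lam
  · rw [Set.indicator_of_mem (Set.mem_Ioi.2 h), tsum_dyadicSymbol hη h, Pi.one_apply, one_mul,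
      Complex.norm_real, Real.norm_eq_abs, abs_le]
    constructor <;> linarith [hη.nonneg (n / lam), hη.le_one (n / lam)]
  · rw [Set.indicator_of_notMem (by simpa using h)]
    simp

lemma posHighSymbol_eq_zero (hη : IsCutoff η) {lam : ℝ} {n : ℤ} (h : (n / lam : ℝ) ≤ 1) :
    posHighSymbol η lam n = 0 := by
  unfold posHighSymbol
  by_cases h0 : (0 : ℝ) < n / lam
  · rw [tsum_dyadicSymbol hη h0, hη.eq_one _ ⟨by linarith, h⟩]
    simp
  · rw [Set.indicator_of_notMem (by simpa using h0), zero_mul]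

end Cutoff

section Duality

variable {lam s : ℝ}

/-- The squared weight of `X^{s+1/2,-1/2}`. -/
noncomputable def outWeight (lam s : ℝ) (n : ℤ) (τ : ℝ) : ℝ :=
  bracket (τ + |n / lam| * (n / lam)) ^ (2 * -(1 / 2) : ℝ) * bracket (n / lam) ^ (2 * (s + 1 / 2))

lemma outWeight_nonneg (lam s : ℝ) (n : ℤ) (τ : ℝ) : 0 ≤ outWeight lam s n τ :=
  mul_nonneg (Real.rpow_nonneg (bracket_pos _).le _) (Real.rpow_nonneg (bracket_pos _).le _)

lemma continuous_outWeight (lam s : ℝ) (n : ℤ) : Continuous (outWeight lam s n) := by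
  unfold outWeight
  refine Continuous.mul (Continuous.rpow_const ?_ fun τ => Or.inl (bracket_pos _).ne')
    continuous_const
  unfold bracket
  fun_prop

lemma weightDual_sq_mul_outWeight (lam s : ℝ) (n : ℤ) (τ : ℝ) :
    weightDual lam s (n, τ) ^ 2 * ENNReal.ofReal (outWeight lam s n τ) = 1 := by
  have h1 := bracket_pos (modulation lam (n, τ))
  have h2 := bracket_pos (n / lam : ℝ)
  unfold weightDual
  rw [← ENNReal.ofReal_pow (by positivity), ← ENNReal.ofReal_mul (by positivity),
    ← ENNReal.ofReal_one]
  congr 1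
  change (bracket (modulation lam (n, τ)) ^ (1 / 2 : ℝ) * bracket (n / lam) ^ (-(s + 1 / 2))) ^ 2 *
    (bracket (modulation lam (n, τ)) ^ (2 * -(1 / 2) : ℝ) *
      bracket (n / lam) ^ (2 * (s + 1 / 2))) = 1
  simp only [bracket_rpow_eq_exp, ← Real.exp_add, ← Real.exp_nat_mul]
  rw [← Real.exp_zero]
  congr 1
  push_cast
  ring

/-- Division by E^(1/2) needs E finite; this is why the duality argument works with truncated test
functions. -/
lemma le_sq_of_le_rpow_half_mul {E M : ℝ≥0∞} (hE : E ≠ ∞) (h : E ≤ E ^ (1 / 2 : ℝ) * M) :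
    E ≤ M ^ 2 := by
  rcases eq_or_ne E 0 with h0 | h0
  · simp [h0]
  have h1 : E ^ (1 / 2 : ℝ) * E ^ (1 / 2 : ℝ) ≤ E ^ (1 / 2 : ℝ) * M := by
    rwa [← sq, sq_rpow_half]
  have h2 : E ^ (1 / 2 : ℝ) ≤ M := by
    refine (ENNReal.mul_le_mul_iff_right ?_ ?_).1 h1
    · exact (ENNReal.rpow_pos (pos_iff_ne_zero.2 h0) hE).ne'
    · exact ENNReal.rpow_ne_top_of_nonneg (by norm_num) hE
  calc E = (E ^ (1 / 2 : ℝ)) ^ 2 := (sq_rpow_half E).symm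
    _ ≤ M ^ 2 := by gcongr

/-- The norm of `X^{s+1/2,-1/2}` is computed by duality. -/
lemma tsum_lintegral_sq_le_of_dual {P : ℤ → ℝ → ℂ} (hP : ∀ n, Continuous (P n)) {χ : ℤ → ℂ}
    (hχ1 : ∀ n, ‖χ n‖ ≤ 1) (hχ0 : ∀ n : ℤ, (n / lam : ℝ) ≤ 1 → χ n = 0) {M : ℝ≥0∞}
    (hM : ∀ h : ℤ → ℝ → ℂ, (∀ n, Measurable (h n)) → (∀ n, Integrable (h n)) →
      (∀ n, ∫⁻ τ, ENNReal.ofReal (bracket (modulation lam (n, τ))) * ‖h n τ‖ₑ ^ 2 ≠ ∞) →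
      ∀ A : Finset ℤ, (∀ n ∈ A, 1 < (n / lam : ℝ)) →
        ‖∑ n ∈ A, ∫ τ, h n τ * P n τ‖ₑ ≤ weightedNorm (weightDual lam s) h * M) :
    ∑' n : ℤ, ∫⁻ τ, ENNReal.ofReal (outWeight lam s n τ) * ‖χ n * P n τ‖ₑ ^ 2 ≤ M ^ 2 := by
  classical
  have hcont : ∀ n, Continuous fun τ => outWeight lam s n τ * ‖P n τ‖ ^ 2 := fun n =>
    (continuous_outWeight lam s n).mul ((hP n).norm.pow 2)
  have hnn : ∀ n τ, 0 ≤ outWeight lam s n τ * ‖P n τ‖ ^ 2 := fun n τ =>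
    mul_nonneg (outWeight_nonneg _ _ _ _) (sq_nonneg _)
  have hof : ∀ n τ, ENNReal.ofReal (outWeight lam s n τ * ‖P n τ‖ ^ 2) =
      ENNReal.ofReal (outWeight lam s n τ) * ‖P n τ‖ₑ ^ 2 := fun n τ => by
    rw [ENNReal.ofReal_mul (outWeight_nonneg _ _ _ _), ENNReal.ofReal_pow (norm_nonneg _),
      ofReal_norm]
  have hE : ∀ n (R : ℝ), ENNReal.ofReal (∫ τ in Set.Icc (-R) R,
      outWeight lam s n τ * ‖P n τ‖ ^ 2) =
      ∫⁻ τ in Set.Icc (-R) R, ENNReal.ofReal (outWeight lam s n τ) * ‖P n τ‖ₑ ^ 2 := fun n R => by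
    rw [ofReal_integral_eq_lintegral_ofReal ((hcont n).integrableOn_Icc)
      (Filter.Eventually.of_forall (hnn n))]
    simp_rw [hof]
  have main : ∀ A : Finset ℤ, (∀ n ∈ A, 1 < (n / lam : ℝ)) → ∀ R : ℝ,
      ∑ n ∈ A, ∫⁻ τ in Set.Icc (-R) R,
        ENNReal.ofReal (outWeight lam s n τ) * ‖P n τ‖ₑ ^ 2 ≤ M ^ 2 := by
    intro A hA R
    -- The extremal test function: truncated to |τ| ≤ R and n ∈ A, its pairing with P and the square
    -- of its dual norm are the same finite number E.
    set g : ℤ → ℝ → ℂ := fun n τ => (outWeight lam s n τ : ℂ) * starRingEnd ℂ (P n τ) with hg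
    have hgc : ∀ n, Continuous (g n) := fun n =>
      (Complex.continuous_ofReal.comp (continuous_outWeight lam s n)).mul
        (Complex.continuous_conj.comp (hP n))
    set h : ℤ → ℝ → ℂ := fun n => if n ∈ A then (Set.Icc (-R) R).indicator (g n) else 0 with hh
    have hdual : ∀ n, ∀ τ, (weightDual lam s (n, τ) * ‖h n τ‖ₑ) ^ 2 = if n ∈ A then
        (Set.Icc (-R) R).indicator
          (fun τ => ENNReal.ofReal (outWeight lam s n τ) * ‖P n τ‖ₑ ^ 2) τ else 0 := by
      intro n τ
      by_cases hn : n ∈ A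
      · by_cases hτ : τ ∈ Set.Icc (-R) R
        · simp only [hh, if_pos hn, Set.indicator_of_mem hτ, hg]
          rw [enorm_mul, mul_pow, mul_pow, RCLike.enorm_conj, ← ofReal_norm (_ : ℂ),
            Complex.norm_real, Real.norm_of_nonneg (outWeight_nonneg _ _ _ _), sq (ENNReal.ofReal _),
            ← mul_assoc, ← mul_assoc, weightDual_sq_mul_outWeight, one_mul]
        · simp [hh, hn, Set.indicator_of_notMem hτ]
      · simp [hh, hn]
    have hdual2 : ∀ n, ∫⁻ τ, (weightDual lam s (n, τ) * ‖h n τ‖ₑ) ^ 2 = if n ∈ A then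
        ∫⁻ τ in Set.Icc (-R) R, ENNReal.ofReal (outWeight lam s n τ) * ‖P n τ‖ₑ ^ 2 else 0 := by
      intro n
      simp_rw [hdual]
      split_ifs
      · exact lintegral_indicator measurableSet_Icc _
      · simp
    have mh : ∀ n, Measurable (h n) := fun n => by
      simp only [hh]
      split_ifs
      · exact (hgc n).measurable.indicator measurableSet_Icc
      · exact measurable_const
    have hi : ∀ n, Integrable (h n) := fun n => by
      simp only [hh]
      split_ifs
      · exact ((hgc n).integrableOn_Icc).integrable_indicator measurableSet_Icc
      · exact integrable_zero _ _ _
    have hfin : ∀ n, ∫⁻ τ, ENNReal.ofReal (bracket (modulation lam (n, τ))) * ‖h n τ‖ₑ ^ 2 ≠ ∞ := by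
      intro n
      simp_rw [weightDual_sq lam s, mul_assoc, ← mul_pow]
      rw [lintegral_const_mul' _ _ ENNReal.ofReal_ne_top, hdual2]
      refine ENNReal.mul_ne_top ENNReal.ofReal_ne_top ?_
      split_ifs
      · rw [← hE]; exact ENNReal.ofReal_ne_top
      · exact ENNReal.zero_ne_top
    have key := hM h mh hi hfin A hA
    set E := ∑ n ∈ A, ∫⁻ τ in Set.Icc (-R) R,
        ENNReal.ofReal (outWeight lam s n τ) * ‖P n τ‖ₑ ^ 2 with hEdef
    have hnorm : weightedNorm (weightDual lam s) h = E ^ (1 / 2 : ℝ) := by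
      rw [← rpow_half_sq (weightedNorm _ _), weightedNorm_sq (measurable_weightDual lam s) mh]
      simp_rw [hdual2]
      rw [tsum_eq_sum (s := A) fun n hn => if_neg hn]
      congr 1
      exact Finset.sum_congr rfl fun n hn => if_pos hn
    have hint : ∀ n ∈ A, ∫ τ, h n τ * P n τ =
        ((∫ τ in Set.Icc (-R) R, outWeight lam s n τ * ‖P n τ‖ ^ 2 : ℝ) : ℂ) := by
      intro n hn
      rw [← integral_complex_ofReal, ← integral_indicator measurableSet_Icc]
      refine integral_congr_ae (Filter.Eventually.of_forall fun τ => ?_)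
      simp only [hh, if_pos hn]
      by_cases hτ : τ ∈ Set.Icc (-R) R
      · rw [Set.indicator_of_mem hτ, Set.indicator_of_mem hτ]
        simp only [hg]
        rw [mul_assoc, Complex.conj_mul']
        push_cast
        rfl
      · rw [Set.indicator_of_notMem hτ, Set.indicator_of_notMem hτ, zero_mul]
    have hval : ‖∑ n ∈ A, ∫ τ, h n τ * P n τ‖ₑ = E := by
      rw [Finset.sum_congr rfl hint, ← Complex.ofReal_sum, ← ofReal_norm, Complex.norm_real,
        Real.norm_of_nonneg (Finset.sum_nonneg fun n _ => integral_nonneg (hnn n)),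
        ENNReal.ofReal_sum_of_nonneg fun n _ => integral_nonneg (hnn n)]
      exact Finset.sum_congr rfl fun n _ => hE n R
    rw [hval, hnorm] at key
    refine le_sq_of_le_rpow_half_mul ?_ key
    refine ENNReal.sum_ne_top.2 fun n _ => ?_
    rw [← hE]; exact ENNReal.ofReal_ne_top
  have main2 : ∀ A : Finset ℤ, (∀ n ∈ A, 1 < (n / lam : ℝ)) →
      ∑ n ∈ A, ∫⁻ τ, ENNReal.ofReal (outWeight lam s n τ) * ‖P n τ‖ₑ ^ 2 ≤ M ^ 2 := by
    intro A hA
    -- The bound does not depend on R, so the intervals can exhaust the line.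
    have ht := tendsto_finsetSum A fun n _ =>
      (aecover_Icc (μ := (volume : Measure ℝ)) Filter.tendsto_neg_atTop_atBot
        Filter.tendsto_id).lintegral_tendsto_of_countably_generated
        (f := fun τ => ENNReal.ofReal (outWeight lam s n τ) * ‖P n τ‖ₑ ^ 2)
        (by simp_rw [← hof]; exact (hcont n).measurable.ennreal_ofReal.aemeasurable)
    exact le_of_tendsto' ht fun R => main A hA R
  refine ENNReal.summable.tsum_le_of_sum_le fun A => ?_
  refine le_trans ?_ (main2 (A.filter fun n => 1 < (n / lam : ℝ))
    fun n hn => (Finset.mem_filter.1 hn).2)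
  rw [Finset.sum_filter]
  refine Finset.sum_le_sum fun n _ => ?_
  split_ifs with hn
  · refine lintegral_mono fun τ => ?_
    rw [enorm_mul, mul_pow]
    gcongr
    have : ‖χ n‖ₑ ≤ 1 := by
      rw [← ofReal_norm, ← ENNReal.ofReal_one]; exact ENNReal.ofReal_le_ofReal (hχ1 n)
    exact mul_le_of_le_one_left zero_le (pow_le_one₀ zero_le this)
  · simp [hχ0 n (not_lt.1 hn)]

end Duality

end BOTorus

/-! ### The norms in terms of weighted L² norms; factors of λ. -/

namespace BOTorus

section Norms

variable {lam s b : ℝ} {c : Coeffs} {G : ℤ → ℝ → ℂ}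

/-- The norm of `X^{s,b}` is computed with any version of the Fourier transform. -/
lemma xNorm_eq (hl : 0 < lam) (hG : ∀ n, IsTimeFourier (c n) (G n)) :
    xNorm lam s b c = ENNReal.ofReal (2 * Real.pi) * ENNReal.ofReal lam ^ (1 / 2 : ℝ) *
      (∑' n : ℤ, ∫⁻ τ : ℝ, ENNReal.ofReal (bracket (τ + |n / lam| * (n / lam)) ^ (2 * b)
        * bracket (n / lam) ^ (2 * s)) * ‖G n τ‖ₑ ^ 2) ^ (1 / 2 : ℝ) := by
  have hpi := Real.pi_pos
  have key : ∀ G' : ℤ → ℝ → ℂ, (∀ n, IsTimeFourier (c n) (G' n)) →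
      (ENNReal.ofReal lam⁻¹ * ∑' n : ℤ, ∫⁻ τ : ℝ,
      ENNReal.ofReal (bracket (τ + |n / lam| * (n / lam)) ^ (2 * b)
        * bracket (n / lam) ^ (2 * s)) * ‖(2 * Real.pi * lam : ℝ) * G' n τ‖ₑ ^ 2) ^ (1 / 2 : ℝ) =
      ENNReal.ofReal (2 * Real.pi) * ENNReal.ofReal lam ^ (1 / 2 : ℝ) *
      (∑' n : ℤ, ∫⁻ τ : ℝ, ENNReal.ofReal (bracket (τ + |n / lam| * (n / lam)) ^ (2 * b)
        * bracket (n / lam) ^ (2 * s)) * ‖G n τ‖ₑ ^ 2) ^ (1 / 2 : ℝ) := by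
    intro G' hG'
    have e : ∀ n : ℤ, ∫⁻ τ : ℝ, ENNReal.ofReal (bracket (τ + |n / lam| * (n / lam)) ^ (2 * b)
        * bracket (n / lam) ^ (2 * s)) * ‖(2 * Real.pi * lam : ℝ) * G' n τ‖ₑ ^ 2 =
        ENNReal.ofReal (2 * Real.pi * lam) ^ 2 *
          ∫⁻ τ : ℝ, ENNReal.ofReal (bracket (τ + |n / lam| * (n / lam)) ^ (2 * b)
            * bracket (n / lam) ^ (2 * s)) * ‖G n τ‖ₑ ^ 2 := fun n => by
      rw [← lintegral_const_mul' _ _ (by finiteness)]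
      refine lintegral_congr_ae ?_
      filter_upwards [(hG' n).ae_eq (hG n)] with τ hτ
      rw [hτ, enorm_mul, mul_pow, ← ofReal_norm ((_ : ℝ) : ℂ), Complex.norm_real,
        Real.norm_of_nonneg (by positivity)]
      ring
    simp_rw [e]
    rw [ENNReal.tsum_mul_left, ← mul_assoc, mul_rpow_half]
    congr 1
    have h2 : ENNReal.ofReal lam⁻¹ * ENNReal.ofReal (2 * Real.pi * lam) ^ 2 =
        ENNReal.ofReal (2 * Real.pi) ^ 2 * ENNReal.ofReal lam := by
      rw [← ENNReal.ofReal_pow (by positivity), ← ENNReal.ofReal_pow (by positivity),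
        ← ENNReal.ofReal_mul (by positivity), ← ENNReal.ofReal_mul (by positivity)]
      congr 1
      field_simp
    rw [h2, mul_rpow_half, rpow_half_sq]
  refine le_antisymm ((iInf₂_le G hG).trans_eq (key G hG)) ?_
  exact le_iInf₂ fun G' hG' => (key G' hG').ge

lemma xNorm_in_eq (hl : 0 < lam) (hG : ∀ n, IsTimeFourier (c n) (G n))
    (mG : ∀ n, Measurable (G n)) :
    xNorm lam (s + 1 / 2) (1 / 2) c = ENNReal.ofReal (2 * Real.pi) *
      ENNReal.ofReal lam ^ (1 / 2 : ℝ) * weightedNorm (weightIn lam s) G := by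
  rw [xNorm_eq hl hG, ← rpow_half_sq (weightedNorm _ _), weightedNorm_sq (measurable_weightIn _ _) mG]
  simp_rw [mul_pow, weightIn_sq]
  rw [show (2 * (1 / 2) : ℝ) = 1 by norm_num, show 2 * (s + 1 / 2) = 2 * s + 1 by ring]
  simp_rw [Real.rpow_one]
  rfl

lemma weightNeg_sq_le (lam s : ℝ) (m : ℤ) (τ : ℝ) : weightNeg lam s (m, τ) ^ 2 ≤
    2 * ENNReal.ofReal (bracket (m / lam) ^ (2 * s)) +
      2 * ENNReal.ofReal (bracket (τ + |m / lam| * (m / lam)) ^ (2 * 1 : ℝ)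
        * bracket (m / lam) ^ (2 * (s - 1))) := by
  have h1 := bracket_pos (m / lam : ℝ)
  have h2 := bracket_pos (τ + |m / lam| * (m / lam))
  rw [← ENNReal.ofReal_ofNat, ← ENNReal.ofReal_mul (by norm_num),
    ← ENNReal.ofReal_mul (by norm_num), ← ENNReal.ofReal_add (by positivity) (by positivity)]
  unfold weightNeg
  rw [← ENNReal.ofReal_pow (by have := bracket_pos (modulation lam (m, τ)); positivity)]
  refine ENNReal.ofReal_le_ofReal ?_
  change (bracket (m / lam) ^ (s - 1) *
    (bracket (m / lam) + bracket (τ + |m / lam| * (m / lam)))) ^ 2 ≤ _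
  set x := bracket (m / lam)
  set y := bracket (τ + |m / lam| * (m / lam))
  have e1 : x ^ (2 * s) = (x ^ (s - 1)) ^ 2 * x ^ 2 := by
    rw [← Real.rpow_natCast, ← Real.rpow_mul h1.le, ← Real.rpow_natCast x, ← Real.rpow_add h1]
    congr 1; push_cast; ring
  have e2 : x ^ (2 * (s - 1)) = (x ^ (s - 1)) ^ 2 := by
    rw [← Real.rpow_natCast, ← Real.rpow_mul h1.le]
    congr 1; push_cast; ring
  have e3 : y ^ (2 * 1 : ℝ) = y ^ 2 := by
    rw [mul_one]; exact Real.rpow_two y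
  rw [e1, e2, e3]
  nlinarith [mul_nonneg (sq_nonneg (x ^ (s - 1))) (sq_nonneg (x - y))]

lemma bracket_rpow_le_besselSymbol (hs : 0 ≤ s) (ξ : ℝ) :
    bracket ξ ^ (2 * s) ≤ 2 ^ s * besselSymbol s ξ ^ 2 := by
  have h1 : bracket ξ ^ 2 ≤ 2 * (1 + |ξ| ^ 2) := by
    unfold bracket; nlinarith [sq_nonneg (|ξ| - 1)]
  unfold besselSymbol
  rw [← Real.rpow_natCast (_ ^ (s / 2)), ← Real.rpow_mul (by positivity),
    Real.rpow_mul (bracket_pos ξ).le, Real.rpow_two]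
  refine (Real.rpow_le_rpow (by positivity) h1 hs).trans (le_of_eq ?_)
  rw [Real.mul_rpow (by norm_num) (by positivity)]
  congr 2
  push_cast; ring

lemma tsum_lintegral_in_ne_top {u : ℤ → ℝ → ℂ} (hw : ∀ k, MemLp (u k) 2) (hG : ∀ n, IsTimeFourier (u n) (G n))
    (mG : ∀ n, Measurable (G n)) (hfin : weightedNorm (weightIn lam s) G ≠ ∞) :
    ∑' k : ℤ, ENNReal.ofReal (bracket (k / lam) ^ (2 * s + 1)) * ∫⁻ t, ‖u k t‖ₑ ^ 2 ≠ ∞ := by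
  have h : weightedNorm (weightIn lam s) G ^ 2 ≠ ∞ := ENNReal.pow_ne_top hfin
  rw [weightedNorm_sq (measurable_weightIn _ _) mG] at h
  refine ne_top_of_le_ne_top h (ENNReal.tsum_le_tsum fun k => ?_)
  calc _ ≤ ENNReal.ofReal (bracket (k / lam) ^ (2 * s + 1)) * ∫⁻ τ, ‖G k τ‖ₑ ^ 2 := by
        refine mul_le_mul_right ?_ _
        rw [((hG k).lintegral_eq (hw k)).2]
        refine le_mul_of_one_le_left zero_le ?_
        rw [← ENNReal.ofReal_one]
        exact ENNReal.ofReal_le_ofReal (by linarith [Real.pi_gt_three])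
    _ ≤ _ := by
        rw [← lintegral_const_mul' _ _ ENNReal.ofReal_ne_top]
        refine lintegral_mono fun τ => ?_
        rw [mul_pow, weightIn_sq]
        gcongr
        have := bracket_pos (k / lam)
        exact le_mul_of_one_le_left (by positivity) (one_le_bracket _)

variable [hl : Fact (1 ≤ lam)] {u : ℤ → ℝ → ℂ} {v : ℝ × Torus lam → ℂ}

lemma tsum_lintegral_bessel_le (hs : 0 ≤ s) (hv : MemLp v 2 volume)
    (hvu : ∀ m : ℤ, coeffs v m =ᵐ[volume] fun t => (besselSymbol s (m / lam) : ℂ) * u m t) :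
    ENNReal.ofReal (2 * Real.pi * lam) *
        ∑' m : ℤ, ENNReal.ofReal (bracket (m / lam) ^ (2 * s)) * ∫⁻ t, ‖u m t‖ₑ ^ 2 ≤
      ENNReal.ofReal (2 ^ s) * ∫⁻ x, ‖v x‖ₑ ^ 2 := by
  rw [← tsum_lintegral_coeffs_sq hv, mul_left_comm]
  gcongr
  rw [← ENNReal.tsum_mul_left]
  refine ENNReal.tsum_le_tsum fun m => ?_
  have e : ∫⁻ t, ‖coeffs v m t‖ₑ ^ 2 =
      ENNReal.ofReal (besselSymbol s (m / lam) ^ 2) * ∫⁻ t, ‖u m t‖ₑ ^ 2 := by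
    rw [← lintegral_const_mul' _ _ ENNReal.ofReal_ne_top]
    refine lintegral_congr_ae ?_
    filter_upwards [hvu m] with t ht
    rw [ht, enorm_mul, mul_pow, ← ofReal_norm ((_ : ℝ) : ℂ), Complex.norm_real,
      Real.norm_of_nonneg (besselSymbol_pos _ _).le, ENNReal.ofReal_pow (besselSymbol_pos _ _).le]
  rw [e, ← mul_assoc, ← ENNReal.ofReal_mul (by positivity)]
  gcongr
  exact bracket_rpow_le_besselSymbol hs _

/-- The squared weight is at most twice the sum of those of X^{s,0} and X^{s-1,1}. The first part is
‖J^s u‖ in L² by Plancherel in time and Parseval in space. The factor λ^(1/2) is the one produced by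
the trilinear estimate. -/
lemma weightedNorm_weightNeg_le (hs : 0 ≤ s) (hu : ∀ m, MemLp (u m) 2)
    (hG : ∀ m, IsTimeFourier (u m) (G m)) (mG : ∀ m, Measurable (G m)) (hv : MemLp v 2 volume)
    (hvu : ∀ m : ℤ, coeffs v m =ᵐ[volume] fun t => (besselSymbol s (m / lam) : ℂ) * u m t) :
    ENNReal.ofReal lam ^ (1 / 2 : ℝ) * weightedNorm (weightNeg lam s) G ≤
      2 * (ENNReal.ofReal (2 ^ s) ^ (1 / 2 : ℝ) * (∫⁻ x, ‖v x‖ₑ ^ 2) ^ (1 / 2 : ℝ) +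
        xNorm lam (s - 1) 1 u) := by
  have hl0 : 0 < lam := lam_pos
  set N₀ := ∑' m : ℤ, ∫⁻ τ, ENNReal.ofReal (bracket (m / lam) ^ (2 * s)) * ‖G m τ‖ₑ ^ 2 with hN₀
  set N₁ := ∑' m : ℤ, ∫⁻ τ, ENNReal.ofReal (bracket (τ + |m / lam| * (m / lam)) ^ (2 * 1 : ℝ)
        * bracket (m / lam) ^ (2 * (s - 1))) * ‖G m τ‖ₑ ^ 2 with hN₁
  have h1 : weightedNorm (weightNeg lam s) G ^ 2 ≤ 2 * N₀ + 2 * N₁ := by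
    rw [weightedNorm_sq (measurable_weightNeg _ _) mG, hN₀, hN₁, ← ENNReal.tsum_mul_left,
      ← ENNReal.tsum_mul_left, ← ENNReal.tsum_add]
    refine ENNReal.tsum_le_tsum fun m => ?_
    have hm : Measurable fun τ => ENNReal.ofReal (bracket (m / lam) ^ (2 * s)) * ‖G m τ‖ₑ ^ 2 :=
      ((mG m).enorm.pow_const 2).const_mul _
    rw [← lintegral_const_mul' _ _ (by norm_num), ← lintegral_const_mul' _ _ (by norm_num),
      ← lintegral_add_left (hm.const_mul 2)]
    refine lintegral_mono fun τ => ?_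
    rw [mul_pow]
    refine (mul_le_mul_left (weightNeg_sq_le lam s m τ) _).trans (le_of_eq ?_)
    ring
  have h2 : weightedNorm (weightNeg lam s) G ≤ 2 * (N₀ ^ (1 / 2 : ℝ) + N₁ ^ (1 / 2 : ℝ)) := by
    rw [← rpow_half_sq (weightedNorm _ _)]
    refine (ENNReal.rpow_le_rpow h1 (by norm_num)).trans ?_
    rw [← mul_add, mul_rpow_half]
    refine mul_le_mul' ?_ (rpow_half_add_le _ _)
    calc (2 : ℝ≥0∞) ^ (1 / 2 : ℝ) ≤ 2 ^ (1 : ℝ) :=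
          ENNReal.rpow_le_rpow_of_exponent_le (by norm_num) (by norm_num)
      _ = 2 := ENNReal.rpow_one _
  have h3 : ENNReal.ofReal lam ^ (1 / 2 : ℝ) * N₀ ^ (1 / 2 : ℝ) ≤
      ENNReal.ofReal (2 ^ s) ^ (1 / 2 : ℝ) * (∫⁻ x, ‖v x‖ₑ ^ 2) ^ (1 / 2 : ℝ) := by
    rw [← mul_rpow_half, ← mul_rpow_half]
    refine ENNReal.rpow_le_rpow ?_ (by norm_num)
    refine le_trans (le_of_eq ?_) (tsum_lintegral_bessel_le hs hv hvu)
    have e : N₀ = ENNReal.ofReal (2 * Real.pi) *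
        ∑' m : ℤ, ENNReal.ofReal (bracket (m / lam) ^ (2 * s)) * ∫⁻ t, ‖u m t‖ₑ ^ 2 := by
      rw [hN₀, ← ENNReal.tsum_mul_left]
      refine tsum_congr fun m => ?_
      rw [lintegral_const_mul' _ _ ENNReal.ofReal_ne_top, ((hG m).lintegral_eq (hu m)).2,
        mul_left_comm]
    rw [e, ENNReal.ofReal_mul Real.two_pi_pos.le]
    ring
  have h4 : ENNReal.ofReal lam ^ (1 / 2 : ℝ) * N₁ ^ (1 / 2 : ℝ) ≤ xNorm lam (s - 1) 1 u := by
    rw [xNorm_eq hl0 hG, mul_assoc]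
    refine le_mul_of_one_le_left zero_le ?_
    rw [← ENNReal.ofReal_one]
    exact ENNReal.ofReal_le_ofReal (by linarith [Real.pi_gt_three])
  calc _ ≤ ENNReal.ofReal lam ^ (1 / 2 : ℝ) * (2 * (N₀ ^ (1 / 2 : ℝ) + N₁ ^ (1 / 2 : ℝ))) := by
        gcongr
    _ = 2 * (ENNReal.ofReal lam ^ (1 / 2 : ℝ) * N₀ ^ (1 / 2 : ℝ) +
        ENNReal.ofReal lam ^ (1 / 2 : ℝ) * N₁ ^ (1 / 2 : ℝ)) := by ring
    _ ≤ _ := by gcongr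

/-- Hölder on the torus was used with normalized measure; passing to total mass 2πλ absorbs exactly
the λ^(1/4) lost in Bernstein. -/
lemma rpow_quarter_mul_le :
    ENNReal.ofReal lam ^ (1 / 4 : ℝ) *
      (∫⁻ x, ‖v x‖ₑ ^ 4 ∂(volume : Measure ℝ).prod AddCircle.haarAddCircle) ^ (1 / 4 : ℝ) ≤
      (∫⁻ x, ‖v x‖ₑ ^ 4) ^ (1 / 4 : ℝ) := by
  rw [lintegral_volume_eq, ← ENNReal.mul_rpow_of_nonneg _ _ (by norm_num)]
  refine ENNReal.rpow_le_rpow ?_ (by norm_num)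
  gcongr
  have := lam_pos (lam := lam)
  nlinarith [Real.pi_gt_three]

end Norms

/-- Purpose: to pass from each version of J^s u to the infimum defining the space-time norm, without
showing that the infimum is attained. -/
lemma le_mul_add_of_forall_lt {X K a S : ℝ≥0∞} (hK : K ≠ ∞) (hS : S < ∞)
    (h : ∀ t, S < t → X ≤ K * (a + t)) : X ≤ K * (a + S) := by
  have hc : Continuous fun t : ℝ≥0∞ => K * (a + t) :=
    (ENNReal.continuous_const_mul hK).comp (continuous_const.add continuous_id)
  have : (nhdsWithin S (Set.Ioi S)).NeBot := nhdsGT_neBot_of_exists_gt ⟨∞, hS⟩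
  refine ge_of_tendsto (x := nhdsWithin S (Set.Ioi S))
    ((hc.tendsto S).mono_left nhdsWithin_le_nhds) ?_
  filter_upwards [self_mem_nhdsWithin] with t ht using h t ht

lemma spaceTimeNorm_lt_iff {lam : ℝ} [Fact (1 ≤ lam)] {p : ℝ≥0∞} {c : Coeffs} {t : ℝ≥0∞} :
    spaceTimeNorm lam p c < t ↔ ∃ v : ℝ × Torus lam → ℂ, MemLp v p volume ∧
      (∀ n, coeffs v n =ᵐ[volume] c n) ∧ eLpNorm v p volume < t := by
  unfold spaceTimeNorm
  simp only [iInf_lt_iff, exists_prop]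

end BOTorus

/-! ### Assembly of the bilinear estimate. -/

namespace BOTorus

lemma exists_measurable_isTimeFourier {f : ℝ → ℂ} (hf : MemLp f 2) :
    ∃ F, Measurable F ∧ IsTimeFourier f F := by
  obtain ⟨F, h1, h2, -⟩ := exists_isTimeFourier hf
  exact ⟨h1.1.mk F, h1.1.stronglyMeasurable_mk.measurable, h2.congr_right h1.1.ae_eq_mk⟩

lemma projNeg_dx_apply {lam : ℝ} (hl : 0 < lam) (c : Coeffs) (m : ℤ) (t : ℝ) :
    projNeg lam (dx lam c) m t = negSymbol lam m * c m t := by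
  unfold projNeg dx multiplier negSymbol
  by_cases hm : m < 0
  · rw [if_pos hm, Set.indicator_of_mem, Pi.one_apply, one_mul]
    exact div_neg_of_neg_of_pos (by exact_mod_cast hm) hl
  · rw [if_neg hm, Set.indicator_of_notMem, zero_mul, zero_mul]
    have : (0 : ℝ) ≤ m := by exact_mod_cast not_lt.1 hm
    exact not_lt.2 (div_nonneg this hl.le)

/-- The constant in the bilinear estimate. -/
noncomputable def bilinearConst (s : ℝ) : ℝ≥0∞ :=
  240 * 24 * sobolevConst ^ (1 / 4 : ℝ) + ENNReal.ofReal (freezeConst s) * trilinearConst *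
    (2 * (ENNReal.ofReal (2 ^ s) ^ (1 / 2 : ℝ) + 1))

lemma bilinearConst_ne_top (s : ℝ) : bilinearConst s ≠ ∞ := by
  have h1 : sobolevConst ≠ ∞ := ENNReal.mul_ne_top ENNReal.ofReal_ne_top
    (ENNReal.mul_ne_top (by norm_num) lintegral_decay_lt_top.ne)
  have h2 : trilinearConst ≠ ∞ := ENNReal.mul_ne_top ENNReal.ofReal_ne_top
    (ENNReal.mul_ne_top (by norm_num) (ENNReal.rpow_ne_top_of_nonneg (by norm_num)
      (ENNReal.mul_ne_top (by norm_num) decayConst_ne_top)))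
  unfold bilinearConst
  refine ENNReal.add_ne_top.2 ⟨ENNReal.mul_ne_top (by norm_num)
    (ENNReal.rpow_ne_top_of_nonneg (by norm_num) h1), ENNReal.mul_ne_top
      (ENNReal.mul_ne_top ENNReal.ofReal_ne_top h2) (ENNReal.mul_ne_top (by norm_num)
        (ENNReal.add_ne_top.2 ⟨ENNReal.rpow_ne_top_of_nonneg (by norm_num) ENNReal.ofReal_ne_top,
          ENNReal.one_ne_top⟩))⟩

variable {lam s : ℝ} [hl : Fact (1 ≤ lam)] {η : ℝ → ℝ} {w u : Coeffs} {v₂ v₄ : ℝ × Torus lam → ℂ}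

/-- The bilinear estimate, with given versions of `J^s u`. -/
theorem xNorm_product_le (hη : IsCutoff η) (hs : 1 / 4 ≤ s) (hw : ∀ k, MemLp (w k) 2)
    (hu : ∀ m, MemLp (u m) 2) (hX : xNorm lam (s + 1 / 2) (1 / 2) w < ∞)
    (hv₂ : MemLp v₂ 2 volume) (hvu₂ : ∀ n, coeffs v₂ n =ᵐ[volume] bessel lam s u n)
    (hv₄ : MemLp v₄ 4 volume) (hvu₄ : ∀ n, coeffs v₄ n =ᵐ[volume] bessel lam s u n) :
    ProductDefined w (projNeg lam (dx lam u)) ∧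
      xNorm lam (s + 1 / 2) (-(1 / 2)) (projPosHigh η lam (product w (projNeg lam (dx lam u)))) ≤
        bilinearConst s * xNorm lam (s + 1 / 2) (1 / 2) w *
          (eLpNorm v₂ 2 volume + eLpNorm v₄ 4 volume + xNorm lam (s - 1) 1 u) := by
  have hl0 : 0 < lam := lam_pos
  choose W mW hW using fun k => exists_measurable_isTimeFourier (hw k)
  choose U mU hU using fun m => exists_measurable_isTimeFourier (hu m)
  have hXw := xNorm_in_eq (s := s) hl0 hW mW
  have hwn : weightedNorm (weightIn lam s) W ≠ ∞ := by
    rw [hXw] at hX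
    refine (ENNReal.lt_top_of_mul_ne_top_right hX.ne (mul_ne_zero ?_ ?_)).ne
    · simpa using Real.pi_pos
    · exact (ENNReal.rpow_pos (by simpa using hl0) ENNReal.ofReal_ne_top).ne'
  have n2 : eLpNorm v₂ 2 volume = (∫⁻ x, ‖v₂ x‖ₑ ^ 2) ^ (1 / 2 : ℝ) := by
    rw [eLpNorm_eq_lintegral_rpow_enorm_toReal two_ne_zero ENNReal.ofNat_ne_top]
    simp
  have n4 : eLpNorm v₄ 4 volume = (∫⁻ x, ‖v₄ x‖ₑ ^ 4) ^ (1 / 4 : ℝ) := by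
    rw [eLpNorm_eq_lintegral_rpow_enorm_toReal four_ne_zero ENNReal.ofNat_ne_top]
    simp
  have hv4 : ∫⁻ x, ‖v₄ x‖ₑ ^ 4 < ∞ := by
    have := hv₄.2
    rw [n4] at this
    exact (ENNReal.rpow_lt_top_iff_of_pos (by norm_num)).1 this
  have hw1 := tsum_lintegral_in_ne_top (s := s) hw hW mW hwn
  have hu1 : ∑' m : ℤ, ENNReal.ofReal (bracket (m / lam) ^ (2 * s)) * ∫⁻ t, ‖u m t‖ₑ ^ 2 ≠ ∞ := by
    have h1 := tsum_lintegral_bessel_le (by linarith) hv₂ hvu₂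
    have h2 := h1.trans_lt (ENNReal.mul_lt_top ENNReal.ofReal_lt_top
      (memLp_two_iff_lintegral.1 hv₂).2)
    exact (ENNReal.lt_top_of_mul_ne_top_right h2.ne (by simpa using period_pos)).ne
  have hfin := tsum_lintegral_product_ne_top hs hw hw1 hu1
  have hmeas : ∀ n m, AEStronglyMeasurable
      (fun t => w (n - m) t * (negSymbol lam m * u m t)) volume :=
    fun n m => (hw _).1.mul ((hu m).1.const_mul _)
  have hprod := fun n => integrable_tsum_of_lintegral (hmeas n) (hfin n)
  set p : Coeffs := fun n t => ∑' m, w (n - m) t * (negSymbol lam m * u m t) with hp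
  have hpe : product w (projNeg lam (dx lam u)) = p := by
    funext n t
    simp only [product, hp, projNeg_dx_apply hl0]
  refine ⟨fun n => ?_, ?_⟩
  · simp_rw [projNeg_dx_apply hl0]
    exact hprod n
  rw [hpe]
  have hG : ∀ n, IsTimeFourier (projPosHigh η lam p n)
      (fun τ => posHighSymbol η lam n * timeFt (p n) τ) := fun n => by
    have := (isTimeFourier_timeFt (hprod n).2).const_mul (posHighSymbol η lam n)
    refine this.congr_left (Filter.Eventually.of_forall fun t => ?_)
    exact (projPosHigh_apply lam p n t).symm
  rw [xNorm_eq hl0 hG]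
  set I := (∫⁻ x, ‖v₄ x‖ₑ ^ 4 ∂(volume : Measure ℝ).prod AddCircle.haarAddCircle) ^ (1 / 4 : ℝ)
  set M := weightedNorm (weightIn lam s) W *
        (240 * 24 * ENNReal.ofReal lam ^ (1 / 4 : ℝ) * sobolevConst ^ (1 / 4 : ℝ) * I +
        ENNReal.ofReal (freezeConst s) * trilinearConst * ENNReal.ofReal lam ^ (1 / 2 : ℝ) *
          weightedNorm (weightNeg lam s) U) with hM
  have hdual := tsum_lintegral_sq_le_of_dual (lam := lam) (s := s) (P := fun n => timeFt (p n))
    (χ := posHighSymbol η lam) (M := M) (fun n => continuous_timeFt (hprod n).2)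
    (norm_posHighSymbol_le hη lam) (fun n hn => posHighSymbol_eq_zero hη hn)
    (fun h mh hi hhfin A hA => by
      -- The pairing bound is uniform in the finite set B of input frequencies, so it survives the
      -- limit that recovers the full product.
      have hs' := hasSum_sum fun n (_ : n ∈ A) => hasSum_pairing hw hu (hfin n) (hi n)
      refine le_of_tendsto' (continuous_enorm.continuousAt.tendsto.comp hs') fun B => ?_
      rw [Function.comp_apply, Finset.sum_comm, hM, ← mul_assoc]
      exact enorm_pairing_le hs mh hi hhfin hw hW mW hu hU mU hv₄.1 hv4 hvu₄ A B hA)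
  have hroot := ENNReal.rpow_le_rpow hdual (by norm_num : (0 : ℝ) ≤ 1 / 2)
  rw [rpow_half_sq] at hroot
  have hneg := weightedNorm_weightNeg_le (by linarith) hu hU mU hv₂ hvu₂
  rw [← n2] at hneg
  have hI : ENNReal.ofReal lam ^ (1 / 4 : ℝ) * I ≤ eLpNorm v₄ 4 volume := by
    rw [n4]; exact rpow_quarter_mul_le
  set T := eLpNorm v₂ 2 volume + eLpNorm v₄ 4 volume + xNorm lam (s - 1) 1 u
  have t2 : eLpNorm v₂ 2 volume ≤ T := le_self_add.trans le_self_add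
  have t4 : eLpNorm v₄ 4 volume ≤ T := le_add_self.trans le_self_add
  have tx : xNorm lam (s - 1) 1 u ≤ T := le_add_self
  refine (mul_le_mul_right hroot _).trans ?_
  calc _ = xNorm lam (s + 1 / 2) (1 / 2) w * (240 * 24 * sobolevConst ^ (1 / 4 : ℝ) *
        (ENNReal.ofReal lam ^ (1 / 4 : ℝ) * I) +
        ENNReal.ofReal (freezeConst s) * trilinearConst * (ENNReal.ofReal lam ^ (1 / 2 : ℝ) *
          weightedNorm (weightNeg lam s) U)) := by
        rw [hXw, hM]; ring
    _ ≤ xNorm lam (s + 1 / 2) (1 / 2) w * (240 * 24 * sobolevConst ^ (1 / 4 : ℝ) * T +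
        ENNReal.ofReal (freezeConst s) * trilinearConst *
          (2 * (ENNReal.ofReal (2 ^ s) ^ (1 / 2 : ℝ) * T + T))) := by
        refine mul_le_mul_right (add_le_add (mul_le_mul_right (hI.trans t4) _)
          (mul_le_mul_right (hneg.trans ?_) _)) _
        gcongr
    _ = _ := by unfold bilinearConst; ring

end BOTorus

theorem proposition7p2 (η : ℝ → ℝ) (hη : IsCutoff η) (s : ℝ) (hs : 1 / 4 ≤ s) :
    ∃ C : ℝ≥0, ∀ (lam : ℝ) [Fact (1 ≤ lam)] (W u : ℝ × Torus lam → ℂ),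
      MemLp W 2 volume → MemLp u 2 volume →
      xNorm lam (s + 1 / 2) (1 / 2) (coeffs W) < ∞ →
      spaceTimeNorm lam 2 (bessel lam s (coeffs u)) < ∞ →
      spaceTimeNorm lam 4 (bessel lam s (coeffs u)) < ∞ →
      xNorm lam (s - 1) 1 (coeffs u) < ∞ →
      ProductDefined (coeffs W) (projNeg lam (dx lam (coeffs u))) ∧
      xNorm lam (s + 1 / 2) (-(1 / 2))
          (projPosHigh η lam (product (coeffs W) (projNeg lam (dx lam (coeffs u))))) ≤
        C * xNorm lam (s + 1 / 2) (1 / 2) (coeffs W) *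
          (spaceTimeNorm lam 2 (bessel lam s (coeffs u)) +
            spaceTimeNorm lam 4 (bessel lam s (coeffs u)) +
            xNorm lam (s - 1) 1 (coeffs u)) := by
  refine ⟨(bilinearConst s).toNNReal, fun lam _ W u hW hu hX h2 h4 hXu => ?_⟩
  rw [ENNReal.coe_toNNReal (bilinearConst_ne_top s)]
  have key := fun (v₂ v₄ : ℝ × Torus lam → ℂ) hv₂ hvu₂ hv₄ hvu₄ =>
    xNorm_product_le (v₂ := v₂) (v₄ := v₄) hη hs (memLp_coeffs hW) (memLp_coeffs hu) hX
      hv₂ hvu₂ hv₄ hvu₄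
  have hK := ENNReal.mul_ne_top (bilinearConst_ne_top s) hX.ne
  refine ⟨?_, ?_⟩
  · obtain ⟨v₂, hv₂, hvu₂, -⟩ := spaceTimeNorm_lt_iff.1 h2
    obtain ⟨v₄, hv₄, hvu₄, -⟩ := spaceTimeNorm_lt_iff.1 h4
    exact (key v₂ v₄ hv₂ hvu₂ hv₄ hvu₄).1
  · rw [add_right_comm]
    -- The two infima are approached independently: the versions used for the L² and for the L⁴ norm
    -- need not be the same function.
    refine le_mul_add_of_forall_lt hK h4 fun t₄ ht₄ => ?_
    rw [add_assoc (spaceTimeNorm lam 2 _), add_comm (spaceTimeNorm lam 2 _)]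
    refine le_mul_add_of_forall_lt hK h2 fun t₂ ht₂ => ?_
    obtain ⟨v₂, hv₂, hvu₂, hn₂⟩ := spaceTimeNorm_lt_iff.1 ht₂
    obtain ⟨v₄, hv₄, hvu₄, hn₄⟩ := spaceTimeNorm_lt_iff.1 ht₄
    refine (key v₂ v₄ hv₂ hvu₂ hv₄ hvu₄).2.trans (mul_le_mul_right ?_ _)
    exact (add_le_add (add_le_add hn₂.le hn₄.le) le_rfl).trans_eq (by ring)
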